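/- Let $k$ be a commutative unital ring and let $\mathsf{Ch}$ be the symmetric monoidal category of $\mathbb{Z}$-graded differential graded $k$-modules (homological grading, Koszul sign rule). **The prop $\mathcal{M}$ and its Hopf structure.** Let $\mathcal{M}$ be the prop in $\mathsf{Ch}$ generated by a counit $\epsilon$ of biarity $(1,0)$ and degree $0$, a coproduct $\Delta$ of biarity $(1,2)$ and degree $0$, and a product $*$ of biarity $(2,1)$ and degree $1$, with $\partial\epsilon=0$, $\partial\Delta=0$, $\partial(*)=\epsilon\otimes\mathrm{id}-\mathrm{id}\otimes\epsilon$, subject to the relations $(\epsilon\otimes\mathrm{id})\Delta=\mathrm{id}=(\mathrm{id}\otimes\epsilon)\Delta$, $(\Delta\otimes\mathrm{id})\Delta=(\mathrm{id}\otimes\Delta)\Delta$ and $\epsilon\circ *=0$. It is a Hopf prop: there is a (unique) prop morphism $\Delta_{\mathcal M}\colon\mathcal{M}\to\mathcal{M}\otimes\mathcal{M}$ to the aritywise tensor product with $\epsilon\mapsto\epsilon\otimes\epsilon$, $\Delta\mapsto\Delta\otimes\Delta$, $*\mapsto(\mathrm{id}\otimes\epsilon)\otimes{*}+{*}\otimes(\epsilon\otimes\mathrm{id})$;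 it is coassociative, and counital for the prop morphism to $k$ with $\epsilon,\Delta\mapsto1$, $*\mapsto0$. Let $U(\mathcal{M})$ be the operad with $U(\mathcal{M})(r)=\mathcal{M}(1,r)$. A $U(\mathcal{M})$-coalgebra is a complex $C$ together with a morphism of operads from $U(\mathcal{M})$ to the coendomorphism operad $\{\mathrm{Hom}(C,C^{\otimes r})\}_{r\ge0}$ of $C$; a morphism of $U(\mathcal{M})$-coalgebras is a chain map compatible with the operations. The category $\mathsf{coAlg}_{U(\mathcal{M})}$ is monoidal: $C\otimes D$ is the tensor product of complexes, on which $\mathcal{M}(1,r)$ acts through $\Delta_{\mathcal M}$ followed by the shuffle $C^{\otimes r}\otimes D^{\otimes r}\cong(C\otimes D)^{\otimes r}$, and the unit is $k$, on which $\mathcal{M}(1,r)$ acts through the counit of $\Delta_{\mathcal M}$. **Chains on cubes.** Let $\square$ be the category with objects $2^n=\{0,1\}^n$, $n\ge0$, whose morphisms are the maps generated under composition and cartesian products by the two inclusions $2^0\to2^1$, the projection $2^1\to2^0$ and the connection $\max\colon2^2\to2^1$; it is strict monoidal with $2^p\otimes2^q=2^{p+q}$. Let $\mathrm{C}(\square^1)$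 be the complex with basis $[0],[1]$ in degree $0$ and $[0,1]$ in degree $1$, with $\partial[0,1]=[1]-[0]$, and let $\mathrm{C}(\square^n)=\mathrm{C}(\square^1)^{\otimes n}$, whose basis is the set of faces $x_1\otimes\dots\otimes x_n$ of the $n$-cube. A morphism $f\colon2^m\to2^n$ of $\square$ sends a face $x$ to the face $f(x)$ if $f$ maps the vertices of $x$ bijectively onto those of a face $f(x)$, and to $0$ otherwise. Let $\epsilon$ be the augmentation, with value $1$ on each vertex; let $\Delta$ be the Serre diagonal, the tensor power of $[0]\mapsto[0]\otimes[0]$, $[1]\mapsto[1]\otimes[1]$, $[0,1]\mapsto[0]\otimes[0,1]+[0,1]\otimes[1]$; and let $$x*y=(-1)^{|x|}\sum_{i=1}^n x_1\otimes\dots\otimes x_{i-1}\,\epsilon(y_1)\cdots\epsilon(y_{i-1})\otimes (x_i*y_i)\otimes\epsilon(x_{i+1})\cdots\epsilon(x_n)\,y_{i+1}\otimes\dots\otimes y_n,$$ where $[0]*[1]=[0,1]$, $[1]*[0]=-[0,1]$, and all other products of basis elements of $\mathrm{C}(\square^1)$ vanish. With these operations the complexes $\mathrm{C}(\square^n)$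 form a functor $\mathrm{C}\colon\square\to\mathsf{coAlg}_{U(\mathcal{M})}$. **Cubical chains.** Let $\mathsf{cSet}$ be the category of presheaves of sets on $\square$, with the monoidal structure given by Day convolution, and let $\square^n\in\mathsf{cSet}$ be the presheaf represented by $2^n$. Let $\mathrm{N}^{\square}_{U(\mathcal{M})}\colon\mathsf{cSet}\to\mathsf{coAlg}_{U(\mathcal{M})}$ be the functor of cubical chains, i.e. the (pointwise) left Kan extension of $\mathrm{C}$ along the Yoneda embedding $\square\to\mathsf{cSet}$, $Y\mapsto\mathrm{colim}_{\square^n\to Y}\mathrm{C}(\square^n)$. **Lemma.** The functor $\mathrm{N}^{\square}_{U(\mathcal{M})}$ exists and is (strongly) monoidal. More precisely, the pointwise left Kan extension exists, and every left Kan extension $\mathrm{N}$ of $\mathrm{C}$ along the Yoneda embedding admits a strong monoidal structure with isomorphisms $\mathrm{N}(X)\otimes\mathrm{N}(Y)\cong\mathrm{N}(X\otimes Y)$ which, for $X=\square^p$ and $Y=\square^q$, correspond to the isomorphism of $U(\mathcal{M})$-coalgebras $$\mathrm{C}(\square^p)\otimes\mathrm{C}(\square^q)\cong\mathrm{C}(\square^{p+q}),\qquad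 (x_1\otimes\dots\otimes x_p)\otimes(y_1\otimes\dots\otimes y_q)\mapsto x_1\otimes\dots\otimes x_p\otimes y_1\otimes\dots\otimes y_q .$$ -/

import Mathlib

open CategoryTheory MonoidalCategory
open scoped TensorProduct

universe u v w

noncomputable section

namespace CubChains

section

/-- The sign `(-1)^a` as an element of `k`. -/
def sg (k : Type u) [CommRing k] (a : ℤ) : k := ((a.negOnePow : ℤˣ) : ℤ)

section sg
variable {k : Type u} [CommRing k]

theorem sg_add (a b : ℤ) : sg k (a + b) = sg k a * sg k b := by
  simp [sg, Int.negOnePow_add]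

theorem sg_congr {a b : ℤ} (h : (a : ZMod 2) = b) : sg k a = sg k b := by
  have h2 : Even (a - b) := by
    rw [← ZMod.intCast_eq_zero_iff_even]; push_cast; rw [h, sub_self]
  have h3 : a.negOnePow = b.negOnePow := by
    rw [Int.negOnePow_eq_iff]; exact h2
  simp [sg, h3]

@[simp] theorem sg_zero : sg k 0 = 1 := by simp [sg]

@[simp] theorem sg_one : sg k 1 = -1 := by simp [sg]

theorem sg_self (a : ℤ) : sg k a * sg k a = 1 := by
  rw [← sg_add, ← sg_zero]
  apply sg_congr
  push_cast
  generalize (a : ZMod 2) = x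
  revert x; decide

end sg

/-- A differential (homologically) graded `k`-module: a `k`-module with an internal grading by
the integers and a differential of degree `-1`. -/
structure DGMod (k : Type u) [CommRing k] where
  carrier : Type u
  [grp : AddCommGroup carrier]
  [mod : Module k carrier]
  gr : ℤ → Submodule k carrier
  internal : DirectSum.IsInternal gr
  d : carrier →ₗ[k] carrier
  d_mem : ∀ {n : ℤ} {x : carrier}, x ∈ gr n → d x ∈ gr (n - 1)
  d_d : ∀ x : carrier, d (d x) = 0

namespace DGMod

variable {k : Type u} [CommRing k]

instance : CoeSort (DGMod k) (Type u) := ⟨DGMod.carrier⟩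

attribute [instance] DGMod.grp DGMod.mod

/-- Linear maps agreeing on homogeneous elements are equal. -/
theorem lin_ext {C : DGMod k} {E : Type*} [AddCommMonoid E] [Module k E] {f g : C →ₗ[k] E}
    (h : ∀ (i : ℤ) (x : C), x ∈ C.gr i → f x = g x) : f = g := by
  have key : f.comp (DirectSum.coeLinearMap C.gr) = g.comp (DirectSum.coeLinearMap C.gr) := by
    apply DirectSum.linearMap_ext
    intro i
    ext x
    simpa using h i x x.2
  ext x
  obtain ⟨y, rfl⟩ := C.internal.surjective x
  exact LinearMap.congr_fun key y

theorem lin_ext₂ {C D : DGMod k} {E : Type*} [AddCommMonoid E] [Module k E]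
    {f g : C ⊗[k] D →ₗ[k] E}
    (h : ∀ (i j : ℤ) (x : C) (y : D), x ∈ C.gr i → y ∈ D.gr j → f (x ⊗ₜ y) = g (x ⊗ₜ y)) :
    f = g := by
  apply TensorProduct.ext
  apply lin_ext; intro i x hx
  apply lin_ext; intro j y hy
  exact h i j x y hx hy

/-- The decomposition into homogeneous components. -/
def dec (C : DGMod k) : C ≃ₗ[k] DirectSum ℤ fun n => C.gr n :=
  (LinearEquiv.ofBijective (DirectSum.coeLinearMap C.gr)
    (show Function.Bijective (DirectSum.coeLinearMap C.gr) from C.internal)).symm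

theorem dec_apply {C : DGMod k} {n : ℤ} {x : C} (hx : x ∈ C.gr n) :
    C.dec x = DirectSum.lof k ℤ (fun i => C.gr i) n ⟨x, hx⟩ := by
  rw [dec, LinearEquiv.symm_apply_eq]; simp

/-- The linear map that multiplies elements of degree `n` by `(-1)^(m * n)`. -/
def sgn (C : DGMod k) (m : ℤ) : C →ₗ[k] C :=
  (DirectSum.toModule k ℤ C fun n => sg k (m * n) • (C.gr n).subtype) ∘ₗ C.dec.toLinearMap

theorem sgn_apply {C : DGMod k} (m : ℤ) {n : ℤ} {x : C} (hx : x ∈ C.gr n) :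
    C.sgn m x = sg k (m * n) • x := by
  simp [sgn, dec_apply hx]

/-- A linear map that raises degrees by `m`. -/
def IsDeg (C D : DGMod k) (m : ℤ) (f : C →ₗ[k] D) : Prop :=
  ∀ (n : ℤ) (x : C), x ∈ C.gr n → f x ∈ D.gr (m + n)

/-- The `k`-module of linear maps of degree `m`. -/
def homDeg (C D : DGMod k) (m : ℤ) : Submodule k (C →ₗ[k] D) where
  carrier := {f | IsDeg C D m f}
  add_mem' := fun hf hg n x hx => (D.gr _).add_mem (hf n x hx) (hg n x hx)
  zero_mem' := fun _ _ _ => (D.gr _).zero_mem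
  smul_mem' := fun c _ hf n x hx => (D.gr _).smul_mem c (hf n x hx)

theorem sgn_mem {C : DGMod k} (m : ℤ) {n : ℤ} {x : C} (hx : x ∈ C.gr n) : C.sgn m x ∈ C.gr n := by
  rw [sgn_apply m hx]; exact (C.gr n).smul_mem _ hx

/-- The pieces of the usual grading of a tensor product. -/
def tgr (C D : DGMod k) (n : ℤ) : Submodule k (C ⊗[k] D) :=
  ⨆ p : {p : ℤ × ℤ // p.1 + p.2 = n},
    Submodule.map₂ (TensorProduct.mk k C D) (C.gr p.1.1) (D.gr p.1.2)

theorem tmul_mem {C D : DGMod k} {i j n : ℤ} (h : i + j = n) {x : C} {y : D} (hx : x ∈ C.gr i)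
    (hy : y ∈ D.gr j) : x ⊗ₜ[k] y ∈ tgr C D n :=
  (le_iSup (fun p : {p : ℤ × ℤ // p.1 + p.2 = n} =>
    Submodule.map₂ (TensorProduct.mk k C D) (C.gr p.1.1) (D.gr p.1.2)) ⟨(i, j), h⟩)
      (Submodule.apply_mem_map₂ (TensorProduct.mk k C D) hx hy)

theorem tgr_le {C D : DGMod k} {n : ℤ} {S : Submodule k (C ⊗[k] D)}
    (h : ∀ (i j : ℤ) (x : C) (y : D), i + j = n → x ∈ C.gr i → y ∈ D.gr j → x ⊗ₜ[k] y ∈ S) :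
    tgr C D n ≤ S := by
  apply iSup_le
  rintro ⟨⟨i, j⟩, hij⟩
  rw [Submodule.map₂_le]
  intro x hx y hy
  exact h i j x y hij hx hy

/-- The decomposition of a tensor product into its homogeneous pieces. -/
def tdec (C D : DGMod k) : C ⊗[k] D →ₗ[k] DirectSum ℤ fun n => tgr C D n :=
  (DirectSum.toModule k (ℤ × ℤ) _ fun p =>
    DirectSum.lof k ℤ (fun n => tgr C D n) (p.1 + p.2) ∘ₗ
      LinearMap.codRestrict (tgr C D (p.1 + p.2))
        (TensorProduct.map (C.gr p.1).subtype (D.gr p.2).subtype) (by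
          intro z
          induction z with
          | zero => simp
          | tmul x y => exact tmul_mem rfl x.2 y.2
          | add a b ha hb => rw [map_add]; exact Submodule.add_mem _ ha hb)) ∘ₗ
    (TensorProduct.directSum k k (fun i => C.gr i) (fun j => D.gr j)).toLinearMap ∘ₗ
      TensorProduct.map C.dec.toLinearMap D.dec.toLinearMap

theorem tdec_tmul {C D : DGMod k} {i j n : ℤ} (h : i + j = n) {x : C} {y : D} (hx : x ∈ C.gr i)
    (hy : y ∈ D.gr j) :
    tdec C D (x ⊗ₜ y) = DirectSum.lof k ℤ (fun n => tgr C D n) n ⟨x ⊗ₜ y, tmul_mem h hx hy⟩ := by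
  subst h
  simp only [tdec, LinearMap.comp_apply, TensorProduct.map_tmul, LinearEquiv.coe_coe,
    dec_apply hx, dec_apply hy, TensorProduct.directSum_lof_tmul_lof, DirectSum.toModule_lof]
  rfl

theorem isInternal_mk {M : Type*} [AddCommGroup M] [Module k M] (gr : ℤ → Submodule k M)
    (δ : M →ₗ[k] DirectSum ℤ fun n => gr n)
    (h1 : ∀ n (z : M), z ∈ gr n → ∃ w, δ z = DirectSum.lof k ℤ (fun n => gr n) n w)
    (h2 : DirectSum.coeLinearMap gr ∘ₗ δ = LinearMap.id) : DirectSum.IsInternal gr := by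
  have key : ∀ n (z : M) (hz : z ∈ gr n),
      δ z = DirectSum.lof k ℤ (fun n => gr n) n ⟨z, hz⟩ := by
    intro n z hz
    obtain ⟨w, hw⟩ := h1 n z hz
    have h3 := LinearMap.congr_fun h2 z
    rw [LinearMap.comp_apply, hw, DirectSum.coeLinearMap_lof, LinearMap.id_apply] at h3
    rw [hw]
    congr 1
    exact Subtype.ext h3
  have h3 : δ ∘ₗ (DirectSum.coeLinearMap gr) = LinearMap.id := by
    apply DirectSum.linearMap_ext
    intro n
    ext z : 1
    simp only [LinearMap.comp_apply, DirectSum.coeLinearMap_lof, LinearMap.id_apply]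
    exact key n z z.2
  exact ⟨(show Function.LeftInverse δ (DirectSum.coeLinearMap gr) from
    fun z => LinearMap.congr_fun h3 z).injective,
    (show Function.RightInverse δ (DirectSum.coeLinearMap gr) from
    fun z => LinearMap.congr_fun h2 z).surjective⟩

theorem tgr_internal (C D : DGMod k) : DirectSum.IsInternal (tgr C D) := by
  apply isInternal_mk (tgr C D) (tdec C D)
  · intro n
    have : tgr C D n ≤ Submodule.comap (tdec C D) (LinearMap.range
        (DirectSum.lof k ℤ (fun n => tgr C D n) n)) := by
      apply tgr_le
      intro i j x y h hx hy
      rw [Submodule.mem_comap, tdec_tmul h hx hy]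
      exact ⟨_, rfl⟩
    intro z hz
    obtain ⟨w, hw⟩ := this hz
    exact ⟨w, hw.symm⟩
  · apply lin_ext₂
    intro i j x y hx hy
    rw [LinearMap.comp_apply, tdec_tmul rfl hx hy]
    simp

/-- The tensor product, with differential `d (x ⊗ y) = d x ⊗ y + (-1)^|x| x ⊗ d y`. -/
abbrev tens (C D : DGMod k) : DGMod k where
  carrier := C ⊗[k] D
  gr := tgr C D
  internal := tgr_internal C D
  d := TensorProduct.map C.d LinearMap.id + TensorProduct.map (C.sgn 1) D.d
  d_mem := by
    intro n x hx
    have : tgr C D n ≤ Submodule.comap (TensorProduct.map C.d LinearMap.id +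
        TensorProduct.map (C.sgn 1) D.d) (tgr C D (n - 1)) := by
      apply tgr_le
      intro i j x y h hx hy
      rw [Submodule.mem_comap]
      exact Submodule.add_mem _ (tmul_mem (by omega) (C.d_mem hx) hy)
        (tmul_mem (by omega) (sgn_mem 1 hx) (D.d_mem hy))
    exact this hx
  d_d := by
    intro z
    have : (TensorProduct.map C.d LinearMap.id + TensorProduct.map (C.sgn 1) D.d) ∘ₗ
        (TensorProduct.map C.d LinearMap.id + TensorProduct.map (C.sgn 1) D.d) = 0 := by
      apply lin_ext₂
      intro i j x y hx hy
      simp only [LinearMap.comp_apply, LinearMap.add_apply, TensorProduct.map_tmul, map_add,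
        LinearMap.id_apply, C.d_d, D.d_d, sgn_apply _ hx, sgn_apply _ (C.d_mem hx), map_smul]
      have : sg k (i - 1) = - sg k i := by
        rw [← neg_one_mul, ← sg_one, ← sg_add]; apply sg_congr
        push_cast; generalize (i : ZMod 2) = x; revert x; decide
      simp [TensorProduct.neg_tmul, ← TensorProduct.smul_tmul', this]
    exact LinearMap.congr_fun this z

/-- The unit: `k` in degree `0`. -/
abbrev unit (k : Type u) [CommRing k] : DGMod k where
  carrier := k
  gr := fun n => if n = 0 then ⊤ else ⊥
  internal := by
    apply isInternal_mk _ ((DirectSum.lof k ℤ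
      (fun n : ℤ => ((if n = 0 then ⊤ else ⊥ : Submodule k k) : Type u)) 0) ∘ₗ
        LinearMap.codRestrict _ LinearMap.id (by simp))
    · intro n z hz
      by_cases h : n = 0
      · subst h; exact ⟨_, rfl⟩
      · simp only [h, if_false, Submodule.mem_bot] at hz
        subst hz
        exact ⟨0, by simp⟩
    · ext; simp
  d := 0
  d_mem := fun _ => Submodule.zero_mem _
  d_d := fun _ => rfl

/-- Morphisms: chain maps. -/
@[ext] structure Hom (C D : DGMod k) where
  lin : C →ₗ[k] D
  deg : ∀ {n : ℤ} {x : C}, x ∈ C.gr n → lin x ∈ D.gr n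
  comm : ∀ x : C, lin (C.d x) = D.d (lin x)

instance : Category (DGMod k) where
  Hom := Hom
  id C := ⟨LinearMap.id, fun h => h, fun _ => rfl⟩
  comp f g := ⟨g.lin ∘ₗ f.lin, fun h => g.deg (f.deg h), fun x => by simp [f.comm, g.comm]⟩

@[ext] theorem hom_ext {C D : DGMod k} {f g : C ⟶ D} (h : f.lin = g.lin) : f = g := Hom.ext h

@[simp] theorem id_lin (C : DGMod k) : Hom.lin (𝟙 C) = LinearMap.id := rfl

@[simp] theorem comp_lin {C D E : DGMod k} (f : C ⟶ D) (g : D ⟶ E) :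
    (f ≫ g).lin = g.lin ∘ₗ f.lin := rfl

theorem tens_d_tmul {C D : DGMod k} {i : ℤ} {x : C} (hx : x ∈ C.gr i) (y : D) :
    (tens C D).d (x ⊗ₜ y) = C.d x ⊗ₜ y + sg k i • (x ⊗ₜ[k] D.d y) := by
  change C.d x ⊗ₜ y + C.sgn 1 x ⊗ₜ D.d y = _
  rw [sgn_apply 1 hx, one_mul, TensorProduct.smul_tmul']

theorem mem_gr_zero (r : k) : r ∈ (unit k).gr 0 := by
  change r ∈ (if (0 : ℤ) = 0 then ⊤ else ⊥ : Submodule k k); simp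

theorem one_mem_gr : (1 : k) ∈ (unit k).gr 0 := mem_gr_zero 1

theorem unit_gr {n : ℤ} (hn : n ≠ 0) {r : k} (hr : r ∈ (unit k).gr n) : r = 0 := by
  change r ∈ (if n = 0 then ⊤ else ⊥ : Submodule k k) at hr
  simpa [hn] using hr

/-- A linear map out of a tensor product preserves degrees if it does so on pure tensors. -/
theorem deg_tens {C D E : DGMod k} {f : C ⊗[k] D →ₗ[k] E} {m : ℤ}
    (h : ∀ (i j : ℤ) (x : C) (y : D), x ∈ C.gr i → y ∈ D.gr j → f (x ⊗ₜ y) ∈ E.gr (m + (i + j))) :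
    IsDeg (tens C D) E m f := by
  intro n x hx
  have : tgr C D n ≤ Submodule.comap f (E.gr (m + n)) := by
    apply tgr_le
    rintro i j x y rfl hx hy
    exact h i j x y hx hy
  exact this hx

/-- Constructor for morphisms out of a tensor product. -/
def homMk₂ {C D E : DGMod k} (f : C ⊗[k] D →ₗ[k] E)
    (h : ∀ (i j : ℤ) (x : C) (y : D), x ∈ C.gr i → y ∈ D.gr j → f (x ⊗ₜ y) ∈ E.gr (i + j))
    (h' : ∀ (i j : ℤ) (x : C) (y : D), x ∈ C.gr i → y ∈ D.gr j →
      f (C.d x ⊗ₜ y) + sg k i • f (x ⊗ₜ[k] D.d y) = E.d (f (x ⊗ₜ y))) : tens C D ⟶ E where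
  lin := f
  deg {n x} hx := by
    have : IsDeg (tens C D) E 0 f := deg_tens (fun i j x y hx hy => by
      rw [zero_add]; exact h i j x y hx hy)
    have := this n x hx
    rwa [zero_add] at this
  comm x := by
    have : f ∘ₗ (tens C D).d = E.d ∘ₗ f := by
      apply lin_ext₂
      intro i j x y hx hy
      have := h' i j x y hx hy
      rw [LinearMap.comp_apply, tens_d_tmul hx, map_add, map_smul, this, LinearMap.comp_apply]
    exact LinearMap.congr_fun this x

/-- The tensor product of morphisms. -/
def mapT {C C' D D' : DGMod k} (f : C ⟶ C') (g : D ⟶ D') : tens C D ⟶ tens C' D' :=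
  homMk₂ (TensorProduct.map f.lin g.lin)
    (fun i j x y hx hy => tmul_mem rfl (f.deg hx) (g.deg hy))
    (fun i j x y hx hy => by
      simp only [TensorProduct.map_tmul]
      rw [tens_d_tmul (f.deg hx), f.comm, g.comm])

/-- Isomorphisms from linear equivalences. -/
def isoMk {C D : DGMod k} (f : C ⟶ D) (e : C ≃ₗ[k] D) (h : f.lin = e.toLinearMap)
    (he : ∀ (n : ℤ) (y : D), y ∈ D.gr n → e.symm y ∈ C.gr n) : C ≅ D where
  hom := f
  inv :=
    { lin := e.symm.toLinearMap
      deg := fun hy => he _ _ hy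
      comm := fun y => by
        have := f.comm (e.symm y)
        rw [h] at this
        simp only [LinearEquiv.coe_coe, LinearEquiv.apply_symm_apply] at this
        rw [← this]
        simp }
  hom_inv_id := by ext x; simp [h]
  inv_hom_id := by ext x; simp [h]

theorem deg_symm_tens {C D E : DGMod k} (e : E ≃ₗ[k] C ⊗[k] D)
    (h : ∀ (i j : ℤ) (x : C) (y : D), x ∈ C.gr i → y ∈ D.gr j → e.symm (x ⊗ₜ y) ∈ E.gr (i + j)) :
    ∀ (n : ℤ) (y : C ⊗[k] D), y ∈ (tens C D).gr n → e.symm y ∈ E.gr n := by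
  intro n y hy
  have : tgr C D n ≤ Submodule.comap e.symm.toLinearMap (E.gr n) := by
    apply tgr_le
    rintro i j x y rfl hx hy
    exact h i j x y hx hy
  exact this hy

/-- The associator. -/
def assocIso (C D E : DGMod k) : tens (tens C D) E ≅ tens C (tens D E) :=
  isoMk (homMk₂ (TensorProduct.assoc k C D E).toLinearMap
      (by
        intro i j x z hx hz
        have : tgr C D i ≤ Submodule.comap ((TensorProduct.assoc k C D E).toLinearMap ∘ₗ
            (TensorProduct.mk k (C ⊗[k] D) E).flip z) (tgr C (tens D E) (i + j)) := by
          apply tgr_le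
          intro a b x y h hx hy
          exact tmul_mem (C := C) (D := tens D E) (j := b + j) (by omega) hx (tmul_mem rfl hy hz)
        exact this hx)
      (by
        intro i j x z hx hz
        have : ∀ (x : C ⊗[k] D), x ∈ tgr C D i → x ∈ LinearMap.eqLocus
          ((TensorProduct.assoc k C D E).toLinearMap ∘ₗ
            ((TensorProduct.mk k (C ⊗[k] D) E).flip z ∘ₗ (tens C D).d +
            sg k i • (TensorProduct.mk k (C ⊗[k] D) E).flip (E.d z)))
          ((tens C (tens D E)).d ∘ₗ (TensorProduct.assoc k C D E).toLinearMap ∘ₗ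
            (TensorProduct.mk k (C ⊗[k] D) E).flip z) := by
          apply tgr_le
          rintro a b x y rfl hx hy
          simp only [LinearMap.mem_eqLocus, LinearMap.comp_apply, LinearMap.add_apply,
            LinearMap.smul_apply, LinearMap.flip_apply, TensorProduct.mk_apply, LinearEquiv.coe_coe,
            TensorProduct.assoc_tmul, tens_d_tmul (C := C) (D := D) hx,
            tens_d_tmul (C := C) (D := tens D E) hx, tens_d_tmul (C := D) (D := E) hy]
          simp only [TensorProduct.add_tmul, TensorProduct.tmul_add, map_add, smul_add,
            ← TensorProduct.smul_tmul', TensorProduct.tmul_smul, map_smul, smul_smul,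
            TensorProduct.assoc_tmul, sg_add, add_assoc]
        have := this x hx
        rw [LinearMap.mem_eqLocus] at this
        refine Eq.trans ?_ this
        change _ = TensorProduct.assoc k C D E ((tens C D).d x ⊗ₜ z + sg k i • (x ⊗ₜ E.d z))
        rw [map_add, map_smul]; rfl))
    (TensorProduct.assoc k C D E) rfl
    (by
      apply deg_symm_tens (C := C) (D := tens D E) (E := tens (tens C D) E)
      intro i j x z hx hz
      have : tgr D E j ≤ Submodule.comap ((TensorProduct.assoc k C D E).symm.toLinearMap ∘ₗ
          (TensorProduct.mk k C (D ⊗[k] E)) x) (tgr (tens C D) E (i + j)) := by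
        apply tgr_le
        intro a b y z h hy hz
        exact tmul_mem (C := tens C D) (D := E) (i := i + a) (by omega) (tmul_mem rfl hx hy) hz
      exact this hz)

/-- The left unitor. -/
def lunitIso (C : DGMod k) : tens (unit k) C ≅ C :=
  isoMk (homMk₂ (TensorProduct.lid k C).toLinearMap
      (by
        intro i j x y hx hy
        by_cases hi : i = 0
        · subst hi; simpa using (C.gr j).smul_mem x hy
        · rw [unit_gr hi hx]; simp)
      (by
        intro i j x y hx hy
        by_cases hi : i = 0
        · subst hi; simp
        · rw [unit_gr hi hx]; simp))
    (TensorProduct.lid k C) rfl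
    (fun n y hy => by
      simpa using tmul_mem (C := unit k) (D := C) (zero_add n) one_mem_gr hy)

/-- The right unitor. -/
def runitIso (C : DGMod k) : tens C (unit k) ≅ C :=
  isoMk (homMk₂ (TensorProduct.rid k C).toLinearMap
      (by
        intro i j x y hx hy
        by_cases hi : j = 0
        · subst hi; simpa using (C.gr i).smul_mem y hx
        · rw [unit_gr hi hy]; simp)
      (by
        intro i j x y hx hy
        by_cases hi : j = 0
        · subst hi; simp
        · rw [unit_gr hi hy]; simp))
    (TensorProduct.rid k C) rfl
    (fun n y hy => by
      simpa using tmul_mem (C := C) (D := unit k) (add_zero n) hy one_mem_gr)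

instance : MonoidalCategoryStruct (DGMod k) where
  tensorObj := tens
  tensorUnit := unit k
  tensorHom := mapT
  whiskerLeft C _ _ f := mapT (𝟙 C) f
  whiskerRight f D := mapT f (𝟙 D)
  associator := assocIso
  leftUnitor := lunitIso
  rightUnitor := runitIso

instance : MonoidalCategory (DGMod k) := MonoidalCategory.ofTensorHom
  (id_tensorHom_id := fun C D => hom_ext (TensorProduct.ext' fun _ _ => rfl))
  (id_tensorHom := fun C _ _ f => rfl)
  (tensorHom_id := fun f D => rfl)
  (tensorHom_comp_tensorHom := fun f g f' g' => hom_ext (TensorProduct.ext' fun _ _ => rfl))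
  (associator_naturality := fun f g h => hom_ext (TensorProduct.ext_threefold fun _ _ _ => rfl))
  (leftUnitor_naturality := fun f => hom_ext (TensorProduct.ext' fun r x => by
    exact (map_smul f.lin r x).symm))
  (rightUnitor_naturality := fun f => hom_ext (TensorProduct.ext' fun x r => by
    exact (map_smul f.lin r x).symm))
  (pentagon := fun A B C D => hom_ext (TensorProduct.ext_fourfold fun _ _ _ _ => rfl))
  (triangle := fun C D => hom_ext (TensorProduct.ext_threefold fun x r y => by
    exact (TensorProduct.smul_tmul r x y).symm))

/-- The underlying map of the braiding. -/
def braidLin (C D : DGMod k) : C ⊗[k] D →ₗ[k] D ⊗[k] C :=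
  TensorProduct.lift ((DirectSum.toModule k ℤ (D →ₗ[k] D ⊗[k] C) fun i =>
    (((TensorProduct.mk k D C).flip).compr₂ (LinearMap.rTensor C (D.sgn i))) ∘ₗ
      (C.gr i).subtype) ∘ₗ C.dec.toLinearMap)

theorem braidLin_tmul' {C D : DGMod k} {i : ℤ} {x : C} (y : D) (hx : x ∈ C.gr i) :
    braidLin C D (x ⊗ₜ y) = D.sgn i y ⊗ₜ x := by
  simp [braidLin, dec_apply hx]

/-- The braiding is `x ⊗ y ↦ (-1)^(|x| |y|) y ⊗ x`. -/
theorem braidLin_tmul {C D : DGMod k} {i j : ℤ} {x : C} {y : D} (hx : x ∈ C.gr i)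
    (hy : y ∈ D.gr j) : braidLin C D (x ⊗ₜ y) = sg k (i * j) • (y ⊗ₜ x) := by
  rw [braidLin_tmul' y hx, sgn_apply i hy, TensorProduct.smul_tmul']

/-- The braiding as a chain map. -/
def braidHom (C D : DGMod k) : tens C D ⟶ tens D C :=
  homMk₂ (braidLin C D)
    (fun i j x y hx hy => by
      rw [braidLin_tmul hx hy]
      exact Submodule.smul_mem _ _ (tmul_mem (add_comm j i) hy hx))
    (fun i j x y hx hy => by
      rw [braidLin_tmul hx hy, map_smul, tens_d_tmul (C := D) (D := C) hy,
        braidLin_tmul (C.d_mem hx) hy, braidLin_tmul hx (D.d_mem hy), smul_add, smul_smul,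
        smul_smul, ← sg_add, ← sg_add, add_comm]
      congr 2
      · apply sg_congr; push_cast
        generalize (i : ZMod 2) = a; generalize (j : ZMod 2) = b; revert a b; decide
      · apply sg_congr; push_cast
        generalize (i : ZMod 2) = a; generalize (j : ZMod 2) = b; revert a b; decide)

theorem braid_braid (C D : DGMod k) : braidHom C D ≫ braidHom D C = 𝟙 _ := by
  apply hom_ext
  apply lin_ext₂
  intro i j x y hx hy
  change braidLin D C (braidLin C D (x ⊗ₜ y)) = x ⊗ₜ y
  rw [braidLin_tmul hx hy, map_smul, braidLin_tmul hy hx, smul_smul, mul_comm j i, sg_self,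
    one_smul]

theorem lin_ext₃ {A B C : DGMod k} {E : Type*} [AddCommMonoid E] [Module k E]
    {f g : (A ⊗[k] B) ⊗[k] C →ₗ[k] E}
    (h : ∀ (i j l : ℤ) (x : A) (y : B) (z : C), x ∈ A.gr i → y ∈ B.gr j → z ∈ C.gr l →
      f ((x ⊗ₜ y) ⊗ₜ z) = g ((x ⊗ₜ y) ⊗ₜ z)) : f = g := by
  apply TensorProduct.ext
  apply lin_ext₂; intro i j x y hx hy
  apply lin_ext; intro l z hz
  exact h i j l x y z hx hy hz

theorem lin_ext₃' {A B C : DGMod k} {E : Type*} [AddCommMonoid E] [Module k E]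
    {f g : A ⊗[k] (B ⊗[k] C) →ₗ[k] E}
    (h : ∀ (i j l : ℤ) (x : A) (y : B) (z : C), x ∈ A.gr i → y ∈ B.gr j → z ∈ C.gr l →
      f (x ⊗ₜ (y ⊗ₜ z)) = g (x ⊗ₜ (y ⊗ₜ z))) : f = g := by
  apply TensorProduct.ext
  apply lin_ext; intro i x hx
  apply lin_ext₂; intro j l y z hy hz
  exact h i j l x y z hx hy hz

instance : BraidedCategory (DGMod k) where
  braiding C D :=
    { hom := braidHom C D
      inv := braidHom D C
      hom_inv_id := braid_braid C D
      inv_hom_id := braid_braid D C }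
  braiding_naturality_right C D E f := hom_ext <| lin_ext₂ fun i j x y hx hy => by
    change braidLin C E (x ⊗ₜ f.lin y) = TensorProduct.map f.lin LinearMap.id (braidLin C D (x ⊗ₜ y))
    rw [braidLin_tmul hx hy, braidLin_tmul hx (f.deg hy), map_smul]; rfl
  braiding_naturality_left f Z := hom_ext <| lin_ext₂ fun i j x y hx hy => by
    change braidLin _ _ (f.lin x ⊗ₜ y) = TensorProduct.map LinearMap.id f.lin (braidLin _ _ (x ⊗ₜ y))
    rw [braidLin_tmul hx hy, braidLin_tmul (f.deg hx) hy, map_smul]; rfl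
  hexagon_forward A B C := hom_ext <| lin_ext₃ fun i j l x y z hx hy hz => by
    change TensorProduct.assoc k B C A (braidLin A (tens B C) (x ⊗ₜ (y ⊗ₜ z))) =
      TensorProduct.map LinearMap.id (braidLin A C) (TensorProduct.assoc k B A C
        (TensorProduct.map (braidLin A B) LinearMap.id ((x ⊗ₜ y) ⊗ₜ z)))
    rw [braidLin_tmul (D := tens B C) hx (tmul_mem rfl hy hz)]
    simp only [map_smul, TensorProduct.map_tmul, braidLin_tmul hx hy, ← TensorProduct.smul_tmul',
      TensorProduct.assoc_tmul, braidLin_tmul hx hz, LinearMap.id_apply, TensorProduct.tmul_smul,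
      smul_smul, ← sg_add, mul_add]
  hexagon_reverse A B C := hom_ext <| lin_ext₃' fun i j l x y z hx hy hz => by
    change (TensorProduct.assoc k C A B).symm (braidLin (tens A B) C ((x ⊗ₜ y) ⊗ₜ z)) =
      TensorProduct.map (braidLin A C) LinearMap.id ((TensorProduct.assoc k A C B).symm
        (TensorProduct.map LinearMap.id (braidLin B C) (x ⊗ₜ (y ⊗ₜ z))))
    rw [braidLin_tmul (C := tens A B) (tmul_mem rfl hx hy) hz]
    simp only [map_smul, TensorProduct.map_tmul, braidLin_tmul hy hz, ← TensorProduct.smul_tmul',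
      TensorProduct.assoc_symm_tmul, braidLin_tmul hx hz, LinearMap.id_apply,
      TensorProduct.tmul_smul, smul_smul, ← sg_add, add_mul]
    congr 2; ring

instance : SymmetricCategory (DGMod k) where
  symmetry := braid_braid

end DGMod

end

section

/-- Bracketed words in a single letter `X`. -/
inductive Word : Type
  | one : Word
  | X : Word
  | tens : Word → Word → Word

namespace Word

/-- The standard word of length `r`. -/
def std : ℕ → Word
  | 0 => one
  | r + 1 => tens (std r) X

end Word

/-- Formal structural isomorphisms of symmetric monoidal categories between bracketed words. -/
inductive Str : Word → Word → Type
  | id (a : Word) : Str a a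
  | comp {a b c : Word} (s : Str a b) (t : Str b c) : Str a c
  | wl (c : Word) {a b : Word} (s : Str a b) : Str (c.tens a) (c.tens b)
  | wr {a b : Word} (s : Str a b) (c : Word) : Str (a.tens c) (b.tens c)
  | assoc (a b c : Word) : Str ((a.tens b).tens c) (a.tens (b.tens c))
  | associ (a b c : Word) : Str (a.tens (b.tens c)) ((a.tens b).tens c)
  | lun (a : Word) : Str (Word.one.tens a) a
  | luni (a : Word) : Str a (Word.one.tens a)
  | run (a : Word) : Str (a.tens Word.one) a
  | runi (a : Word) : Str a (a.tens Word.one)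
  | braid (a b : Word) : Str (a.tens b) (b.tens a)

/-- The relations between structural isomorphisms in a symmetric monoidal category (besides
functoriality and naturality). -/
inductive StrRel : ∀ {a b : Word}, Str a b → Str a b → Prop
  | wl_id (c a : Word) : StrRel (.wl c (.id a)) (.id (c.tens a))
  | wr_id (a c : Word) : StrRel (.wr (.id a) c) (.id (a.tens c))
  | assoc_associ (a b c : Word) : StrRel (.comp (.assoc a b c) (.associ a b c)) (.id _)
  | associ_assoc (a b c : Word) : StrRel (.comp (.associ a b c) (.assoc a b c)) (.id _)
  | lun_luni (a : Word) : StrRel (.comp (.lun a) (.luni a)) (.id _)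
  | luni_lun (a : Word) : StrRel (.comp (.luni a) (.lun a)) (.id _)
  | run_runi (a : Word) : StrRel (.comp (.run a) (.runi a)) (.id _)
  | runi_run (a : Word) : StrRel (.comp (.runi a) (.run a)) (.id _)
  | pentagon (a b c e : Word) : StrRel
      (.comp (.wr (.assoc a b c) e) (.comp (.assoc a (b.tens c) e) (.wl a (.assoc b c e))))
      (.comp (.assoc (a.tens b) c e) (.assoc a b (c.tens e)))
  | triangle (a b : Word) : StrRel (.comp (.assoc a .one b) (.wl a (.lun b))) (.wr (.run a) b)
  | braid_braid (a b : Word) : StrRel (.comp (.braid a b) (.braid b a)) (.id _)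
  | hexagon (a b c : Word) : StrRel
      (.comp (.assoc a b c) (.comp (.braid a (b.tens c)) (.assoc b c a)))
      (.comp (.wr (.braid a b) c) (.comp (.assoc b a c) (.wl b (.braid a c))))

section interpretation
variable {V : Type v} [Category.{w} V] [MonoidalCategory V]

/-- The iterated tensor product of `C` bracketed as the word. -/
def Word.pow (C : V) : Word → V
  | .one => 𝟙_ V
  | .X => C
  | .tens a b => Word.pow C a ⊗ Word.pow C b

/-- The isomorphism of iterated tensor products given by a formal structural isomorphism. -/
def Str.map [BraidedCategory V] (C : V) : ∀ {a b : Word}, Str a b → (a.pow C ⟶ b.pow C)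
  | _, _, .id _ => 𝟙 _
  | _, _, .comp s t => Str.map C s ≫ Str.map C t
  | _, _, .wl c s => c.pow C ◁ Str.map C s
  | _, _, .wr s c => Str.map C s ▷ c.pow C
  | _, _, .assoc a b c => (α_ (a.pow C) (b.pow C) (c.pow C)).hom
  | _, _, .associ a b c => (α_ (a.pow C) (b.pow C) (c.pow C)).inv
  | _, _, .lun a => (λ_ (a.pow C)).hom
  | _, _, .luni a => (λ_ (a.pow C)).inv
  | _, _, .run a => (ρ_ (a.pow C)).hom
  | _, _, .runi a => (ρ_ (a.pow C)).inv
  | _, _, .braid a b => (β_ (a.pow C) (b.pow C)).hom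

theorem Str.map_rel [SymmetricCategory V] (C : V) {a b : Word} {s t : Str a b} (h : StrRel s t) :
    Str.map C s = Str.map C t := by
  cases h <;> simp [Str.map, Word.pow]

end interpretation

/-- A prop over differential graded `k`-modules. Instead of natural numbers, objects are bracketed
words in one letter, so that a prop is a symmetric monoidal category enriched over differential
graded modules whose objects are these words; the component of biarity `(m, n)` is the one from the
standard word of length `m` to the standard word of length `n`. The tensor product of morphisms is
given through the two whiskerings, and `str` is the symmetric monoidal structure. -/
structure DGProp (k : Type u) [CommRing k] where
  Hom : Word → Word → ℤ → Type u
  [grp : ∀ a b n, AddCommGroup (Hom a b n)]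
  [mod : ∀ a b n, Module k (Hom a b n)]
  comp : ∀ {a b c : Word} {i j n : ℤ}, i + j = n → Hom b c i →ₗ[k] Hom a b j →ₗ[k] Hom a c n
  wl : ∀ (c : Word) {a b : Word} {n : ℤ}, Hom a b n →ₗ[k] Hom (c.tens a) (c.tens b) n
  wr : ∀ {a b : Word} {n : ℤ} (c : Word), Hom a b n →ₗ[k] Hom (a.tens c) (b.tens c) n
  d : ∀ {a b : Word} {n m : ℤ}, m + 1 = n → Hom a b n →ₗ[k] Hom a b m
  str : ∀ {a b : Word}, Str a b → Hom a b 0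
  id_comp : ∀ {a b : Word} {n : ℤ} (f : Hom a b n), comp (zero_add n) (str (.id b)) f = f
  comp_id : ∀ {a b : Word} {n : ℤ} (f : Hom a b n), comp (add_zero n) f (str (.id a)) = f
  assoc : ∀ {a b c e : Word} {i j l p q n : ℤ} (h₁ : i + j = p) (h₂ : p + l = n) (h₃ : j + l = q)
    (h₄ : i + q = n) (f : Hom c e i) (g : Hom b c j) (x : Hom a b l),
    comp h₂ (comp h₁ f g) x = comp h₄ f (comp h₃ g x)
  wl_comp : ∀ (e : Word) {a b c : Word} {i j n : ℤ} (h : i + j = n) (f : Hom b c i) (g : Hom a b j),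
    wl e (comp h f g) = comp h (wl e f) (wl e g)
  wr_comp : ∀ (e : Word) {a b c : Word} {i j n : ℤ} (h : i + j = n) (f : Hom b c i) (g : Hom a b j),
    wr e (comp h f g) = comp h (wr e f) (wr e g)
  exchange : ∀ {a a' b b' : Word} {i j n : ℤ} (h : i + j = n) (h' : j + i = n) (f : Hom a a' i)
    (g : Hom b b' j), comp h (wr b' f) (wl a g) = sg k (i * j) • comp h' (wl a' g) (wr b f)
  str_comp : ∀ {a b c : Word} (s : Str a b) (t : Str b c),
    str (.comp s t) = comp (zero_add 0) (str t) (str s)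
  str_wl : ∀ (c : Word) {a b : Word} (s : Str a b), str (.wl c s) = wl c (str s)
  str_wr : ∀ (c : Word) {a b : Word} (s : Str a b), str (.wr s c) = wr c (str s)
  str_rel : ∀ {a b : Word} {s t : Str a b}, StrRel s t → str s = str t
  assoc_left : ∀ {a a' : Word} (b c : Word) {n : ℤ} (f : Hom a a' n),
    comp (zero_add n) (str (.assoc a' b c)) (wr c (wr b f)) =
      comp (add_zero n) (wr (b.tens c) f) (str (.assoc a b c))
  assoc_mid : ∀ (a : Word) {b b' : Word} (c : Word) {n : ℤ} (f : Hom b b' n),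
    comp (zero_add n) (str (.assoc a b' c)) (wr c (wl a f)) =
      comp (add_zero n) (wl a (wr c f)) (str (.assoc a b c))
  assoc_right : ∀ (a b : Word) {c c' : Word} {n : ℤ} (f : Hom c c' n),
    comp (zero_add n) (str (.assoc a b c')) (wl (a.tens b) f) =
      comp (add_zero n) (wl a (wl b f)) (str (.assoc a b c))
  lun_nat : ∀ {a b : Word} {n : ℤ} (f : Hom a b n),
    comp (zero_add n) (str (.lun b)) (wl .one f) = comp (add_zero n) f (str (.lun a))
  run_nat : ∀ {a b : Word} {n : ℤ} (f : Hom a b n),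
    comp (zero_add n) (str (.run b)) (wr .one f) = comp (add_zero n) f (str (.run a))
  braid_nat : ∀ {a a' : Word} (b : Word) {n : ℤ} (f : Hom a a' n),
    comp (zero_add n) (str (.braid a' b)) (wr b f) =
      comp (add_zero n) (wl b f) (str (.braid a b))
  d_d : ∀ {a b : Word} {n m l : ℤ} (h : m + 1 = n) (h' : l + 1 = m) (f : Hom a b n),
    d h' (d h f) = 0
  d_comp : ∀ {a b c : Word} {i i' j j' n m : ℤ} (h : i + j = n) (hi : i' + 1 = i) (hj : j' + 1 = j)
    (hn : m + 1 = n) (h₁ : i' + j = m) (h₂ : i + j' = m) (f : Hom b c i) (g : Hom a b j),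
    d hn (comp h f g) = comp h₁ (d hi f) g + sg k i • comp h₂ f (d hj g)
  d_wl : ∀ (c : Word) {a b : Word} {n m : ℤ} (h : m + 1 = n) (f : Hom a b n),
    d h (wl c f) = wl c (d h f)
  d_wr : ∀ (c : Word) {a b : Word} {n m : ℤ} (h : m + 1 = n) (f : Hom a b n),
    d h (wr c f) = wr c (d h f)
  d_str : ∀ {a b : Word} {m : ℤ} (h : m + 1 = 0) (s : Str a b), d h (str s) = 0

attribute [instance] DGProp.grp DGProp.mod

/-- Elements of a prop satisfying the relations of the presentation of `M`: a counit and a coproduct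
of degree `0` and a product of degree `1`. -/
structure Gens {k : Type u} [CommRing k] (P : DGProp k) where
  cu : P.Hom .X .one 0
  cp : P.Hom .X (.tens .X .X) 0
  pr : P.Hom (.tens .X .X) .X 1
  d_cu : P.d (neg_add_cancel 1) cu = 0
  d_cp : P.d (neg_add_cancel 1) cp = 0
  d_pr : P.d (zero_add 1) pr =
    P.comp (zero_add 0) (P.str (.lun .X)) (P.wr .X cu) -
      P.comp (zero_add 0) (P.str (.run .X)) (P.wl .X cu)
  counit_left : P.comp (zero_add 0) (P.wr .X cu) cp = P.str (.luni .X)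
  counit_right : P.comp (zero_add 0) (P.wl .X cu) cp = P.str (.runi .X)
  coassoc : P.comp (zero_add 0) (P.str (.assoc .X .X .X)) (P.comp (zero_add 0) (P.wr .X cp) cp) =
    P.comp (zero_add 0) (P.wl .X cp) cp
  cu_pr : P.comp (zero_add 1) cu pr = 0

/-- Formal expressions in the operations of a differential graded prop and the three generators. -/
inductive Expr (k : Type u) : Word → Word → ℤ → Type u
  | zero (a b : Word) (n : ℤ) : Expr k a b n
  | add {a b : Word} {n : ℤ} (x y : Expr k a b n) : Expr k a b n
  | smul {a b : Word} {n : ℤ} (r : k) (x : Expr k a b n) : Expr k a b n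
  | comp {a b c : Word} {i j n : ℤ} (h : i + j = n) (x : Expr k b c i) (y : Expr k a b j) :
      Expr k a c n
  | wl (c : Word) {a b : Word} {n : ℤ} (x : Expr k a b n) : Expr k (c.tens a) (c.tens b) n
  | wr (c : Word) {a b : Word} {n : ℤ} (x : Expr k a b n) : Expr k (a.tens c) (b.tens c) n
  | d {a b : Word} {n m : ℤ} (h : m + 1 = n) (x : Expr k a b n) : Expr k a b m
  | str {a b : Word} (s : Str a b) : Expr k a b 0
  | cu : Expr k .X .one 0
  | cp : Expr k .X (.tens .X .X) 0
  | pr : Expr k (.tens .X .X) .X 1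

variable {k : Type u} [CommRing k]

/-- The value of a formal expression. -/
def Expr.eval {P : DGProp k} (G : Gens P) : ∀ {a b : Word} {n : ℤ}, Expr k a b n → P.Hom a b n
  | _, _, _, .zero _ _ _ => 0
  | _, _, _, .add x y => x.eval G + y.eval G
  | _, _, _, .smul r x => r • x.eval G
  | _, _, _, .comp h x y => P.comp h (x.eval G) (y.eval G)
  | _, _, _, .wl c x => P.wl c (x.eval G)
  | _, _, _, .wr c x => P.wr c (x.eval G)
  | _, _, _, .d h x => P.d h (x.eval G)
  | _, _, _, .str s => P.str s
  | _, _, _, .cu => G.cu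
  | _, _, _, .cp => G.cp
  | _, _, _, .pr => G.pr

/-- Two formal expressions are identified when they have the same value in every prop with
generators satisfying the relations, i.e. when their equality follows from the axioms of a prop and
the relations. -/
instance Expr.setoid (k : Type u) [CommRing k] (a b : Word) (n : ℤ) : Setoid (Expr k a b n) where
  r x y := ∀ (P : DGProp.{u} k) (G : Gens P), x.eval G = y.eval G
  iseqv := ⟨fun _ _ _ => rfl, fun h P G => (h P G).symm, fun h h' P G => (h P G).trans (h' P G)⟩

theorem Expr.app {a b : Word} {n : ℤ} {x y : Expr k a b n} (h : x ≈ y) {P : DGProp.{u} k}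
    (G : Gens P) : x.eval G = y.eval G := h P G

/-- The morphisms of degree `n` of the prop `M`. -/
def MHom (k : Type u) [CommRing k] (a b : Word) (n : ℤ) : Type u := Quotient (Expr.setoid k a b n)

namespace MHom

variable {a b : Word} {n : ℤ}

/-- The value of an element of `M` in a prop with generators. -/
def eval {P : DGProp k} (G : Gens P) (x : MHom k a b n) : P.Hom a b n :=
  Quotient.lift (fun e => Expr.eval G e) (fun _ _ h => Expr.app h G) x

theorem ext {x y : MHom k a b n} (h : ∀ (P : DGProp.{u} k) (G : Gens P), x.eval G = y.eval G) :
    x = y := by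
  induction x using Quotient.inductionOn
  induction y using Quotient.inductionOn
  exact Quotient.sound h

instance : Zero (MHom k a b n) := ⟨Quotient.mk _ (.zero a b n)⟩
instance : Add (MHom k a b n) :=
  ⟨Quotient.map₂ .add fun _ _ h _ _ h' P G => congrArg₂ (· + ·) (Expr.app h G) (Expr.app h' G)⟩
instance : SMul k (MHom k a b n) :=
  ⟨fun r => Quotient.map (.smul r) fun _ _ h P G => congrArg (r • ·) (Expr.app h G)⟩

theorem eval_zero {P : DGProp k} (G : Gens P) : (0 : MHom k a b n).eval G = 0 := rfl
theorem eval_add {P : DGProp k} (G : Gens P) (x y : MHom k a b n) :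
    (x + y).eval G = x.eval G + y.eval G := by
  induction x using Quotient.inductionOn
  induction y using Quotient.inductionOn
  rfl
theorem eval_smul {P : DGProp k} (G : Gens P) (r : k) (x : MHom k a b n) :
    (r • x).eval G = r • x.eval G := by
  induction x using Quotient.inductionOn
  rfl

instance : Neg (MHom k a b n) := ⟨fun x => (-1 : k) • x⟩

instance : AddCommGroup (MHom k a b n) where
  add_assoc x y z := ext fun P G => by simp only [eval_add, add_assoc]
  zero_add x := ext fun P G => by simp only [eval_add, eval_zero, zero_add]
  add_zero x := ext fun P G => by simp only [eval_add, eval_zero, add_zero]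
  add_comm x y := ext fun P G => by simp only [eval_add, add_comm]
  neg_add_cancel x := ext fun P G => by
    change ((-1 : k) • x + x).eval G = _
    simp only [eval_add, eval_smul, eval_zero, neg_smul, one_smul, neg_add_cancel]
  nsmul := nsmulRec
  zsmul := zsmulRec

instance : Module k (MHom k a b n) where
  one_smul x := ext fun P G => by simp only [eval_smul, one_smul]
  mul_smul r s x := ext fun P G => by simp only [eval_smul, mul_smul]
  smul_zero r := ext fun P G => by simp only [eval_smul, eval_zero, smul_zero]
  smul_add r x y := ext fun P G => by simp only [eval_smul, eval_add, smul_add]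
  add_smul r s x := ext fun P G => by simp only [eval_smul, eval_add, add_smul]
  zero_smul x := ext fun P G => by simp only [eval_smul, eval_zero, zero_smul]

/-- Evaluation as a linear map. -/
def evalL {P : DGProp k} (G : Gens P) : MHom k a b n →ₗ[k] P.Hom a b n where
  toFun := eval G
  map_add' := eval_add G
  map_smul' := eval_smul G

/-- Composition. -/
def comp {a b c : Word} {i j n : ℤ} (h : i + j = n) (x : MHom k b c i) (y : MHom k a b j) :
    MHom k a c n :=
  Quotient.map₂ (.comp h) (fun _ _ h₁ _ _ h₂ P G => by
    simp only [Expr.eval, Expr.app h₁ G, Expr.app h₂ G]) x y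

theorem eval_comp {P : DGProp k} (G : Gens P) {a b c : Word} {i j n : ℤ} (h : i + j = n)
    (x : MHom k b c i) (y : MHom k a b j) :
    (comp h x y).eval G = P.comp h (x.eval G) (y.eval G) := by
  induction x using Quotient.inductionOn
  induction y using Quotient.inductionOn
  rfl

/-- Left whiskering. -/
def wl (c : Word) (x : MHom k a b n) : MHom k (c.tens a) (c.tens b) n :=
  Quotient.map (.wl c) (fun _ _ h P G => congrArg (P.wl c) (Expr.app h G)) x

theorem eval_wl {P : DGProp k} (G : Gens P) (c : Word) (x : MHom k a b n) :
    (wl c x).eval G = P.wl c (x.eval G) := by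
  induction x using Quotient.inductionOn
  rfl

/-- Right whiskering. -/
def wr (c : Word) (x : MHom k a b n) : MHom k (a.tens c) (b.tens c) n :=
  Quotient.map (.wr c) (fun _ _ h P G => congrArg (P.wr c) (Expr.app h G)) x

theorem eval_wr {P : DGProp k} (G : Gens P) (c : Word) (x : MHom k a b n) :
    (wr c x).eval G = P.wr c (x.eval G) := by
  induction x using Quotient.inductionOn
  rfl

/-- The differential. -/
def d {m : ℤ} (h : m + 1 = n) (x : MHom k a b n) : MHom k a b m :=
  Quotient.map (.d h) (fun _ _ h' P G => congrArg (P.d h) (Expr.app h' G)) x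

theorem eval_d {P : DGProp k} (G : Gens P) {m : ℤ} (h : m + 1 = n) (x : MHom k a b n) :
    (d h x).eval G = P.d h (x.eval G) := by
  induction x using Quotient.inductionOn
  rfl

/-- Structural morphisms. -/
def str (s : Str a b) : MHom k a b 0 := Quotient.mk _ (.str s)

theorem eval_str {P : DGProp k} (G : Gens P) (s : Str a b) :
    (str s : MHom k a b 0).eval G = P.str s := rfl

/-- The generating counit. -/
def cu : MHom k .X .one 0 := Quotient.mk _ .cu

/-- The generating coproduct. -/
def cp : MHom k .X (.tens .X .X) 0 := Quotient.mk _ .cp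

/-- The generating product. -/
def pr : MHom k (.tens .X .X) .X 1 := Quotient.mk _ .pr

theorem eval_cu {P : DGProp k} (G : Gens P) : (cu : MHom k _ _ _).eval G = G.cu := rfl
theorem eval_cp {P : DGProp k} (G : Gens P) : (cp : MHom k _ _ _).eval G = G.cp := rfl
theorem eval_pr {P : DGProp k} (G : Gens P) : (pr : MHom k _ _ _).eval G = G.pr := rfl

theorem eval_sub {P : DGProp k} (G : Gens P) (x y : MHom k a b n) :
    (x - y).eval G = x.eval G - y.eval G := map_sub (evalL G) x y

end MHom

open MHom in
/-- The prop `M`: the prop presented by a counit and a coproduct of degree `0` and a product of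
degree `1`, with the boundaries and relations listed in `Gens`. -/
abbrev M (k : Type u) [CommRing k] : DGProp k where
  Hom := MHom k
  comp h := LinearMap.mk₂ k (MHom.comp h)
    (fun _ _ _ => MHom.ext fun P G => by simp only [eval_comp, eval_add, map_add, LinearMap.add_apply])
    (fun _ _ _ => MHom.ext fun P G => by
      simp only [eval_comp, eval_smul, map_smul, LinearMap.smul_apply])
    (fun _ _ _ => MHom.ext fun P G => by simp only [eval_comp, eval_add, map_add])
    (fun _ _ _ => MHom.ext fun P G => by simp only [eval_comp, eval_smul, map_smul])
  wl c {_ _ _} :=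
    { toFun := MHom.wl c
      map_add' := fun _ _ => MHom.ext fun P G => by simp only [eval_wl, eval_add, map_add]
      map_smul' := fun _ _ => MHom.ext fun P G => by
        simp only [eval_wl, eval_smul, map_smul, RingHom.id_apply] }
  wr c :=
    { toFun := MHom.wr c
      map_add' := fun _ _ => MHom.ext fun P G => by simp only [eval_wr, eval_add, map_add]
      map_smul' := fun _ _ => MHom.ext fun P G => by
        simp only [eval_wr, eval_smul, map_smul, RingHom.id_apply] }
  d h :=
    { toFun := MHom.d h
      map_add' := fun _ _ => MHom.ext fun P G => by simp only [eval_d, eval_add, map_add]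
      map_smul' := fun _ _ => MHom.ext fun P G => by
        simp only [eval_d, eval_smul, map_smul, RingHom.id_apply] }
  str := MHom.str
  id_comp f := MHom.ext fun P G => by
    simpa only [LinearMap.mk₂_apply, eval_comp, eval_str] using P.id_comp _
  comp_id f := MHom.ext fun P G => by
    simpa only [LinearMap.mk₂_apply, eval_comp, eval_str] using P.comp_id _
  assoc h₁ h₂ h₃ h₄ f g x := MHom.ext fun P G => by
    simpa only [LinearMap.mk₂_apply, eval_comp] using P.assoc h₁ h₂ h₃ h₄ _ _ _
  wl_comp e _ _ _ _ _ _ h f g := MHom.ext fun P G => by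
    simpa only [LinearMap.mk₂_apply, LinearMap.coe_mk, AddHom.coe_mk, eval_comp, eval_wl] using
      P.wl_comp e h _ _
  wr_comp e _ _ _ _ _ _ h f g := MHom.ext fun P G => by
    simpa only [LinearMap.mk₂_apply, LinearMap.coe_mk, AddHom.coe_mk, eval_comp, eval_wr] using
      P.wr_comp e h _ _
  exchange h h' f g := MHom.ext fun P G => by
    simpa only [LinearMap.mk₂_apply, LinearMap.coe_mk, AddHom.coe_mk, eval_comp, eval_wr, eval_wl,
      eval_smul] using P.exchange h h' _ _
  str_comp s t := MHom.ext fun P G => by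
    simpa only [LinearMap.mk₂_apply, eval_comp, eval_str] using P.str_comp s t
  str_wl c _ _ s := MHom.ext fun P G => P.str_wl c s
  str_wr c _ _ s := MHom.ext fun P G => P.str_wr c s
  str_rel h := MHom.ext fun P G => P.str_rel h
  assoc_left b c _ f := MHom.ext fun P G => by
    simpa only [LinearMap.mk₂_apply, LinearMap.coe_mk, AddHom.coe_mk, eval_comp, eval_wr, eval_wl,
      eval_str] using P.assoc_left b c _
  assoc_mid a _ _ c _ f := MHom.ext fun P G => by
    simpa only [LinearMap.mk₂_apply, LinearMap.coe_mk, AddHom.coe_mk, eval_comp, eval_wr, eval_wl,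
      eval_str] using P.assoc_mid a c _
  assoc_right a b _ _ _ f := MHom.ext fun P G => by
    simpa only [LinearMap.mk₂_apply, LinearMap.coe_mk, AddHom.coe_mk, eval_comp, eval_wr, eval_wl,
      eval_str] using P.assoc_right a b _
  lun_nat f := MHom.ext fun P G => by
    simpa only [LinearMap.mk₂_apply, LinearMap.coe_mk, AddHom.coe_mk, eval_comp, eval_wr, eval_wl,
      eval_str] using P.lun_nat _
  run_nat f := MHom.ext fun P G => by
    simpa only [LinearMap.mk₂_apply, LinearMap.coe_mk, AddHom.coe_mk, eval_comp, eval_wr, eval_wl,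
      eval_str] using P.run_nat _
  braid_nat b _ f := MHom.ext fun P G => by
    simpa only [LinearMap.mk₂_apply, LinearMap.coe_mk, AddHom.coe_mk, eval_comp, eval_wr, eval_wl,
      eval_str] using P.braid_nat b _
  d_d h h' f := MHom.ext fun P G => by
    simpa only [LinearMap.coe_mk, AddHom.coe_mk, eval_d, eval_zero] using P.d_d h h' _
  d_comp h hi hj hn h₁ h₂ f g := MHom.ext fun P G => by
    simpa only [LinearMap.mk₂_apply, LinearMap.coe_mk, AddHom.coe_mk, eval_comp, eval_d, eval_add,
      eval_smul] using P.d_comp h hi hj hn h₁ h₂ _ _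
  d_wl c _ _ _ _ h f := MHom.ext fun P G => by
    simpa only [LinearMap.coe_mk, AddHom.coe_mk, eval_wl, eval_d] using P.d_wl c h _
  d_wr c _ _ _ _ h f := MHom.ext fun P G => by
    simpa only [LinearMap.coe_mk, AddHom.coe_mk, eval_wr, eval_d] using P.d_wr c h _
  d_str h s := MHom.ext fun P G => by
    simpa only [LinearMap.coe_mk, AddHom.coe_mk, eval_d, eval_str, eval_zero] using P.d_str h s

open MHom in
/-- The generators of `M`. -/
def M.gens (k : Type u) [CommRing k] : Gens (M k) where
  cu := MHom.cu
  cp := MHom.cp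
  pr := MHom.pr
  d_cu := MHom.ext fun P G => by
    simpa only [LinearMap.coe_mk, AddHom.coe_mk, eval_d, eval_zero, eval_cu] using G.d_cu
  d_cp := MHom.ext fun P G => by
    simpa only [LinearMap.coe_mk, AddHom.coe_mk, eval_d, eval_zero, eval_cp] using G.d_cp
  d_pr := MHom.ext fun P G => by
    simpa only [LinearMap.mk₂_apply, LinearMap.coe_mk, AddHom.coe_mk, eval_comp, eval_wr, eval_wl,
      eval_str, eval_d, eval_sub, eval_cu, eval_pr] using G.d_pr
  counit_left := MHom.ext fun P G => by
    simpa only [LinearMap.mk₂_apply, LinearMap.coe_mk, AddHom.coe_mk, eval_comp, eval_wr, eval_wl,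
      eval_str, eval_cu, eval_cp] using G.counit_left
  counit_right := MHom.ext fun P G => by
    simpa only [LinearMap.mk₂_apply, LinearMap.coe_mk, AddHom.coe_mk, eval_comp, eval_wr, eval_wl,
      eval_str, eval_cu, eval_cp] using G.counit_right
  coassoc := MHom.ext fun P G => by
    simpa only [LinearMap.mk₂_apply, LinearMap.coe_mk, AddHom.coe_mk, eval_comp, eval_wr, eval_wl,
      eval_str, eval_cu, eval_cp] using G.coassoc
  cu_pr := MHom.ext fun P G => by
    simpa only [LinearMap.mk₂_apply, eval_comp, eval_zero, eval_cu, eval_pr] using G.cu_pr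

/-- Morphisms of props. -/
structure PropHom (P Q : DGProp k) where
  map : ∀ {a b : Word} {n : ℤ}, P.Hom a b n →ₗ[k] Q.Hom a b n
  map_comp : ∀ {a b c : Word} {i j n : ℤ} (h : i + j = n) (f : P.Hom b c i) (g : P.Hom a b j),
    map (P.comp h f g) = Q.comp h (map f) (map g)
  map_wl : ∀ (c : Word) {a b : Word} {n : ℤ} (f : P.Hom a b n), map (P.wl c f) = Q.wl c (map f)
  map_wr : ∀ (c : Word) {a b : Word} {n : ℤ} (f : P.Hom a b n), map (P.wr c f) = Q.wr c (map f)
  map_d : ∀ {a b : Word} {n m : ℤ} (h : m + 1 = n) (f : P.Hom a b n), map (P.d h f) = Q.d h (map f)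
  map_str : ∀ {a b : Word} (s : Str a b), map (P.str s) = Q.str s

/-- The universal property of `M`. -/
def M.lift {P : DGProp k} (G : Gens P) : PropHom (M k) P where
  map := MHom.evalL G
  map_comp h f g := MHom.eval_comp G h f g
  map_wl c _ _ _ f := MHom.eval_wl G c f
  map_wr c _ _ _ f := MHom.eval_wr G c f
  map_d h f := MHom.eval_d G h f
  map_str s := rfl

/-- A morphism of props out of `M` is determined by its values on the generators. -/
theorem M.hom_eq {P : DGProp k} (φ ψ : PropHom (M k) P)
    (h₁ : φ.map (M.gens k).cu = ψ.map (M.gens k).cu)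
    (h₂ : φ.map (M.gens k).cp = ψ.map (M.gens k).cp)
    (h₃ : φ.map (M.gens k).pr = ψ.map (M.gens k).pr) {a b : Word} {n : ℤ} (x : (M k).Hom a b n) :
    φ.map x = ψ.map x := by
  obtain ⟨e, rfl⟩ := Quotient.exists_rep x
  induction e with
  | zero a b n => exact (map_zero φ.map).trans (map_zero ψ.map).symm
  | add x y hx hy =>
    exact (map_add φ.map _ _).trans ((congrArg₂ (· + ·) hx hy).trans (map_add ψ.map _ _).symm)
  | smul r x hx =>
    exact (map_smul φ.map r _).trans ((congrArg (r • ·) hx).trans (map_smul ψ.map r _).symm)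
  | comp h x y hx hy =>
    exact (φ.map_comp h _ _).trans ((congrArg₂ (fun s t => P.comp h s t) hx hy).trans
      (ψ.map_comp h _ _).symm)
  | wl c x hx => exact (φ.map_wl c _).trans ((congrArg (P.wl c) hx).trans (ψ.map_wl c _).symm)
  | wr c x hx => exact (φ.map_wr c _).trans ((congrArg (P.wr c) hx).trans (ψ.map_wr c _).symm)
  | d h x hx => exact (φ.map_d h _).trans ((congrArg (P.d h) hx).trans (ψ.map_d h _).symm)
  | str s => exact (φ.map_str s).trans (ψ.map_str s).symm
  | cu => exact h₁
  | cp => exact h₂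
  | pr => exact h₃

end

section

variable {k : Type u} [CommRing k]

namespace DGProp

/-- The degree `n` part of the tensor product of the morphism modules of two props. -/
def THom (P Q : DGProp k) (a b : Word) (n : ℤ) : Type u :=
  DirectSum {p : ℤ × ℤ // p.1 + p.2 = n} fun p => P.Hom a b p.1.1 ⊗[k] Q.Hom a b p.1.2

instance (P Q : DGProp k) (a b : Word) (n : ℤ) : AddCommGroup (THom P Q a b n) :=
  inferInstanceAs (AddCommGroup (DirectSum {p : ℤ × ℤ // p.1 + p.2 = n} fun p =>
    P.Hom a b p.1.1 ⊗[k] Q.Hom a b p.1.2))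

instance (P Q : DGProp k) (a b : Word) (n : ℤ) : Module k (THom P Q a b n) :=
  inferInstanceAs (Module k (DirectSum {p : ℤ × ℤ // p.1 + p.2 = n} fun p =>
    P.Hom a b p.1.1 ⊗[k] Q.Hom a b p.1.2))

section
variable {P Q : DGProp k} {a b c : Word} {n : ℤ}

/-- The element `x ⊗ y`. -/
def tm {i j : ℤ} (h : i + j = n) : P.Hom a b i →ₗ[k] Q.Hom a b j →ₗ[k] THom P Q a b n :=
  (TensorProduct.mk k _ _).compr₂ (DirectSum.lof k {p : ℤ × ℤ // p.1 + p.2 = n}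
    (fun p => P.Hom a b p.1.1 ⊗[k] Q.Hom a b p.1.2) ⟨(i, j), h⟩)

@[elab_as_elim]
theorem tind {p : THom P Q a b n → Prop} (x : THom P Q a b n) (zero : p 0)
    (add : ∀ x y, p x → p y → p (x + y))
    (tm : ∀ (i j : ℤ) (h : i + j = n) (x : P.Hom a b i) (y : Q.Hom a b j), p (tm h x y)) :
    p x := by
  induction x using DirectSum.induction_on with
  | zero => exact zero
  | add x y hx hy => exact add x y hx hy
  | of i x =>
    induction x with
    | zero => rw [map_zero]; exact zero
    | add x y hx hy => rw [map_add]; exact add _ _ hx hy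
    | tmul x y => exact tm i.1.1 i.1.2 i.2 x y

/-- Linear maps out of the tensor product. -/
def tdesc {E : Type*} [AddCommGroup E] [Module k E]
    (φ : ∀ i j : ℤ, i + j = n → P.Hom a b i →ₗ[k] Q.Hom a b j →ₗ[k] E) : THom P Q a b n →ₗ[k] E :=
  DirectSum.toModule k _ E fun p => TensorProduct.lift (φ p.1.1 p.1.2 p.2)

@[simp] theorem tdesc_pure {E : Type*} [AddCommGroup E] [Module k E]
    (φ : ∀ i j : ℤ, i + j = n → P.Hom a b i →ₗ[k] Q.Hom a b j →ₗ[k] E) {i j : ℤ} (h : i + j = n)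
    (x : P.Hom a b i) (y : Q.Hom a b j) : tdesc φ (tm h x y) = φ i j h x y :=
  (DirectSum.toModule_lof k (M := fun p : {p : ℤ × ℤ // p.1 + p.2 = n} =>
    P.Hom a b p.1.1 ⊗[k] Q.Hom a b p.1.2) (φ := fun p => TensorProduct.lift (φ p.1.1 p.1.2 p.2))
    ⟨(i, j), h⟩ (x ⊗ₜ[k] y)).trans (TensorProduct.lift.tmul x y)

theorem tlin_ext {E : Type*} [AddCommGroup E] [Module k E] {f g : THom P Q a b n →ₗ[k] E}
    (h : ∀ (i j : ℤ) (h : i + j = n) (x : P.Hom a b i) (y : Q.Hom a b j),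
      f (tm h x y) = g (tm h x y)) : f = g := by
  refine LinearMap.ext fun x => ?_
  induction x using tind with
  | zero => simp
  | add x y hx hy => simp [hx, hy]
  | tm i j h' x y => exact h i j h' x y

/-- Composition: `(x ⊗ y) ∘ (x' ⊗ y') = (-1)^(|y| |x'|) (x ∘ x') ⊗ (y ∘ y')`. -/
def tcomp {i j : ℤ} (h : i + j = n) : THom P Q b c i →ₗ[k] THom P Q a b j →ₗ[k] THom P Q a c n :=
  tdesc fun i₁ i₂ hi => LinearMap.mk₂ k
    (fun x y => tdesc fun j₁ j₂ hj => sg k (i₂ * j₁) •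
      (tm (i := i₁ + j₁) (j := i₂ + j₂) (by omega)).compl₁₂ (P.comp rfl x) (Q.comp rfl y))
    (fun _ _ _ => tlin_ext fun _ _ _ _ _ => by simp)
    (fun _ _ _ => tlin_ext fun _ _ _ _ _ => by simp [smul_smul, mul_comm])
    (fun _ _ _ => tlin_ext fun _ _ _ _ _ => by simp)
    (fun _ _ _ => tlin_ext fun _ _ _ _ _ => by simp [smul_smul, mul_comm])

theorem tcomp_pure {i j i₁ i₂ j₁ j₂ n₁ n₂ : ℤ} (h : i + j = n) (hi : i₁ + i₂ = i)
    (hj : j₁ + j₂ = j) (h₁ : i₁ + j₁ = n₁) (h₂ : i₂ + j₂ = n₂) (h₁₂ : n₁ + n₂ = n)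
    (x : P.Hom b c i₁) (y : Q.Hom b c i₂) (x' : P.Hom a b j₁) (y' : Q.Hom a b j₂) :
    tcomp h (tm hi x y) (tm hj x' y') =
      sg k (i₂ * j₁) • tm h₁₂ (P.comp h₁ x x') (Q.comp h₂ y y') := by
  subst h₁ h₂
  simp [tcomp]

/-- The differential: `d (x ⊗ y) = d x ⊗ y + (-1)^|x| x ⊗ d y`. -/
def td {m : ℤ} (h : m + 1 = n) : THom P Q a b n →ₗ[k] THom P Q a b m :=
  tdesc fun i j hij =>
    (tm (i := i - 1) (j := j) (by omega)).compl₁₂ (P.d (sub_add_cancel i 1)) LinearMap.id +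
      sg k i • (tm (i := i) (j := j - 1) (by omega)).compl₁₂ LinearMap.id
        (Q.d (sub_add_cancel j 1))

theorem td_pure {m i j i' j' : ℤ} (h : m + 1 = n) (hij : i + j = n) (hi : i' + 1 = i)
    (hj : j' + 1 = j) (h₁ : i' + j = m) (h₂ : i + j' = m) (x : P.Hom a b i) (y : Q.Hom a b j) :
    td h (tm hij x y) = tm h₁ (P.d hi x) y + sg k i • tm h₂ x (Q.d hj y) := by
  obtain rfl : i' = i - 1 := by omega
  obtain rfl : j' = j - 1 := by omega
  simp [td]

/-- Left whiskering of a tensor product. -/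
def twl (e : Word) : THom P Q a b n →ₗ[k] THom P Q (e.tens a) (e.tens b) n :=
  tdesc fun _ _ h => (tm h).compl₁₂ (P.wl e) (Q.wl e)

/-- Right whiskering of a tensor product. -/
def twr (e : Word) : THom P Q a b n →ₗ[k] THom P Q (a.tens e) (b.tens e) n :=
  tdesc fun _ _ h => (tm h).compl₁₂ (P.wr e) (Q.wr e)

@[simp] theorem twl_pure (e : Word) {i j : ℤ} (h : i + j = n) (x : P.Hom a b i) (y : Q.Hom a b j) :
    twl e (tm h x y) = tm h (P.wl e x) (Q.wl e y) := by simp [twl]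

@[simp] theorem twr_pure (e : Word) {i j : ℤ} (h : i + j = n) (x : P.Hom a b i) (y : Q.Hom a b j) :
    twr e (tm h x y) = tm h (P.wr e x) (Q.wr e y) := by simp [twr]

/-- Structural morphisms of a tensor product. -/
def tstr (s : Str a b) : THom P Q a b 0 := tm (add_zero 0) (P.str s) (Q.str s)

theorem str_tcomp_pure {i j : ℤ} (h : i + j = n) (s : Str b c) (x : P.Hom a b i)
    (y : Q.Hom a b j) : tcomp (zero_add n) (tstr s) (tm h x y) =
      tm h (P.comp (zero_add i) (P.str s) x) (Q.comp (zero_add j) (Q.str s) y) := by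
  rw [tstr, tcomp_pure _ _ _ (zero_add i) (zero_add j) h]; simp

theorem pure_tcomp_str {i j : ℤ} (h : i + j = n) (s : Str a b) (x : P.Hom b c i)
    (y : Q.Hom b c j) : tcomp (add_zero n) (tm h x y) (tstr s) =
      tm h (P.comp (add_zero i) x (P.str s)) (Q.comp (add_zero j) y (Q.str s)) := by
  rw [tstr, tcomp_pure _ _ _ (add_zero i) (add_zero j) h]; simp

theorem td_comp {a b c : Word} {i i' j j' n m : ℤ} (h : i + j = n) (hi : i' + 1 = i)
    (hj : j' + 1 = j) (hn : m + 1 = n) (h₁ : i' + j = m) (h₂ : i + j' = m) (f : THom P Q b c i)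
    (g : THom P Q a b j) : td hn (tcomp h f g) =
      tcomp h₁ (td hi f) g + sg k i • tcomp h₂ f (td hj g) := by
  induction f using tind with
  | zero => simp
  | add x y hx hy => simp only [map_add, LinearMap.add_apply, hx, hy, smul_add]; abel
  | tm i₁ i₂ hi₁ f f' =>
  induction g using tind with
  | zero => simp
  | add x y hx hy => simp only [map_add, hx, hy, smul_add]; abel
  | tm j₁ j₂ hj₁ g g' =>
    obtain rfl : i' = i - 1 := by omega
    obtain rfl : j' = j - 1 := by omega
    obtain rfl : m = n - 1 := by omega
    rw [td_pure hi hi₁ (sub_add_cancel i₁ 1) (sub_add_cancel i₂ 1) (by omega) (by omega),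
      td_pure hj hj₁ (sub_add_cancel j₁ 1) (sub_add_cancel j₂ 1) (by omega) (by omega),
      tcomp_pure h hi₁ hj₁ rfl rfl (by omega), map_smul,
      td_pure hn _ (sub_add_cancel (i₁ + j₁) 1) (sub_add_cancel (i₂ + j₂) 1) (by omega)
        (by omega)]
    simp only [map_add, LinearMap.add_apply, map_smul, LinearMap.smul_apply]
    rw [tcomp_pure h₁ _ hj₁ (n₁ := i₁ + j₁ - 1) (n₂ := i₂ + j₂) (by omega) (by omega) (by omega),
      tcomp_pure h₁ _ hj₁ (n₁ := i₁ + j₁) (n₂ := i₂ + j₂ - 1) (by omega) (by omega) (by omega),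
      tcomp_pure h₂ hi₁ _ (n₁ := i₁ + j₁ - 1) (n₂ := i₂ + j₂) (by omega) (by omega) (by omega),
      tcomp_pure h₂ hi₁ _ (n₁ := i₁ + j₁) (n₂ := i₂ + j₂ - 1) (by omega) (by omega) (by omega)]
    rw [P.d_comp rfl (sub_add_cancel i₁ 1) (sub_add_cancel j₁ 1) (sub_add_cancel (i₁ + j₁) 1)
        (show i₁ - 1 + j₁ = i₁ + j₁ - 1 by ring) (show i₁ + (j₁ - 1) = i₁ + j₁ - 1 by ring),
      Q.d_comp rfl (sub_add_cancel i₂ 1) (sub_add_cancel j₂ 1) (sub_add_cancel (i₂ + j₂) 1)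
        (show i₂ - 1 + j₂ = i₂ + j₂ - 1 by ring) (show i₂ + (j₂ - 1) = i₂ + j₂ - 1 by ring)]
    simp only [map_add, LinearMap.add_apply, map_smul, LinearMap.smul_apply, smul_add, smul_smul,
      ← sg_add]
    have e₁ : sg k (i + i₂ * (j₁ - 1)) = sg k (i₂ * j₁ + i₁) := by
      rw [← hi₁]; apply sg_congr; push_cast
      generalize (i₁ : ZMod 2) = a₁; generalize (i₂ : ZMod 2) = a₂
      generalize (j₁ : ZMod 2) = b₁; revert a₁ a₂ b₁; decide
    have e₂ : sg k (i₁ + (i₂ - 1) * j₁) = sg k (i₂ * j₁ + (i₁ + j₁)) := by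
      apply sg_congr; push_cast
      generalize (i₁ : ZMod 2) = a₁; generalize (i₂ : ZMod 2) = a₂
      generalize (j₁ : ZMod 2) = b₁; revert a₁ a₂ b₁; decide
    have e₃ : sg k (i + (j₁ + i₂ * j₁)) = sg k (i₂ * j₁ + (i₁ + j₁ + i₂)) := by
      rw [← hi₁]; apply sg_congr; push_cast
      generalize (i₁ : ZMod 2) = a₁; generalize (i₂ : ZMod 2) = a₂
      generalize (j₁ : ZMod 2) = b₁; revert a₁ a₂ b₁; decide
    rw [e₁, e₂, e₃, add_add_add_comm]

end

/-- The tensor product of two props. -/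
abbrev prod (P Q : DGProp k) : DGProp k where
  Hom := THom P Q
  comp h := tcomp h
  wl e := twl e
  wr e := twr e
  d h := td h
  str s := tstr s
  id_comp f := by
    induction f using tind with
    | zero => simp
    | add x y hx hy => simp only [map_add, hx, hy]
    | tm i j h x y => rw [str_tcomp_pure, P.id_comp, Q.id_comp]
  comp_id f := by
    induction f using tind with
    | zero => simp
    | add x y hx hy => simp only [map_add, LinearMap.add_apply, hx, hy]
    | tm i j h x y => rw [pure_tcomp_str, P.comp_id, Q.comp_id]
  assoc {_ _ _ _ i j l p q n} h₁ h₂ h₃ h₄ f g x := by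
    induction f using tind with
    | zero => simp
    | add x y hx hy => simp only [map_add, LinearMap.add_apply, hx, hy]
    | tm i₁ i₂ hi f f' =>
    induction g using tind with
    | zero => simp
    | add x y hx hy => simp only [map_add, LinearMap.add_apply, hx, hy]
    | tm j₁ j₂ hj g g' =>
    induction x using tind with
    | zero => simp
    | add x y hx hy => simp only [map_add, hx, hy]
    | tm l₁ l₂ hl x x' =>
      rw [tcomp_pure h₁ hi hj rfl rfl (by omega), tcomp_pure h₃ hj hl rfl rfl (by omega),
        map_smul, map_smul, LinearMap.smul_apply, tcomp_pure h₂ _ hl rfl rfl (by omega),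
        tcomp_pure h₄ hi _ (n₁ := i₁ + j₁ + l₁) (n₂ := i₂ + j₂ + l₂) (by omega) (by omega)
        (by omega), P.assoc rfl rfl rfl (by omega), Q.assoc rfl rfl rfl (by omega), smul_smul,
        smul_smul, ← sg_add, ← sg_add]
      congr 2; ring
  wl_comp e _ _ _ i j n h f g := by
    induction f using tind with
    | zero => simp
    | add x y hx hy => simp only [map_add, LinearMap.add_apply, hx, hy]
    | tm i₁ i₂ hi f f' =>
    induction g using tind with
    | zero => simp
    | add x y hx hy => simp only [map_add, hx, hy]
    | tm j₁ j₂ hj g g' =>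
      rw [tcomp_pure h hi hj rfl rfl (by omega), map_smul, twl_pure, twl_pure, twl_pure,
        tcomp_pure h hi hj rfl rfl (by omega), P.wl_comp, Q.wl_comp]
  wr_comp e _ _ _ i j n h f g := by
    induction f using tind with
    | zero => simp
    | add x y hx hy => simp only [map_add, LinearMap.add_apply, hx, hy]
    | tm i₁ i₂ hi f f' =>
    induction g using tind with
    | zero => simp
    | add x y hx hy => simp only [map_add, hx, hy]
    | tm j₁ j₂ hj g g' =>
      rw [tcomp_pure h hi hj rfl rfl (by omega), map_smul, twr_pure, twr_pure, twr_pure,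
        tcomp_pure h hi hj rfl rfl (by omega), P.wr_comp, Q.wr_comp]
  exchange {_ _ _ _ i j n} h h' f g := by
    induction f using tind with
    | zero => simp
    | add x y hx hy => simp only [map_add, LinearMap.add_apply, hx, hy, smul_add]
    | tm i₁ i₂ hi f f' =>
    induction g using tind with
    | zero => simp
    | add x y hx hy => simp only [map_add, LinearMap.add_apply, hx, hy, smul_add]
    | tm j₁ j₂ hj g g' =>
      rw [twl_pure, twl_pure, twr_pure, twr_pure, tcomp_pure h hi hj rfl rfl (by omega),
        tcomp_pure h' hj hi (n₁ := i₁ + j₁) (n₂ := i₂ + j₂) (by omega) (by omega) (by omega),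
        P.exchange rfl (add_comm _ _), Q.exchange rfl (add_comm _ _)]
      simp only [map_smul, LinearMap.smul_apply, smul_smul, ← sg_add]
      congr 1; rw [← hi, ← hj]; apply sg_congr; push_cast
      generalize (i₁ : ZMod 2) = a₁; generalize (i₂ : ZMod 2) = a₂
      generalize (j₁ : ZMod 2) = b₁; generalize (j₂ : ZMod 2) = b₂
      revert a₁ a₂ b₁ b₂; decide
  str_comp s t := by
    change _ = tcomp _ (tstr t) (tm _ (P.str s) (Q.str s))
    rw [str_tcomp_pure, ← P.str_comp, ← Q.str_comp]; rfl
  str_wl c _ _ s := by rw [tstr, tstr, twl_pure, P.str_wl, Q.str_wl]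
  str_wr c _ _ s := by rw [tstr, tstr, twr_pure, P.str_wr, Q.str_wr]
  str_rel h := by rw [tstr, tstr, P.str_rel h, Q.str_rel h]
  assoc_left b c n f := by
    induction f using tind with
    | zero => simp
    | add x y hx hy => simp only [map_add, LinearMap.add_apply, hx, hy]
    | tm i j h x y =>
      simp only [twr_pure, twl_pure, str_tcomp_pure, pure_tcomp_str, P.assoc_left, Q.assoc_left]
  assoc_mid a _ _ c n f := by
    induction f using tind with
    | zero => simp
    | add x y hx hy => simp only [map_add, LinearMap.add_apply, hx, hy]
    | tm i j h x y =>
      simp only [twr_pure, twl_pure, str_tcomp_pure, pure_tcomp_str, P.assoc_mid, Q.assoc_mid]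
  assoc_right a b _ _ n f := by
    induction f using tind with
    | zero => simp
    | add x y hx hy => simp only [map_add, LinearMap.add_apply, hx, hy]
    | tm i j h x y =>
      simp only [twr_pure, twl_pure, str_tcomp_pure, pure_tcomp_str, P.assoc_right, Q.assoc_right]
  lun_nat f := by
    induction f using tind with
    | zero => simp
    | add x y hx hy => simp only [map_add, LinearMap.add_apply, hx, hy]
    | tm i j h x y => simp only [twl_pure, str_tcomp_pure, pure_tcomp_str, P.lun_nat, Q.lun_nat]
  run_nat f := by
    induction f using tind with
    | zero => simp
    | add x y hx hy => simp only [map_add, LinearMap.add_apply, hx, hy]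
    | tm i j h x y => simp only [twr_pure, str_tcomp_pure, pure_tcomp_str, P.run_nat, Q.run_nat]
  braid_nat b n f := by
    induction f using tind with
    | zero => simp
    | add x y hx hy => simp only [map_add, LinearMap.add_apply, hx, hy]
    | tm i j h x y =>
      simp only [twr_pure, twl_pure, str_tcomp_pure, pure_tcomp_str, P.braid_nat, Q.braid_nat]
  d_d {_ _ n m l} h h' f := by
    induction f using tind with
    | zero => simp
    | add x y hx hy => simp only [map_add, hx, hy, add_zero]
    | tm i j hij x y =>
      rw [td_pure h hij (sub_add_cancel i 1) (sub_add_cancel j 1) (by omega) (by omega), map_add,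
        map_smul, td_pure h' _ (sub_add_cancel (i - 1) 1) (sub_add_cancel j 1) (by omega)
        (by omega), td_pure h' _ (sub_add_cancel i 1) (sub_add_cancel (j - 1) 1) (by omega)
        (by omega), P.d_d, Q.d_d]
      have : sg k (i - 1) = - sg k i := by
        rw [← neg_one_mul, ← sg_one, ← sg_add]; apply sg_congr
        push_cast; generalize (i : ZMod 2) = x; revert x; decide
      simp only [this, map_zero, LinearMap.zero_apply, zero_add, smul_zero, add_zero]
      rw [← add_smul, neg_add_cancel, zero_smul]
  d_comp := td_comp
  d_wl c _ _ n m h f := by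
    induction f using tind with
    | zero => simp
    | add x y hx hy => simp only [map_add, hx, hy]
    | tm i j hij x y =>
      rw [twl_pure, td_pure h hij (sub_add_cancel i 1) (sub_add_cancel j 1) (by omega) (by omega),
        td_pure h hij (sub_add_cancel i 1) (sub_add_cancel j 1) (by omega) (by omega),
        P.d_wl, Q.d_wl, map_add, map_smul, twl_pure, twl_pure]
  d_wr c _ _ n m h f := by
    induction f using tind with
    | zero => simp
    | add x y hx hy => simp only [map_add, hx, hy]
    | tm i j hij x y =>
      rw [twr_pure, td_pure h hij (sub_add_cancel i 1) (sub_add_cancel j 1) (by omega) (by omega),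
        td_pure h hij (sub_add_cancel i 1) (sub_add_cancel j 1) (by omega) (by omega),
        P.d_wr, Q.d_wr, map_add, map_smul, twr_pure, twr_pure]
  d_str h s := by
    rw [tstr, td_pure h _ h h (by omega) (by omega), P.d_str, Q.d_str]; simp

end DGProp

end

section

variable {k : Type u} [CommRing k]

theorem unit_mul_mem {i j n : ℤ} (h : i + j = n) {x y : k} (hx : x ∈ (DGMod.unit k).gr i)
    (hy : y ∈ (DGMod.unit k).gr j) : x * y ∈ (DGMod.unit k).gr n := by
  by_cases hi : i = 0
  · by_cases hj : j = 0
    · subst hi hj h; exact DGMod.mem_gr_zero _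
    · rw [DGMod.unit_gr hj hy, mul_zero]; exact Submodule.zero_mem _
  · rw [DGMod.unit_gr hi hx, zero_mul]; exact Submodule.zero_mem _

namespace DGProp

/-- The unit for the tensor product of props: all morphism modules are `k` in degree `0`. -/
abbrev unit (k : Type u) [CommRing k] : DGProp k where
  Hom _ _ n := (DGMod.unit k).gr n
  comp h := LinearMap.mk₂ k (fun x y => ⟨x.1 * y.1, unit_mul_mem h x.2 y.2⟩)
    (fun _ _ _ => Subtype.ext (add_mul _ _ _)) (fun _ _ _ => Subtype.ext (mul_assoc _ _ _))
    (fun _ _ _ => Subtype.ext (mul_add _ _ _)) (fun _ _ _ => Subtype.ext (mul_left_comm _ _ _))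
  wl _ {_ _ _} := LinearMap.id
  wr _ := LinearMap.id
  d _ := 0
  str _ := ⟨1, DGMod.one_mem_gr⟩
  id_comp f := Subtype.ext (one_mul _)
  comp_id f := Subtype.ext (mul_one _)
  assoc _ _ _ _ _ _ _ := Subtype.ext (mul_assoc _ _ _)
  wl_comp _ _ _ _ _ _ _ _ _ _ := rfl
  wr_comp _ _ _ _ _ _ _ _ _ _ := rfl
  exchange {_ _ _ _ i j n} h h' f g := by
    by_cases hi : i = 0
    · subst hi; exact Subtype.ext (by simpa using mul_comm _ _)
    · have : f = 0 := Subtype.ext (DGMod.unit_gr hi f.2)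
      subst this; simp only [map_zero, LinearMap.zero_apply, smul_zero]
  str_comp _ _ := Subtype.ext (one_mul _).symm
  str_wl _ _ _ _ := rfl
  str_wr _ _ _ _ := rfl
  str_rel _ := rfl
  assoc_left _ _ _ _ := Subtype.ext (mul_comm _ _)
  assoc_mid _ _ _ _ _ _ := Subtype.ext (mul_comm _ _)
  assoc_right _ _ _ _ _ _ := Subtype.ext (mul_comm _ _)
  lun_nat _ := Subtype.ext (mul_comm _ _)
  run_nat _ := Subtype.ext (mul_comm _ _)
  braid_nat _ _ _ := Subtype.ext (mul_comm _ _)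
  d_d _ _ _ := rfl
  d_comp _ _ _ _ _ _ _ _ := by
    simp only [LinearMap.zero_apply, map_zero, smul_zero, add_zero]
  d_wl _ _ _ _ _ _ _ := rfl
  d_wr _ _ _ _ _ _ _ := rfl
  d_str _ _ := rfl

end DGProp

namespace PropHom
open DGProp

variable {P Q R P' Q' : DGProp k}

/-- The identity. -/
def id (P : DGProp k) : PropHom P P where
  map := LinearMap.id
  map_comp _ _ _ := rfl
  map_wl _ _ _ _ _ := rfl
  map_wr _ _ _ _ _ := rfl
  map_d _ _ := rfl
  map_str _ := rfl

/-- Composition. -/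
def trans (φ : PropHom P Q) (ψ : PropHom Q R) : PropHom P R where
  map := ψ.map ∘ₗ φ.map
  map_comp h f g := by simp only [LinearMap.comp_apply, φ.map_comp, ψ.map_comp]
  map_wl c _ _ _ f := by simp only [LinearMap.comp_apply, φ.map_wl, ψ.map_wl]
  map_wr c _ _ _ f := by simp only [LinearMap.comp_apply, φ.map_wr, ψ.map_wr]
  map_d h f := by simp only [LinearMap.comp_apply, φ.map_d, ψ.map_d]
  map_str s := by simp only [LinearMap.comp_apply, φ.map_str, ψ.map_str]

/-- The linear maps underlying `prodMap`. -/
def prodLin (φ : PropHom P P') (ψ : PropHom Q Q') {a b : Word} {n : ℤ} :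
    THom P Q a b n →ₗ[k] THom P' Q' a b n :=
  tdesc fun _ _ h => (tm h).compl₁₂ φ.map ψ.map

@[simp] theorem prodLin_pure (φ : PropHom P P') (ψ : PropHom Q Q') {a b : Word} {n i j : ℤ}
    (h : i + j = n) (x : P.Hom a b i) (y : Q.Hom a b j) :
    prodLin φ ψ (tm h x y) = tm h (φ.map x) (ψ.map y) := by simp [prodLin]

/-- The tensor product of morphisms of props. -/
def prodMap (φ : PropHom P P') (ψ : PropHom Q Q') : PropHom (P.prod Q) (P'.prod Q') where
  map := prodLin φ ψ
  map_comp h f g := by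
    induction f using tind with
    | zero => simp
    | add x y hx hy => simp only [map_add, LinearMap.add_apply, hx, hy]
    | tm i₁ i₂ hi f f' =>
    induction g using tind with
    | zero => simp
    | add x y hx hy => simp only [map_add, hx, hy]
    | tm j₁ j₂ hj g g' =>
      rw [tcomp_pure h hi hj rfl rfl (by omega), map_smul, prodLin_pure, prodLin_pure,
        prodLin_pure, tcomp_pure h hi hj rfl rfl (by omega), φ.map_comp, ψ.map_comp]
  map_wl c _ _ _ f := by
    induction f using tind with
    | zero => simp
    | add x y hx hy => simp only [map_add, hx, hy]
    | tm i j h x y => simp only [twl_pure, prodLin_pure, φ.map_wl, ψ.map_wl]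
  map_wr c _ _ _ f := by
    induction f using tind with
    | zero => simp
    | add x y hx hy => simp only [map_add, hx, hy]
    | tm i j h x y => simp only [twr_pure, prodLin_pure, φ.map_wr, ψ.map_wr]
  map_d h f := by
    induction f using tind with
    | zero => simp
    | add x y hx hy => simp only [map_add, hx, hy]
    | tm i j hij x y =>
      rw [prodLin_pure, td_pure h hij (sub_add_cancel i 1) (sub_add_cancel j 1) (by omega)
        (by omega), td_pure h hij (sub_add_cancel i 1) (sub_add_cancel j 1) (by omega) (by omega),
        map_add, map_smul, prodLin_pure, prodLin_pure, φ.map_d, ψ.map_d]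
  map_str s := by
    change prodLin φ ψ (tm _ _ _) = tm _ _ _
    rw [prodLin_pure, φ.map_str, ψ.map_str]

/-- The linear maps underlying `assoc`. -/
def assocLin {a b : Word} {n : ℤ} :
    THom (P.prod Q) R a b n →ₗ[k] THom P (Q.prod R) a b n :=
  tdesc fun i j h => tdesc fun i₁ i₂ h' => LinearMap.mk₂ k
    (fun x y => tm (i := i₁) (j := i₂ + j) (by omega) x ∘ₗ tm rfl y)
    (fun _ _ _ => by rw [map_add, LinearMap.add_comp])
    (fun _ _ _ => by rw [map_smul, LinearMap.smul_comp])
    (fun _ _ _ => by rw [map_add, LinearMap.comp_add])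
    (fun _ _ _ => by rw [map_smul, LinearMap.comp_smul])

@[simp] theorem assocLin_pure {a b : Word} {n i j l p q : ℤ} (h₁ : i + j = p) (h₂ : p + l = n)
    (h₃ : j + l = q) (h₄ : i + q = n) (x : P.Hom a b i) (y : Q.Hom a b j) (z : R.Hom a b l) :
    assocLin (tm (P := P.prod Q) h₂ (tm h₁ x y) z) =
      tm (Q := Q.prod R) h₄ x (tm h₃ y z) := by
  subst h₃
  rw [assocLin, tdesc_pure, tdesc_pure]
  rfl

theorem tind₃ {a b : Word} {n : ℤ} {p : THom (P.prod Q) R a b n → Prop}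
    (x : THom (P.prod Q) R a b n) (zero : p 0) (add : ∀ x y, p x → p y → p (x + y))
    (tm : ∀ (i j l m : ℤ) (h : i + j = m) (h' : m + l = n) (x : P.Hom a b i) (y : Q.Hom a b j)
      (z : R.Hom a b l), p (tm (P := P.prod Q) h' (tm h x y) z)) :
    p x := by
  induction x using tind with
  | zero => exact zero
  | add x y hx hy => exact add x y hx hy
  | tm m l h' t z =>
    induction t using tind with
    | zero => rw [map_zero, LinearMap.zero_apply]; exact zero
    | add x y hx hy => rw [map_add, LinearMap.add_apply]; exact add _ _ hx hy
    | tm i j h x y => exact tm i j l m h h' x y z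

theorem assoc_comp {a b c : Word} {i j n : ℤ} (h : i + j = n) (f : THom (P.prod Q) R b c i)
    (g : THom (P.prod Q) R a b j) :
    assocLin (tcomp h f g) = tcomp h (assocLin f) (assocLin g) := by
  induction f using tind₃ with
  | zero => simp
  | add x y hx hy => simp only [map_add, LinearMap.add_apply, hx, hy]
  | tm i₁ i₂ i₃ i₁₂ h₁₂ hi f f' f'' =>
  induction g using tind₃ with
  | zero => simp
  | add x y hx hy => simp only [map_add, hx, hy]
  | tm j₁ j₂ j₃ j₁₂ h₁₂' hj g g' g'' =>
    rw [tcomp_pure (P := P.prod Q) h hi hj rfl rfl (by omega), map_smul,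
      tcomp_pure rfl h₁₂ h₁₂' rfl rfl (by omega), map_smul, LinearMap.smul_apply, map_smul,
      assocLin_pure _ _ (show (i₂ + j₂) + (i₃ + j₃) = i₂ + i₃ + (j₂ + j₃) by ring) (by omega),
      assocLin_pure _ _ rfl (by omega), assocLin_pure _ _ rfl (by omega),
      tcomp_pure (Q := Q.prod R) h (by omega) (by omega) rfl rfl (by omega),
      tcomp_pure (P := Q) rfl rfl rfl rfl rfl
        (show (i₂ + j₂) + (i₃ + j₃) = i₂ + i₃ + (j₂ + j₃) by ring), map_smul, smul_smul, smul_smul,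
      ← sg_add, ← sg_add]
    congr 2
    rw [← h₁₂']; ring

/-- The associativity isomorphism for tensor products of props. -/
def assoc (P Q R : DGProp k) : PropHom ((P.prod Q).prod R) (P.prod (Q.prod R)) where
  map := assocLin
  map_comp h f g := assoc_comp h f g
  map_wl c _ _ _ f := by
    induction f using tind₃ with
    | zero => simp
    | add x y hx hy => simp only [map_add, hx, hy]
    | tm i j l m h h' x y z =>
      rw [twl_pure, twl_pure, assocLin_pure _ _ rfl (by omega), assocLin_pure _ _ rfl (by omega),
        twl_pure, twl_pure]
  map_wr c _ _ _ f := by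
    induction f using tind₃ with
    | zero => simp
    | add x y hx hy => simp only [map_add, hx, hy]
    | tm i j l m h h' x y z =>
      rw [twr_pure, twr_pure, assocLin_pure _ _ rfl (by omega), assocLin_pure _ _ rfl (by omega),
        twr_pure, twr_pure]
  map_d h f := by
    induction f using tind₃ with
    | zero => simp
    | add x y hx hy => simp only [map_add, hx, hy]
    | tm i j l m h₁ h₂ x y z =>
      rw [assocLin_pure h₁ h₂ rfl (by omega), td_pure (P := P.prod Q) h h₂ (sub_add_cancel m 1)
        (sub_add_cancel l 1) (by omega) (by omega), td_pure (m := m - 1) (sub_add_cancel m 1) h₁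
        (sub_add_cancel i 1) (sub_add_cancel j 1) (by omega) (by omega),
        td_pure (Q := Q.prod R) h _ (sub_add_cancel i 1) (sub_add_cancel (j + l) 1) (by omega)
        (by omega), td_pure (m := j + l - 1) (sub_add_cancel (j + l) 1) rfl
        (sub_add_cancel j 1) (sub_add_cancel l 1) (by omega) (by omega)]
      simp only [map_add, LinearMap.add_apply, map_smul, LinearMap.smul_apply]
      rw [assocLin_pure _ _ rfl (by omega), assocLin_pure (q := j + l - 1) _ _ (by omega) (by omega),
        assocLin_pure (q := j + l - 1) _ _ (by omega) (by omega),
        show sg k m = sg k i * sg k j by rw [← h₁, sg_add], smul_add, smul_smul, add_assoc]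
  map_str s := by
    change assocLin (tm (P := P.prod Q) _ (tm _ _ _) _) = tm (Q := Q.prod R) _ _ (tm _ _ _)
    rw [assocLin_pure _ _ rfl (by omega)]

/-- The linear maps underlying `lun`. -/
def lunLin {a b : Word} {n : ℤ} : THom (DGProp.unit k) P a b n →ₗ[k] P.Hom a b n :=
  tdesc fun i j h => if hi : i = 0 then LinearMap.mk₂ k
    (fun r x => r.1 • P.comp (show 0 + j = n by omega) (P.str (.id b)) x)
    (fun _ _ _ => add_smul _ _ _) (fun _ _ _ => mul_smul _ _ _)
    (fun _ _ _ => by rw [map_add, smul_add]) (fun _ _ _ => by rw [map_smul, smul_comm]) else 0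

@[simp] theorem lunLin_pure {a b : Word} {n : ℤ} (h : 0 + n = n)
    (r : (DGProp.unit k).Hom a b 0) (x : P.Hom a b n) :
    lunLin (tm h r x) = r.1 • x := by
  rw [lunLin, tdesc_pure, dif_pos rfl]
  exact congrArg (r.1 • ·) (P.id_comp x)

/-- The linear maps underlying `run`. -/
def runLin {a b : Word} {n : ℤ} : THom P (DGProp.unit k) a b n →ₗ[k] P.Hom a b n :=
  tdesc fun i j h => if hj : j = 0 then LinearMap.flip (LinearMap.mk₂ k
    (fun r x => r.1 • P.comp (show 0 + i = n by omega) (P.str (.id b)) x)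
    (fun _ _ _ => add_smul _ _ _) (fun _ _ _ => mul_smul _ _ _)
    (fun _ _ _ => by rw [map_add, smul_add]) (fun _ _ _ => by rw [map_smul, smul_comm])) else 0

@[simp] theorem runLin_pure {a b : Word} {n : ℤ} (h : n + 0 = n)
    (x : P.Hom a b n) (r : (DGProp.unit k).Hom a b 0) :
    runLin (tm h x r) = r.1 • x := by
  rw [runLin, tdesc_pure, dif_pos rfl]
  exact congrArg (r.1 • ·) (P.id_comp x)

theorem lind {a b : Word} {n : ℤ} {p : THom (DGProp.unit k) P a b n → Prop}
    (x : THom (DGProp.unit k) P a b n) (zero : p 0) (add : ∀ x y, p x → p y → p (x + y))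
    (tm : ∀ (r : (DGProp.unit k).Hom a b 0) (x : P.Hom a b n), p (tm (zero_add n) r x)) : p x := by
  induction x using tind with
  | zero => exact zero
  | add x y hx hy => exact add x y hx hy
  | tm i j h r x =>
    by_cases hi : i = 0
    · subst hi
      obtain rfl : j = n := by omega
      exact tm r x
    · have : r = 0 := Subtype.ext (DGMod.unit_gr hi r.2)
      rw [this, map_zero, LinearMap.zero_apply]; exact zero

theorem rind {a b : Word} {n : ℤ} {p : THom P (DGProp.unit k) a b n → Prop}
    (x : THom P (DGProp.unit k) a b n) (zero : p 0) (add : ∀ x y, p x → p y → p (x + y))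
    (tm : ∀ (x : P.Hom a b n) (r : (DGProp.unit k).Hom a b 0), p (tm (add_zero n) x r)) : p x := by
  induction x using tind with
  | zero => exact zero
  | add x y hx hy => exact add x y hx hy
  | tm i j h x r =>
    by_cases hi : j = 0
    · subst hi
      obtain rfl : i = n := by omega
      exact tm x r
    · have : r = 0 := Subtype.ext (DGMod.unit_gr hi r.2)
      rw [this, map_zero]; exact zero

end PropHom

/-- A Hopf structure on a prop. -/
structure Hopf (P : DGProp k) where
  Δ : PropHom P (P.prod P)
  ε : PropHom P (DGProp.unit k)
  coassoc : ∀ {a b : Word} {n : ℤ} (f : P.Hom a b n),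
    (PropHom.assoc P P P).map ((Δ.prodMap (.id P)).map (Δ.map f)) =
      (PropHom.prodMap (.id P) Δ).map (Δ.map f)
  counit_left : ∀ {a b : Word} {n : ℤ} (f : P.Hom a b n),
    PropHom.lunLin ((ε.prodMap (.id P)).map (Δ.map f)) = f
  counit_right : ∀ {a b : Word} {n : ℤ} (f : P.Hom a b n),
    PropHom.runLin ((PropHom.prodMap (.id P) ε).map (Δ.map f)) = f

namespace PropHom
open DGProp
variable {P : DGProp k}

/-- The left unit isomorphism for tensor products of props. -/
def lun (P : DGProp k) : PropHom ((DGProp.unit k).prod P) P where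
  map := lunLin
  map_comp h f g := by
    induction f using lind with
    | zero => simp only [map_zero, LinearMap.zero_apply]
    | add x y hx hy => simp only [map_add, LinearMap.add_apply, hx, hy]
    | tm r x =>
    induction g using lind with
    | zero => simp only [map_zero]
    | add x y hx hy => simp only [map_add, hx, hy]
    | tm r' x' =>
      rw [tcomp_pure h _ _ (zero_add 0) h (zero_add _), map_smul, lunLin_pure, lunLin_pure,
        lunLin_pure]
      simp only [mul_zero, sg_zero, map_smul, LinearMap.smul_apply, smul_smul]
      rw [one_mul, mul_comm r'.1]; rfl
  map_wl c _ _ _ f := by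
    induction f using lind with
    | zero => simp only [map_zero]
    | add x y hx hy => simp only [map_add, hx, hy]
    | tm r x => rw [twl_pure, lunLin_pure, lunLin_pure, map_smul]; rfl
  map_wr c _ _ _ f := by
    induction f using lind with
    | zero => simp only [map_zero]
    | add x y hx hy => simp only [map_add, hx, hy]
    | tm r x => rw [twr_pure, lunLin_pure, lunLin_pure, map_smul]; rfl
  map_d h f := by
    induction f using lind with
    | zero => simp only [map_zero]
    | add x y hx hy => simp only [map_add, hx, hy]
    | tm r x =>
      rw [td_pure h _ (neg_add_cancel 1) h (by omega) (zero_add _), map_add, map_smul, lunLin_pure,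
        lunLin_pure, map_smul, sg_zero, one_smul]
      simp only [LinearMap.zero_apply, map_zero, zero_add]
  map_str s := by
    change lunLin (tm _ _ _) = _
    rw [lunLin_pure]; exact one_smul _ _

/-- The right unit isomorphism for tensor products of props. -/
def run (P : DGProp k) : PropHom (P.prod (DGProp.unit k)) P where
  map := runLin
  map_comp h f g := by
    induction f using rind with
    | zero => simp only [map_zero, LinearMap.zero_apply]
    | add x y hx hy => simp only [map_add, LinearMap.add_apply, hx, hy]
    | tm x r =>
    induction g using rind with
    | zero => simp only [map_zero]
    | add x y hx hy => simp only [map_add, hx, hy]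
    | tm x' r' =>
      rw [tcomp_pure h _ _ h (zero_add 0) (add_zero _), map_smul, runLin_pure, runLin_pure,
        runLin_pure]
      simp only [zero_mul, sg_zero, map_smul, LinearMap.smul_apply, smul_smul]
      rw [one_mul, mul_comm r'.1]; rfl
  map_wl c _ _ _ f := by
    induction f using rind with
    | zero => simp only [map_zero]
    | add x y hx hy => simp only [map_add, hx, hy]
    | tm r x => rw [twl_pure, runLin_pure, runLin_pure, map_smul]; rfl
  map_wr c _ _ _ f := by
    induction f using rind with
    | zero => simp only [map_zero]
    | add x y hx hy => simp only [map_add, hx, hy]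
    | tm r x => rw [twr_pure, runLin_pure, runLin_pure, map_smul]; rfl
  map_d h f := by
    induction f using rind with
    | zero => simp only [map_zero]
    | add x y hx hy => simp only [map_add, hx, hy]
    | tm x r =>
      rw [td_pure h _ h (neg_add_cancel 1) (add_zero _) (by omega), map_add, map_smul, runLin_pure,
        runLin_pure, map_smul]
      simp only [LinearMap.zero_apply, map_zero, add_zero, smul_zero]
  map_str s := by
    change runLin (tm _ _ _) = _
    rw [runLin_pure]; exact one_smul _ _

end PropHom

namespace Gens
open DGProp

variable {P Q : DGProp k}

/-- The composite `a ∘ (cu ⊗ 1)` of the counit on the left factor and the unit isomorphism. -/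
def cl (G : Gens P) : P.Hom (.tens .X .X) .X 0 :=
  P.comp (zero_add 0) (P.str (.lun .X)) (P.wr .X G.cu)

/-- The composite of the counit on the right factor and the unit isomorphism. -/
def cr (G : Gens P) : P.Hom (.tens .X .X) .X 0 :=
  P.comp (zero_add 0) (P.str (.run .X)) (P.wl .X G.cu)

theorem d_cr (G : Gens P) : P.d (neg_add_cancel 1) G.cr = 0 := by
  rw [cr, P.d_comp (zero_add 0) (neg_add_cancel 1) (neg_add_cancel 1) _ (add_zero _) (zero_add _),
    P.d_str, P.d_wl, G.d_cu, map_zero, map_zero, map_zero, smul_zero, add_zero,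
    LinearMap.zero_apply]

theorem d_cl (G : Gens P) : P.d (neg_add_cancel 1) G.cl = 0 := by
  rw [cl, P.d_comp (zero_add 0) (neg_add_cancel 1) (neg_add_cancel 1) _ (add_zero _) (zero_add _),
    P.d_str, P.d_wr, G.d_cu, map_zero, map_zero, map_zero, smul_zero, add_zero,
    LinearMap.zero_apply]

/-- The structure on a tensor product of props: `cu ⊗ cu`, `cp ⊗ cp` and
`(1 ⊗ cu) ⊗ pr + pr ⊗ (cu ⊗ 1)`. -/
def prod (G : Gens P) (H : Gens Q) : Gens (P.prod Q) where
  cu := tm (add_zero 0) G.cu H.cu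
  cp := tm (add_zero 0) G.cp H.cp
  pr := tm (zero_add 1) G.cr H.pr + tm (add_zero 1) G.pr H.cl
  d_cu := by
    rw [td_pure _ _ (neg_add_cancel 1) (neg_add_cancel 1) rfl rfl, G.d_cu, H.d_cu]
    simp only [map_zero, LinearMap.zero_apply, smul_zero, add_zero]
  d_cp := by
    rw [td_pure _ _ (neg_add_cancel 1) (neg_add_cancel 1) rfl rfl, G.d_cp, H.d_cp]
    simp only [map_zero, LinearMap.zero_apply, smul_zero, add_zero]
  d_pr := by
    rw [map_add, td_pure _ _ (neg_add_cancel 1) (zero_add 1) (neg_add_cancel 1) (zero_add 0),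
      td_pure _ _ (zero_add 1) (neg_add_cancel 1) (zero_add 0) (add_neg_cancel 1), G.d_cr, H.d_cl,
      G.d_pr, H.d_pr, map_zero, map_zero, LinearMap.zero_apply, smul_zero, add_zero, zero_add,
      sg_zero, one_smul, twr_pure, twl_pure, str_tcomp_pure, str_tcomp_pure]
    change tm _ G.cr (H.cl - H.cr) + tm _ (G.cl - G.cr) H.cl = tm _ G.cl H.cl - tm _ G.cr H.cr
    rw [map_sub, map_sub, LinearMap.sub_apply, sub_add_sub_comm]
    abel
  counit_left := by
    rw [twr_pure, tcomp_pure _ _ _ (zero_add 0) (zero_add 0) rfl, G.counit_left, H.counit_left,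
      mul_zero, sg_zero, one_smul]; rfl
  counit_right := by
    rw [twl_pure, tcomp_pure _ _ _ (zero_add 0) (zero_add 0) rfl, G.counit_right, H.counit_right,
      mul_zero, sg_zero, one_smul]; rfl
  coassoc := by
    rw [twr_pure, twl_pure, tcomp_pure _ _ _ (zero_add 0) (zero_add 0) rfl,
      tcomp_pure _ _ _ (zero_add 0) (zero_add 0) rfl,
      mul_zero, sg_zero, one_smul, one_smul, str_tcomp_pure, G.coassoc, H.coassoc]
  cu_pr := by
    rw [map_add, tcomp_pure _ _ _ (zero_add 0) (zero_add 1) rfl,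
      tcomp_pure _ _ _ (zero_add 1) (zero_add 0) rfl, G.cu_pr, H.cu_pr]
    simp only [map_zero, LinearMap.zero_apply, smul_zero, add_zero]

/-- The structure on the unit prop. -/
def unit (k : Type u) [CommRing k] : Gens (DGProp.unit k) where
  cu := ⟨1, DGMod.one_mem_gr⟩
  cp := ⟨1, DGMod.one_mem_gr⟩
  pr := 0
  d_cu := rfl
  d_cp := rfl
  d_pr := (sub_self _).symm
  counit_left := Subtype.ext (one_mul _)
  counit_right := Subtype.ext (one_mul _)
  coassoc := Subtype.ext (one_mul _)
  cu_pr := map_zero _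

/-- The image of a structure under a morphism of props. -/
def map (G : Gens P) (φ : PropHom P Q) : Gens Q where
  cu := φ.map G.cu
  cp := φ.map G.cp
  pr := φ.map G.pr
  d_cu := by rw [← φ.map_d, G.d_cu, map_zero]
  d_cp := by rw [← φ.map_d, G.d_cp, map_zero]
  d_pr := by
    rw [← φ.map_d, G.d_pr, map_sub, φ.map_comp, φ.map_comp, φ.map_str, φ.map_str, φ.map_wl,
      φ.map_wr]
  counit_left := by rw [← φ.map_wr, ← φ.map_comp, G.counit_left, φ.map_str]
  counit_right := by rw [← φ.map_wl, ← φ.map_comp, G.counit_right, φ.map_str]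
  coassoc := by
    rw [← φ.map_wr, ← φ.map_wl, ← φ.map_comp, ← φ.map_str, ← φ.map_comp, ← φ.map_comp, G.coassoc]
  cu_pr := by rw [← φ.map_comp, G.cu_pr, map_zero]

end Gens

namespace Gens
open DGProp
variable {P Q : DGProp k}

theorem prod_cu (G : Gens P) (H : Gens Q) : (G.prod H).cu = tm (add_zero 0) G.cu H.cu := rfl

theorem prod_cp (G : Gens P) (H : Gens Q) : (G.prod H).cp = tm (add_zero 0) G.cp H.cp := rfl

theorem prod_pr (G : Gens P) (H : Gens Q) : (G.prod H).pr =
    tm (zero_add 1) G.cr H.pr + tm (add_zero 1) G.pr H.cl := rfl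

theorem prod_cr (G : Gens P) (H : Gens Q) : (G.prod H).cr = tm (add_zero 0) G.cr H.cr := by
  rw [cr, prod_cu, twl_pure]
  exact str_tcomp_pure _ _ _ _

theorem prod_cl (G : Gens P) (H : Gens Q) : (G.prod H).cl = tm (add_zero 0) G.cl H.cl := by
  rw [cl, prod_cu, twr_pure]
  exact str_tcomp_pure _ _ _ _

theorem map_cr (G : Gens P) (φ : PropHom P Q) : φ.map G.cr = (G.map φ).cr := by
  rw [cr, φ.map_comp, φ.map_str, φ.map_wl]; rfl

theorem map_cl (G : Gens P) (φ : PropHom P Q) : φ.map G.cl = (G.map φ).cl := by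
  rw [cl, φ.map_comp, φ.map_str, φ.map_wr]; rfl

theorem unit_cr : (unit k).cr = ⟨1, DGMod.one_mem_gr⟩ := Subtype.ext (one_mul _)

theorem unit_cl : (unit k).cl = ⟨1, DGMod.one_mem_gr⟩ := Subtype.ext (one_mul _)

end Gens

theorem PropHom.trans_map {P Q R : DGProp k} (φ : PropHom P Q) (ψ : PropHom Q R) {a b : Word} {n : ℤ}
    (x : P.Hom a b n) : (φ.trans ψ).map x = ψ.map (φ.map x) := rfl

theorem PropHom.prodMap_map {P Q P' Q' : DGProp k} (φ : PropHom P P') (ψ : PropHom Q Q')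
    {a b : Word} {n : ℤ} (x : (P.prod Q).Hom a b n) : (φ.prodMap ψ).map x = prodLin φ ψ x := rfl

theorem PropHom.idp_map {P : DGProp k} {a b : Word} {n : ℤ} (x : P.Hom a b n) :
    (PropHom.id P).map x = x := rfl

theorem M.lift_cu {P : DGProp k} (G : Gens P) : (M.lift G).map (M.gens k).cu = G.cu := rfl

theorem M.lift_cp {P : DGProp k} (G : Gens P) : (M.lift G).map (M.gens k).cp = G.cp := rfl

theorem M.lift_pr {P : DGProp k} (G : Gens P) : (M.lift G).map (M.gens k).pr = G.pr := rfl

theorem M.lift_cr {P : DGProp k} (G : Gens P) : (M.lift G).map (M.gens k).cr = G.cr :=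
  Gens.map_cr _ _

theorem M.lift_cl {P : DGProp k} (G : Gens P) : (M.lift G).map (M.gens k).cl = G.cl :=
  Gens.map_cl _ _

section
open DGProp PropHom

/-- The Hopf structure on `M`. -/
def M.hopf (k : Type u) [CommRing k] : Hopf (M k) where
  Δ := M.lift ((M.gens k).prod (M.gens k))
  ε := M.lift (Gens.unit k)
  coassoc f := by
    refine M.hom_eq (((M.lift _).trans (PropHom.prodMap (M.lift _) (.id _))).trans
      (PropHom.assoc _ _ _)) ((M.lift _).trans (PropHom.prodMap (.id _) (M.lift _))) ?_ ?_ ?_ f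
    · rw [trans_map, trans_map, trans_map, prodMap_map, prodMap_map, M.lift_cu, Gens.prod_cu,
        prodLin_pure, prodLin_pure, idp_map, M.lift_cu, Gens.prod_cu]
      exact PropHom.assocLin_pure _ _ (add_zero 0) (add_zero 0) _ _ _
    · rw [trans_map, trans_map, trans_map, prodMap_map, prodMap_map, M.lift_cp, Gens.prod_cp,
        prodLin_pure, prodLin_pure, idp_map, M.lift_cp, Gens.prod_cp]
      exact PropHom.assocLin_pure _ _ (add_zero 0) (add_zero 0) _ _ _
    · rw [trans_map, trans_map, trans_map, prodMap_map, prodMap_map, M.lift_pr, Gens.prod_pr,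
        map_add, map_add, map_add, prodLin_pure, prodLin_pure, prodLin_pure, prodLin_pure, idp_map, M.lift_cr, M.lift_pr, M.lift_cl, Gens.prod_cr, Gens.prod_cl, Gens.prod_pr]
      simp only [map_add, LinearMap.add_apply, ← add_assoc]
      exact congrArg₂ (· + ·) (congrArg₂ (· + ·)
        (PropHom.assocLin_pure _ _ (zero_add 1) (zero_add 1) _ _ _)
        (PropHom.assocLin_pure _ _ (add_zero 1) (zero_add 1) _ _ _))
        (PropHom.assocLin_pure _ _ (add_zero 0) (add_zero 1) _ _ _)
  counit_left f := by
    refine M.hom_eq (((M.lift _).trans (PropHom.prodMap (M.lift (Gens.unit k)) (.id _))).trans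
      (PropHom.lun _)) (.id _) ?_ ?_ ?_ f
    · rw [trans_map, trans_map, prodMap_map, M.lift_cu, Gens.prod_cu, prodLin_pure]
      exact (lunLin_pure _ _ _).trans (one_smul _ _)
    · rw [trans_map, trans_map, prodMap_map, M.lift_cp, Gens.prod_cp, prodLin_pure]
      exact (lunLin_pure _ _ _).trans (one_smul _ _)
    · rw [trans_map, trans_map, prodMap_map, M.lift_pr, Gens.prod_pr, map_add, prodLin_pure,
        prodLin_pure, map_add, M.lift_pr, M.lift_cr, Gens.unit_cr,
        show (Gens.unit k).pr = 0 from rfl, map_zero, LinearMap.zero_apply, map_zero, add_zero]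
      exact (lunLin_pure _ _ _).trans (one_smul _ _)
  counit_right f := by
    refine M.hom_eq (((M.lift _).trans (PropHom.prodMap (.id _) (M.lift (Gens.unit k)))).trans
      (PropHom.run _)) (.id _) ?_ ?_ ?_ f
    · rw [trans_map, trans_map, prodMap_map, M.lift_cu, Gens.prod_cu, prodLin_pure]
      exact (runLin_pure _ _ _).trans (one_smul _ _)
    · rw [trans_map, trans_map, prodMap_map, M.lift_cp, Gens.prod_cp, prodLin_pure]
      exact (runLin_pure _ _ _).trans (one_smul _ _)
    · rw [trans_map, trans_map, prodMap_map, M.lift_pr, Gens.prod_pr, map_add, prodLin_pure,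
        prodLin_pure, map_add, M.lift_pr, M.lift_cl, Gens.unit_cl,
        show (Gens.unit k).pr = 0 from rfl, map_zero, map_zero, zero_add]
      exact (runLin_pure _ _ _).trans (one_smul _ _)

end

end

section

variable {k : Type u} [CommRing k]

namespace DGMod

theorem tensorμ_tmul {A B C D : DGMod k} {i j : ℤ} (x : A) {y : B} {z : C} (t : D)
    (hy : y ∈ B.gr i) (hz : z ∈ C.gr j) :
    (tensorμ A B C D).lin ((x ⊗ₜ y) ⊗ₜ (z ⊗ₜ t)) =
      sg k (i * j) • ((x ⊗ₜ[k] z) ⊗ₜ[k] (y ⊗ₜ[k] t)) := by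
  change (TensorProduct.assoc k A C (B ⊗[k] D)).symm (TensorProduct.map LinearMap.id
    (TensorProduct.assoc k C B D).toLinearMap (TensorProduct.map LinearMap.id
    (TensorProduct.map (braidLin B C) LinearMap.id) (TensorProduct.map LinearMap.id
    (TensorProduct.assoc k B C D).symm.toLinearMap (x ⊗ₜ (y ⊗ₜ (z ⊗ₜ t)))))) = _
  simp only [TensorProduct.map_tmul, LinearEquiv.coe_coe, TensorProduct.assoc_symm_tmul,
    braidLin_tmul hy hz, ← TensorProduct.smul_tmul', TensorProduct.tmul_smul, map_smul,
    TensorProduct.assoc_tmul, LinearMap.id_apply]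

theorem lin_ext₄ {A B C D : DGMod k} {E : Type*} [AddCommMonoid E] [Module k E]
    {f g : (A ⊗[k] B) ⊗[k] (C ⊗[k] D) →ₗ[k] E}
    (h : ∀ (i j l m : ℤ) (x : A) (y : B) (z : C) (t : D), x ∈ A.gr i → y ∈ B.gr j → z ∈ C.gr l →
      t ∈ D.gr m → f ((x ⊗ₜ y) ⊗ₜ (z ⊗ₜ t)) = g ((x ⊗ₜ y) ⊗ₜ (z ⊗ₜ t))) : f = g := by
  apply TensorProduct.ext
  apply lin_ext₂; intro i j x y hx hy
  apply lin_ext₂; intro l m z t hz ht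
  exact h i j l m x y z t hx hy hz ht

theorem braid_tensorμ (A B C D : DGMod k) :
    ((β_ A B).hom ⊗ₘ (β_ C D).hom) ≫ tensorμ B A D C =
      tensorμ A B C D ≫ (β_ (A ⊗ C) (B ⊗ D)).hom := by
  apply hom_ext
  apply lin_ext₄
  intro i j l m x y z t hx hy hz ht
  change (tensorμ B A D C).lin (TensorProduct.map (braidLin A B) (braidLin C D)
    ((x ⊗ₜ y) ⊗ₜ (z ⊗ₜ t))) = braidLin (tens A C) (tens B D) ((tensorμ A B C D).lin _)
  rw [tensorμ_tmul x t hy hz, map_smul, braidLin_tmul (C := tens A C) (D := tens B D)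
    (tmul_mem rfl hx hz) (tmul_mem rfl hy ht), TensorProduct.map_tmul, braidLin_tmul hx hy,
    braidLin_tmul hz ht, TensorProduct.smul_tmul_smul, map_smul, tensorμ_tmul y z hx ht]
  simp only [smul_smul, ← sg_add]
  congr 1
  apply sg_congr; push_cast
  generalize (i : ZMod 2) = a; generalize (j : ZMod 2) = b
  generalize (l : ZMod 2) = c; generalize (m : ZMod 2) = d
  revert a b c d; decide

end DGMod

section shuffle
variable {V : Type v} [Category.{w} V] [MonoidalCategory V]

/-- The iterated tensor product of a morphism. -/
def Word.powMap {C D : V} (f : C ⟶ D) : ∀ a : Word, a.pow C ⟶ a.pow D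
  | .one => 𝟙 _
  | .X => f
  | .tens a b => Word.powMap f a ⊗ₘ Word.powMap f b

theorem Word.powMap_id (C : V) (a : Word) : a.powMap (𝟙 C) = 𝟙 _ := by
  induction a with
  | one => rfl
  | X => rfl
  | tens a b ha hb => simp [powMap, ha, hb, pow]

theorem Word.powMap_comp {C D E : V} (f : C ⟶ D) (g : D ⟶ E) (a : Word) :
    a.powMap (f ≫ g) = a.powMap f ≫ a.powMap g := by
  induction a with
  | one => simp [powMap, pow]
  | X => rfl
  | tens a b ha hb => simp [powMap, ha, hb, pow]

theorem Str.map_natural [BraidedCategory V] {C D : V} (f : C ⟶ D) {a b : Word} (s : Str a b) :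
    s.map C ≫ b.powMap f = a.powMap f ≫ s.map D := by
  induction s with
  | id a => simp [Str.map]
  | comp s t hs ht => simp [Str.map, ht, ← reassoc_of% hs]
  | wl c s hs =>
    simp only [Str.map, Word.powMap, Word.pow, ← id_tensorHom, tensorHom_comp_tensorHom, hs,
      Category.id_comp, Category.comp_id]
  | wr s c hs =>
    simp only [Str.map, Word.powMap, Word.pow, ← tensorHom_id, tensorHom_comp_tensorHom, hs,
      Category.id_comp, Category.comp_id]
  | assoc a b c => simp [Str.map, Word.powMap, Word.pow]
  | associ a b c => simp [Str.map, Word.powMap, Word.pow]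
  | lun a => simp [Str.map, Word.powMap, Word.pow]
  | luni a => simp [Str.map, Word.powMap, Word.pow]
  | run a => simp [Str.map, Word.powMap, Word.pow]
  | runi a => simp [Str.map, Word.powMap, Word.pow]
  | braid a b => simp [Str.map, Word.powMap, Word.pow]

/-- The rearrangement of `C ⊗ ⋯ ⊗ C ⊗ D ⊗ ⋯ ⊗ D` as `(C ⊗ D) ⊗ ⋯ ⊗ (C ⊗ D)`. -/
def Word.shuf [BraidedCategory V] (C D : V) : ∀ a : Word, a.pow C ⊗ a.pow D ≅ a.pow (C ⊗ D)
  | .one => λ_ (𝟙_ V)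
  | .X => Iso.refl _
  | .tens a b =>
    { hom := tensorμ (a.pow C) (b.pow C) (a.pow D) (b.pow D)
      inv := tensorδ (a.pow C) (b.pow C) (a.pow D) (b.pow D)
      hom_inv_id := tensorμ_tensorδ _ _ _ _
      inv_hom_id := tensorδ_tensorμ _ _ _ _ } ≪≫ (Word.shuf C D a ⊗ᵢ Word.shuf C D b)

theorem Word.shuf_natural [BraidedCategory V] {C C' D D' : V} (f : C ⟶ C') (g : D ⟶ D')
    (a : Word) : (a.powMap f ⊗ₘ a.powMap g) ≫ (a.shuf C' D').hom =
      (a.shuf C D).hom ≫ a.powMap (f ⊗ₘ g) := by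
  induction a with
  | one => simp [powMap, shuf, pow]
  | X => simp [powMap, shuf, pow]
  | tens a b ha hb =>
    simp only [powMap, shuf, pow, Iso.trans_hom, tensorIso_hom, Category.assoc]
    rw [tensorμ_natural_assoc, tensorHom_comp_tensorHom, tensorHom_comp_tensorHom, ha, hb]

theorem Word.shuf_assoc [BraidedCategory V] (C D E : V) (a : Word) :
    ((a.shuf C D).hom ▷ a.pow E) ≫ (a.shuf (C ⊗ D) E).hom ≫ a.powMap (α_ C D E).hom =
      (α_ _ _ _).hom ≫ (a.pow C ◁ (a.shuf D E).hom) ≫ (a.shuf C (D ⊗ E)).hom := by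
  induction a with
  | one => simp [powMap, shuf, pow, unitors_equal]
  | X => simp [powMap, shuf, pow]
  | tens a b ha hb =>
    have h1 := tensor_associativity (a.pow C) (b.pow C) (a.pow D) (b.pow D) (a.pow E) (b.pow E)
    simp only [powMap, shuf, pow, Iso.trans_hom, tensorIso_hom, Category.assoc, comp_whiskerRight,
      MonoidalCategory.whiskerLeft_comp]
    rw [tensorμ_natural_left_assoc, tensorμ_natural_right_assoc]
    simp only [tensorHom_comp_tensorHom]
    rw [ha, hb, ← tensorHom_comp_tensorHom, reassoc_of% h1, ← tensorHom_comp_tensorHom]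

/-- The isomorphism of the unit with its iterated tensor product. -/
def Word.unitPow (V : Type v) [Category.{w} V] [MonoidalCategory V] :
    ∀ a : Word, 𝟙_ V ≅ a.pow (𝟙_ V)
  | .one => Iso.refl _
  | .X => Iso.refl _
  | .tens a b => (λ_ (𝟙_ V)).symm ≪≫ (Word.unitPow V a ⊗ᵢ Word.unitPow V b)

theorem Word.shuf_lun [BraidedCategory V] (C : V) (a : Word) :
    ((a.unitPow V).hom ▷ a.pow C) ≫ (a.shuf (𝟙_ V) C).hom ≫ a.powMap (λ_ C).hom =
      (λ_ (a.pow C)).hom := by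
  induction a with
  | one => simp [powMap, shuf, pow, unitPow]
  | X => simp [powMap, shuf, pow, unitPow]
  | tens a b ha hb =>
    simp only [powMap, shuf, pow, unitPow, Iso.trans_hom, tensorIso_hom, Category.assoc,
      comp_whiskerRight, Iso.symm_hom]
    rw [tensorμ_natural_left_assoc]
    simp only [tensorHom_comp_tensorHom]
    rw [ha, hb, ← tensor_left_unitality]

theorem Word.shuf_run [BraidedCategory V] (C : V) (a : Word) :
    (a.pow C ◁ (a.unitPow V).hom) ≫ (a.shuf C (𝟙_ V)).hom ≫ a.powMap (ρ_ C).hom =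
      (ρ_ (a.pow C)).hom := by
  induction a with
  | one => simp [powMap, shuf, pow, unitPow, unitors_equal]
  | X => simp [powMap, shuf, pow, unitPow]
  | tens a b ha hb =>
    simp only [powMap, shuf, pow, unitPow, Iso.trans_hom, tensorIso_hom, Category.assoc,
      MonoidalCategory.whiskerLeft_comp, Iso.symm_hom]
    rw [tensorμ_natural_right_assoc]
    simp only [tensorHom_comp_tensorHom]
    rw [ha, hb, ← tensor_right_unitality]

theorem Word.unitPow_assoc {A B C : V} (f : 𝟙_ V ⟶ A) (g : 𝟙_ V ⟶ B) (h : 𝟙_ V ⟶ C) :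
    (λ_ (𝟙_ V)).inv ≫ (((λ_ (𝟙_ V)).inv ≫ (f ⊗ₘ g)) ⊗ₘ h) ≫ (α_ A B C).hom =
      (λ_ (𝟙_ V)).inv ≫ (f ⊗ₘ ((λ_ (𝟙_ V)).inv ≫ (g ⊗ₘ h))) := by
  rw [← whiskerRight_comp_tensorHom, ← whiskerLeft_comp_tensorHom, Category.assoc,
    associator_naturality]
  monoidal

theorem Str.unitPow [SymmetricCategory V] {a b : Word} (s : Str a b) :
    (a.unitPow V).hom ≫ s.map (𝟙_ V) = (b.unitPow V).hom := by
  induction s with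
  | id a => simp [Str.map]
  | comp s t hs ht => simp only [Str.map, reassoc_of% hs, ht]
  | wl c s hs =>
    simp only [Str.map, Word.unitPow, Word.pow, Iso.trans_hom, tensorIso_hom, Category.assoc,
      ← id_tensorHom, tensorHom_comp_tensorHom, hs, Category.comp_id]
  | wr s c hs =>
    simp only [Str.map, Word.unitPow, Word.pow, Iso.trans_hom, tensorIso_hom, Category.assoc,
      ← tensorHom_id, tensorHom_comp_tensorHom, hs, Category.comp_id]
  | assoc a b c =>
    simp only [Str.map, Word.unitPow, Word.pow, Iso.trans_hom, tensorIso_hom, Category.assoc,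
      Iso.symm_hom]
    exact Word.unitPow_assoc _ _ _
  | associ a b c =>
    simp only [Str.map, Word.unitPow, Word.pow, Iso.trans_hom, tensorIso_hom, Category.assoc,
      Iso.symm_hom]
    rw [← Category.assoc, Iso.comp_inv_eq, Category.assoc]
    exact (Word.unitPow_assoc _ _ _).symm
  | lun a => simp [Str.map, Word.unitPow, Word.pow]
  | luni a => simp [Str.map, Word.unitPow, Word.pow]
  | run a => simp [Str.map, Word.unitPow, Word.pow, ← unitors_equal]
  | runi a => simp [Str.map, Word.unitPow, Word.pow, ← unitors_equal]
  | braid a b => simp [Str.map, Word.unitPow, Word.pow, ← unitors_equal]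

end shuffle

theorem Word.shuf_str_assoc (C D : DGMod k) (a b c : Word) :
    ((Str.assoc a b c).map C ⊗ₘ (Str.assoc a b c).map D) ≫ ((a.tens (b.tens c)).shuf C D).hom =
      (((a.tens b).tens c).shuf C D).hom ≫ (Str.assoc a b c).map (C ⊗ D) := by
  simp only [Str.map, Word.shuf, Word.pow, Iso.trans_hom, tensorIso_hom, Category.assoc]
  rw [← whiskerRight_comp_tensorHom, ← whiskerLeft_comp_tensorHom, Category.assoc,
    associator_naturality, associator_monoidal_assoc]

theorem Word.shuf_str_lun (C D : DGMod k) (a : Word) :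
    ((Str.lun a).map C ⊗ₘ (Str.lun a).map D) ≫ (a.shuf C D).hom =
      ((Word.one.tens a).shuf C D).hom ≫ (Str.lun a).map (C ⊗ D) := by
  simp only [Str.map, Word.shuf, Word.pow, Iso.trans_hom, tensorIso_hom, Category.assoc]
  rw [MonoidalCategory.tensorHom_def (λ_ (𝟙_ _)).hom, Category.assoc, leftUnitor_naturality,
    leftUnitor_monoidal_assoc]

theorem Word.shuf_str_run (C D : DGMod k) (a : Word) :
    ((Str.run a).map C ⊗ₘ (Str.run a).map D) ≫ (a.shuf C D).hom =
      ((a.tens Word.one).shuf C D).hom ≫ (Str.run a).map (C ⊗ D) := by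
  simp only [Str.map, Word.shuf, Word.pow, Iso.trans_hom, tensorIso_hom, Category.assoc]
  rw [MonoidalCategory.tensorHom_def' (Word.shuf C D a).hom, Category.assoc, rightUnitor_naturality,
    rightUnitor_monoidal_assoc]

theorem Word.shuf_inv {V : Type v} [Category.{w} V] [MonoidalCategory V]
    {A A' B B' E E' : V} (f : A ≅ A') (g : B ≅ B') (h : E ≅ E') (p : A ⊗ B ⟶ E) (q : A' ⊗ B' ⟶ E')
    (w : (f.hom ⊗ₘ g.hom) ≫ q = p ≫ h.hom) : (f.inv ⊗ₘ g.inv) ≫ p = q ≫ h.inv := by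
  rw [Iso.eq_comp_inv, Category.assoc, ← w, tensorHom_comp_tensorHom_assoc]
  simp

theorem Str.shuf (C D : DGMod k) {a b : Word} (s : Str a b) :
    (s.map C ⊗ₘ s.map D) ≫ (b.shuf C D).hom = (a.shuf C D).hom ≫ s.map (C ⊗ D) := by
  induction s with
  | id a => simp [Str.map]
  | comp s t hs ht => simp only [Str.map, ← tensorHom_comp_tensorHom, Category.assoc, ht,
      reassoc_of% hs]
  | wl c s hs =>
    simp only [Str.map, Word.shuf, Word.pow, Iso.trans_hom, tensorIso_hom, Category.assoc,
      ← id_tensorHom]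
    rw [tensorμ_natural_assoc, tensorHom_comp_tensorHom, tensorHom_comp_tensorHom, hs]
    simp
  | wr s c hs =>
    simp only [Str.map, Word.shuf, Word.pow, Iso.trans_hom, tensorIso_hom, Category.assoc,
      ← tensorHom_id]
    rw [tensorμ_natural_assoc, tensorHom_comp_tensorHom, tensorHom_comp_tensorHom, hs]
    simp
  | assoc a b c => exact Word.shuf_str_assoc C D a b c
  | associ a b c =>
    exact Word.shuf_inv (α_ (a.pow C) (b.pow C) (c.pow C))
      (α_ (a.pow D) (b.pow D) (c.pow D)) (α_ _ _ _) _ _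
      (Word.shuf_str_assoc C D a b c)
  | lun a => exact Word.shuf_str_lun C D a
  | luni a =>
    exact Word.shuf_inv (λ_ (a.pow C)) (λ_ (a.pow D)) (λ_ _) _ _
      (Word.shuf_str_lun C D a)
  | run a => exact Word.shuf_str_run C D a
  | runi a =>
    exact Word.shuf_inv (ρ_ (a.pow C)) (ρ_ (a.pow D)) (ρ_ _) _ _
      (Word.shuf_str_run C D a)
  | braid a b =>
    simp only [Str.map, Word.shuf, Word.pow, Iso.trans_hom, tensorIso_hom, Category.assoc]
    rw [BraidedCategory.braiding_naturality, reassoc_of% DGMod.braid_tensorμ]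

end

section

variable {k : Type u} [CommRing k]

namespace DGMod

theorem sgn_tens (C D : DGMod k) (m : ℤ) :
    (tens C D).sgn m = TensorProduct.map (C.sgn m) (D.sgn m) := by
  apply lin_ext₂
  intro i j x y hx hy
  rw [sgn_apply (C := tens C D) m (tmul_mem rfl hx hy), TensorProduct.map_tmul, sgn_apply m hx,
    sgn_apply m hy, TensorProduct.smul_tmul_smul, mul_add, sg_add]

theorem sgn_unit (m : ℤ) : (unit k).sgn m = LinearMap.id := by
  ext
  exact (sgn_apply m (one_mem_gr (k := k))).trans (by simp)

theorem sgn_zero (C : DGMod k) : C.sgn 0 = LinearMap.id :=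
  lin_ext fun i x hx => by simp [sgn_apply 0 hx]

theorem sgn_d (C : DGMod k) (m : ℤ) : C.d ∘ₗ C.sgn m = sg k m • C.sgn m ∘ₗ C.d :=
  lin_ext fun i x hx => by
    simp only [LinearMap.comp_apply, LinearMap.smul_apply, sgn_apply m hx,
      sgn_apply m (C.d_mem hx), map_smul, smul_smul, ← sg_add]
    congr 2; ring

theorem sgn_deg {C D : DGMod k} (m : ℤ) {n : ℤ} {f : C →ₗ[k] D} (hf : IsDeg C D n f) :
    D.sgn m ∘ₗ f = sg k (m * n) • f ∘ₗ C.sgn m :=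
  lin_ext fun i x hx => by
    simp only [LinearMap.comp_apply, LinearMap.smul_apply, sgn_apply m hx,
      sgn_apply m (hf i x hx), map_smul, smul_smul, ← sg_add]
    congr 2; ring

theorem sgn_hom {C D : DGMod k} (m : ℤ) (f : C ⟶ D) : D.sgn m ∘ₗ f.lin = f.lin ∘ₗ C.sgn m :=
  lin_ext fun i x hx => by
    simp only [LinearMap.comp_apply, sgn_apply m hx, sgn_apply m (f.deg hx), map_smul]

theorem hom_isDeg {C D : DGMod k} (f : C ⟶ D) : IsDeg C D 0 f.lin := fun n x hx => by
  rw [zero_add]; exact f.deg hx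

theorem IsDeg.comp {C D E : DGMod k} {i j n : ℤ} (h : i + j = n) {f : D →ₗ[k] E} {g : C →ₗ[k] D}
    (hf : IsDeg D E i f) (hg : IsDeg C D j g) : IsDeg C E n (f ∘ₗ g) := fun m x hx => by
  have := hf _ _ (hg m x hx)
  rw [← add_assoc, h] at this
  exact this

theorem IsDeg.cast {C D : DGMod k} {i j : ℤ} (h : i = j) {f : C →ₗ[k] D} (hf : IsDeg C D i f) :
    IsDeg C D j f := h ▸ hf

theorem sgn_isDeg (C : DGMod k) (m : ℤ) : IsDeg C C 0 (C.sgn m) := fun n x hx => by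
  rw [zero_add]; exact sgn_mem m hx

theorem IsDeg.map {C C' D D' : DGMod k} {i j n : ℤ} (h : i + j = n) {f : C →ₗ[k] C'}
    {g : D →ₗ[k] D'} (hf : IsDeg C C' i f) (hg : IsDeg D D' j g) :
    IsDeg (tens C D) (tens C' D') n (TensorProduct.map f g) :=
  deg_tens fun a b x y hx hy => tmul_mem (C := C') (D := D') (by omega) (hf a x hx) (hg b y hy)

theorem id_isDeg (C : DGMod k) : IsDeg C C 0 LinearMap.id := fun n x hx => by
  rw [zero_add]; exact hx

/-- The differential of a linear map, `d f = d ∘ f - (-1)^|f| f ∘ d`. -/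
def dHom (C D : DGMod k) {n m : ℤ} (h : m + 1 = n) : homDeg C D n →ₗ[k] homDeg C D m where
  toFun f := ⟨D.d ∘ₗ f.1 - sg k n • f.1 ∘ₗ C.d, fun i x hx => by
    have h₁ := D.d_mem (f.2 i x hx)
    have h₂ := f.2 _ _ (C.d_mem hx)
    rw [show n + i - 1 = m + i by omega] at h₁
    rw [show n + (i - 1) = m + i by omega] at h₂
    exact Submodule.sub_mem _ h₁ (Submodule.smul_mem _ _ h₂)⟩
  map_add' f g := Subtype.ext <| LinearMap.ext fun x => by
    simp only [Submodule.coe_add, LinearMap.comp_apply, LinearMap.add_apply, map_add,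
      LinearMap.sub_apply, LinearMap.smul_apply, smul_add, add_sub_add_comm]
  map_smul' r f := Subtype.ext <| LinearMap.ext fun x => by
    simp only [Submodule.coe_smul, LinearMap.comp_apply, map_smul,
      LinearMap.sub_apply, LinearMap.smul_apply, smul_sub, RingHom.id_apply, smul_comm r]

/-- Composition of homogeneous linear maps. -/
def compHom (C D E : DGMod k) {i j n : ℤ} (h : i + j = n) :
    homDeg D E i →ₗ[k] homDeg C D j →ₗ[k] homDeg C E n :=
  LinearMap.mk₂ k (fun f g => ⟨f.1 ∘ₗ g.1, IsDeg.comp h f.2 g.2⟩)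
    (fun _ _ _ => Subtype.ext (LinearMap.add_comp _ _ _))
    (fun _ _ _ => Subtype.ext (LinearMap.smul_comp _ _ _))
    (fun _ _ _ => Subtype.ext (LinearMap.comp_add _ _ _))
    (fun _ _ _ => Subtype.ext (LinearMap.comp_smul _ _ _))

/-- Tensor product of homogeneous linear maps: `(f ⊗ g) (x ⊗ y) = (-1)^(|g| |x|) f x ⊗ g y`. -/
def tensHom (C C' D D' : DGMod k) {i j n : ℤ} (h : i + j = n) :
    homDeg C C' i →ₗ[k] homDeg D D' j →ₗ[k] homDeg (tens C D) (tens C' D') n :=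
  LinearMap.mk₂ k (fun f g => ⟨TensorProduct.map (f.1 ∘ₗ C.sgn j) g.1,
      IsDeg.map h (IsDeg.comp (add_zero i) f.2 (sgn_isDeg C j)) g.2⟩)
    (fun _ _ _ => Subtype.ext (by
      simp only [Submodule.coe_add, LinearMap.add_comp, TensorProduct.map_add_left]))
    (fun _ _ _ => Subtype.ext (by
      simp only [Submodule.coe_smul, LinearMap.smul_comp, TensorProduct.map_smul_left]))
    (fun _ _ _ => Subtype.ext (TensorProduct.map_add_right _ _ _))
    (fun _ _ _ => Subtype.ext (TensorProduct.map_smul_right _ _ _))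

/-- A chain map as a linear map of degree `0`. -/
def hom₀ {C D : DGMod k} (f : C ⟶ D) : homDeg C D 0 := ⟨f.lin, hom_isDeg f⟩

theorem tensHom_tmul {C C' D D' : DGMod k} {i j n : ℤ} (h : i + j = n) (f : homDeg C C' i)
    (g : homDeg D D' j) {m : ℤ} {x : C} (hx : x ∈ C.gr m) (y : D) :
    (tensHom C C' D D' h f g).1 (x ⊗ₜ y) = sg k (j * m) • (f.1 x ⊗ₜ g.1 y) := by
  change TensorProduct.map _ _ _ = _
  rw [TensorProduct.map_tmul, LinearMap.comp_apply, sgn_apply j hx, map_smul,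
    TensorProduct.smul_tmul']

theorem tensHom_comp {A B C A' B' C' : DGMod k} {i i' j j' n m p q r : ℤ} (hn : i + i' = n)
    (hm : j + j' = m) (hp : n + m = p) (hq : i + j = q) (hr : i' + j' = r) (hp' : q + r = p)
    (f : homDeg B C i) (f' : homDeg B' C' i') (g : homDeg A B j) (g' : homDeg A' B' j') :
    compHom _ _ _ hp (tensHom B C B' C' hn f f') (tensHom A B A' B' hm g g') =
      sg k (i' * j) • tensHom A C A' C' hp' (compHom _ _ _ hq f g) (compHom _ _ _ hr f' g') := by
  apply Subtype.ext
  apply lin_ext₂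
  intro a b x y hx hy
  change (tensHom B C B' C' hn f f').1 ((tensHom A B A' B' hm g g').1 (x ⊗ₜ y)) =
    sg k (i' * j) • (tensHom A C A' C' hp' _ _).1 (x ⊗ₜ y)
  rw [tensHom_tmul _ _ _ hx, tensHom_tmul _ _ _ hx, map_smul, tensHom_tmul _ _ _ (g.2 a x hx),
    smul_smul, smul_smul, ← sg_add, ← sg_add]
  change _ • (f.1 (g.1 x) ⊗ₜ f'.1 (g'.1 y)) = _ • (f.1 (g.1 x) ⊗ₜ f'.1 (g'.1 y))
  congr 2
  rw [← hr]; ring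

theorem tensHom_d {A B A' B' : DGMod k} {i i' j j' n m : ℤ} (h : m + 1 = n) (hij : i + j = n)
    (hi : i' + 1 = i) (hj : j' + 1 = j) (h₁ : i' + j = m) (h₂ : i + j' = m) (f : homDeg A B i)
    (g : homDeg A' B' j) : dHom _ _ h (tensHom A B A' B' hij f g) =
      tensHom A B A' B' h₁ (dHom A B hi f) g +
        sg k i • tensHom A B A' B' h₂ f (dHom A' B' hj g) := by
  apply Subtype.ext
  apply lin_ext₂
  intro a b x y hx hy
  change (tens B B').d ((tensHom A B A' B' hij f g).1 (x ⊗ₜ y)) -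
    sg k n • (tensHom A B A' B' hij f g).1 ((tens A A').d (x ⊗ₜ y)) =
    (tensHom A B A' B' h₁ _ g).1 (x ⊗ₜ y) + sg k i • (tensHom A B A' B' h₂ f _).1 (x ⊗ₜ y)
  rw [tensHom_tmul _ _ _ hx, map_smul, tens_d_tmul (f.2 a x hx), tens_d_tmul hx, map_add, map_smul,
    tensHom_tmul _ _ _ hx, tensHom_tmul _ _ _ hx, tensHom_tmul _ _ _ hx,
    tensHom_tmul _ _ _ (A.d_mem hx)]
  change _ = sg k (j * a) • ((B.d (f.1 x) - sg k i • f.1 (A.d x)) ⊗ₜ[k] g.1 y) +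
    sg k i • sg k (j' * a) • (f.1 x ⊗ₜ[k] (B'.d (g.1 y) - sg k j • g.1 (A'.d y)))
  simp only [TensorProduct.sub_tmul, TensorProduct.tmul_sub, ← TensorProduct.smul_tmul',
    TensorProduct.tmul_smul, smul_add, smul_sub, smul_smul, ← sg_add]
  obtain rfl : j' = j - 1 := by omega
  subst hij
  have e₁ : sg k (j * a + (i + a)) = sg k (i + (j - 1) * a) := by
    apply sg_congr; push_cast
    generalize (i : ZMod 2) = i'; generalize (j : ZMod 2) = j'; generalize (a : ZMod 2) = a'
    revert i' j' a'; decide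
  have e₂ : sg k (i + j + j * (a - 1)) = sg k (j * a + i) := by
    apply sg_congr; push_cast
    generalize (i : ZMod 2) = i'; generalize (j : ZMod 2) = j'; generalize (a : ZMod 2) = a'
    revert i' j' a'; decide
  have e₃ : sg k (i + j + (a + j * a)) = sg k (i + ((j - 1) * a + j)) := by
    apply sg_congr; push_cast
    generalize (i : ZMod 2) = i'; generalize (j : ZMod 2) = j'; generalize (a : ZMod 2) = a'
    revert i' j' a'; decide
  rw [e₁, e₂, e₃]
  abel

theorem dHom_hom₀ {C D : DGMod k} (f : C ⟶ D) {m : ℤ} (h : m + 1 = 0) :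
    dHom C D h (hom₀ f) = 0 :=
  Subtype.ext <| LinearMap.ext fun x => by
    change D.d (f.lin x) - sg k 0 • f.lin (C.d x) = 0
    rw [f.comm, sg_zero, one_smul, sub_self]

theorem dHom_dHom {C D : DGMod k} {n m l : ℤ} (h : m + 1 = n) (h' : l + 1 = m)
    (f : homDeg C D n) : dHom C D h' (dHom C D h f) = 0 :=
  Subtype.ext <| LinearMap.ext fun x => by
    change D.d (D.d (f.1 x) - sg k n • f.1 (C.d x)) -
      sg k m • (D.d (f.1 (C.d x)) - sg k n • f.1 (C.d (C.d x))) = 0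
    rw [map_sub, D.d_d, C.d_d, map_zero, smul_zero, sub_zero, zero_sub, map_smul,
      show sg k n = - sg k m by rw [← h, sg_add, sg_one, mul_neg_one], neg_smul, neg_neg, sub_self]

theorem dHom_comp {C D E : DGMod k} {i i' j j' n m : ℤ} (h : i + j = n) (hi : i' + 1 = i)
    (hj : j' + 1 = j) (hn : m + 1 = n) (h₁ : i' + j = m) (h₂ : i + j' = m) (f : homDeg D E i)
    (g : homDeg C D j) : dHom C E hn (compHom C D E h f g) =
      compHom C D E h₁ (dHom D E hi f) g + sg k i • compHom C D E h₂ f (dHom C D hj g) :=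
  Subtype.ext <| LinearMap.ext fun x => by
    change E.d (f.1 (g.1 x)) - sg k n • f.1 (g.1 (C.d x)) =
      (E.d (f.1 (g.1 x)) - sg k i • f.1 (D.d (g.1 x))) +
        sg k i • f.1 (D.d (g.1 x) - sg k j • g.1 (C.d x))
    rw [map_sub, smul_sub, map_smul, smul_smul, ← sg_add, h]
    abel

theorem tensHom_hom₀_hom₀ {C C' D D' : DGMod k} (f : C ⟶ C') (g : D ⟶ D') :
    tensHom C C' D D' (add_zero 0) (hom₀ f) (hom₀ g) = hom₀ (f ⊗ₘ g) :=
  Subtype.ext <| lin_ext₂ fun i j x y hx hy => by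
    rw [tensHom_tmul _ _ _ hx, zero_mul, sg_zero, one_smul]; rfl

theorem tensHom_id_left {D D' : DGMod k} (C : DGMod k) {n : ℤ} (f : homDeg D D' n) :
    (tensHom C C D D' (zero_add n) (hom₀ (𝟙 C)) f).1 = TensorProduct.map (C.sgn n) f.1 := rfl

theorem tensHom_id_right {D D' : DGMod k} (C : DGMod k) {n : ℤ} (f : homDeg D D' n) :
    (tensHom D D' C C (add_zero n) f (hom₀ (𝟙 C))).1 = TensorProduct.map f.1 LinearMap.id := by
  change TensorProduct.map (f.1 ∘ₗ D.sgn 0) LinearMap.id = _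
  rw [sgn_zero, LinearMap.comp_id]

/-- `1 ⊗ f`. -/
def whl (E : DGMod k) {A B : DGMod k} {n : ℤ} : homDeg A B n →ₗ[k] homDeg (tens E A) (tens E B) n :=
  tensHom E E A B (zero_add n) (hom₀ (𝟙 E))

/-- `f ⊗ 1`. -/
def whr {A B : DGMod k} {n : ℤ} (E : DGMod k) : homDeg A B n →ₗ[k] homDeg (tens A E) (tens B E) n :=
  (tensHom A B E E (add_zero n)).flip (hom₀ (𝟙 E))

section whiskering
variable {A B C A' B' : DGMod k} (E E' : DGMod k) {n : ℤ}

theorem whl_apply (f : homDeg A B n) : (whl E f).1 = TensorProduct.map (E.sgn n) f.1 := rfl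

theorem whr_apply (f : homDeg A B n) : (whr E f).1 = TensorProduct.map f.1 LinearMap.id :=
  tensHom_id_right E f

theorem whl_comp {i j : ℤ} (h : i + j = n) (f : homDeg B C i) (g : homDeg A B j) :
    whl E (compHom _ _ _ h f g) = compHom _ _ _ h (whl E f) (whl E g) := by
  simp only [whl]
  rw [tensHom_comp _ _ h (add_zero 0) h (zero_add n), mul_zero, sg_zero, one_smul]; rfl

theorem whr_comp {i j : ℤ} (h : i + j = n) (f : homDeg B C i) (g : homDeg A B j) :
    whr E (compHom _ _ _ h f g) = compHom _ _ _ h (whr E f) (whr E g) := by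
  simp only [whr, LinearMap.flip_apply]
  rw [tensHom_comp _ _ h h (add_zero 0) (add_zero n), zero_mul, sg_zero, one_smul]; rfl

theorem wh_exchange {i j : ℤ} (h : i + j = n) (h' : j + i = n) (f : homDeg A A' i)
    (g : homDeg B B' j) : compHom _ _ _ h (whr B' f) (whl A g) =
      sg k (i * j) • compHom _ _ _ h' (whl A' g) (whr B f) := by
  simp only [whl, whr, LinearMap.flip_apply]
  rw [tensHom_comp _ _ h (add_zero i) (zero_add j) h,
    tensHom_comp _ _ h' (zero_add i) (add_zero j) h, mul_zero, sg_zero, one_smul, smul_smul,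
    mul_comm j i, sg_self, one_smul]
  rfl

theorem wh_assoc_left (f : homDeg A B n) :
    compHom _ _ _ (zero_add n) (hom₀ (assocIso B E E').hom) (whr E' (whr E f)) =
      compHom _ _ _ (add_zero n) (whr (tens E E') f) (hom₀ (assocIso A E E').hom) :=
  Subtype.ext <| TensorProduct.ext_threefold fun x y z => by
    change TensorProduct.assoc k _ _ _ ((whr E' (whr E f)).1 ((x ⊗ₜ y) ⊗ₜ z)) =
      (whr (tens E E') f).1 (x ⊗ₜ (y ⊗ₜ z))
    rw [whr_apply, whr_apply, whr_apply]; rfl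

theorem wh_assoc_mid (f : homDeg A B n) :
    compHom _ _ _ (zero_add n) (hom₀ (assocIso E B E').hom) (whr E' (whl E f)) =
      compHom _ _ _ (add_zero n) (whl E (whr E' f)) (hom₀ (assocIso E A E').hom) :=
  Subtype.ext <| TensorProduct.ext_threefold fun x y z => by
    change TensorProduct.assoc k _ _ _ ((whr E' (whl E f)).1 ((x ⊗ₜ y) ⊗ₜ z)) =
      (whl E (whr E' f)).1 (x ⊗ₜ (y ⊗ₜ z))
    rw [whr_apply, whl_apply, whl_apply, whr_apply]; rfl

theorem wh_assoc_right (f : homDeg A B n) :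
    compHom _ _ _ (zero_add n) (hom₀ (assocIso E E' B).hom) (whl (tens E E') f) =
      compHom _ _ _ (add_zero n) (whl E (whl E' f)) (hom₀ (assocIso E E' A).hom) :=
  Subtype.ext <| TensorProduct.ext_threefold fun x y z => by
    change TensorProduct.assoc k _ _ _ ((whl (tens E E') f).1 ((x ⊗ₜ y) ⊗ₜ z)) =
      (whl E (whl E' f)).1 (x ⊗ₜ (y ⊗ₜ z))
    rw [whl_apply, whl_apply, whl_apply, sgn_tens]; rfl

theorem wh_lun (f : homDeg A B n) :
    compHom _ _ _ (zero_add n) (hom₀ (lunitIso B).hom) (whl (unit k) f) =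
      compHom _ _ _ (add_zero n) f (hom₀ (lunitIso A).hom) :=
  Subtype.ext <| TensorProduct.ext' fun r x => by
    change TensorProduct.lid k B ((whl (unit k) f).1 (r ⊗ₜ x)) = f.1 (r • x)
    rw [whl_apply, sgn_unit, map_smul]; rfl

theorem wh_run (f : homDeg A B n) :
    compHom _ _ _ (zero_add n) (hom₀ (runitIso B).hom) (whr (unit k) f) =
      compHom _ _ _ (add_zero n) f (hom₀ (runitIso A).hom) :=
  Subtype.ext <| TensorProduct.ext' fun x r => by
    change TensorProduct.rid k B ((whr (unit k) f).1 (x ⊗ₜ r)) = f.1 (r • x)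
    rw [whr_apply, map_smul]; rfl

theorem wh_braid (f : homDeg A B n) :
    compHom _ _ _ (zero_add n) (hom₀ (braidHom B E)) (whr E f) =
      compHom _ _ _ (add_zero n) (whl E f) (hom₀ (braidHom A E)) :=
  Subtype.ext <| lin_ext₂ fun i j x y hx hy => by
    change braidLin B E ((whr E f).1 (x ⊗ₜ y)) = (whl E f).1 (braidLin A E (x ⊗ₜ y))
    rw [whr_apply, whl_apply, TensorProduct.map_tmul, LinearMap.id_apply,
      braidLin_tmul (f.2 i x hx) hy, braidLin_tmul hx hy, map_smul, TensorProduct.map_tmul,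
      sgn_apply n hy, ← TensorProduct.smul_tmul', smul_smul, ← sg_add]
    congr 2; ring

theorem d_whl {m : ℤ} (h : m + 1 = n) (f : homDeg A B n) :
    dHom _ _ h (whl E f) = whl E (dHom _ _ h f) := by
  simp only [whl]
  rw [tensHom_d h (zero_add n) (neg_add_cancel 1) h (by omega) (zero_add m), dHom_hom₀,
      map_zero, LinearMap.zero_apply, zero_add, sg_zero, one_smul]

theorem d_whr {m : ℤ} (h : m + 1 = n) (f : homDeg A B n) :
    dHom _ _ h (whr E f) = whr E (dHom _ _ h f) := by
  simp only [whr, LinearMap.flip_apply]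
  rw [tensHom_d h (add_zero n) h (neg_add_cancel 1) (add_zero m) (by omega), dHom_hom₀,
    map_zero, smul_zero, add_zero]

theorem whl_hom₀ (f : A ⟶ B) : whl E (hom₀ f) = hom₀ (mapT (𝟙 E) f) := by
  refine Eq.trans ?_ (tensHom_hom₀_hom₀ (𝟙 E) f)
  rfl

theorem whr_hom₀ (f : A ⟶ B) : whr E (hom₀ f) = hom₀ (mapT f (𝟙 E)) := by
  refine Eq.trans ?_ (tensHom_hom₀_hom₀ f (𝟙 E))
  rfl

end whiskering

/-- The coendomorphism prop of a differential graded module. -/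
abbrev endProp (C : DGMod k) : DGProp k where
  Hom a b n := homDeg (a.pow C) (b.pow C) n
  comp h := compHom _ _ _ h
  wl c {_ _ _} := whl (c.pow C)
  wr c := whr (c.pow C)
  d h := dHom _ _ h
  str s := hom₀ (s.map C)
  id_comp f := rfl
  comp_id f := rfl
  assoc _ _ _ _ _ _ _ := rfl
  wl_comp e _ _ _ i j n h f g := whl_comp _ h f g
  wr_comp e _ _ _ i j n h f g := whr_comp _ h f g
  exchange h h' f g := wh_exchange h h' f g
  str_comp _ _ := rfl
  str_wl c _ _ s := (whl_hom₀ _ _).symm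
  str_wr c _ _ s := (whr_hom₀ _ _).symm
  str_rel h := congrArg hom₀ (Str.map_rel C h)
  assoc_left b c n f := wh_assoc_left _ _ f
  assoc_mid a _ _ c n f := wh_assoc_mid _ _ f
  assoc_right a b _ _ n f := wh_assoc_right _ _ f
  lun_nat f := wh_lun f
  run_nat f := wh_run f
  braid_nat b n f := wh_braid _ f
  d_d h h' f := dHom_dHom h h' f
  d_comp h hi hj hn h₁ h₂ f g := dHom_comp h hi hj hn h₁ h₂ f g
  d_wl c _ _ n m h f := d_whl _ h f
  d_wr c _ _ n m h f := d_whr _ h f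
  d_str h s := dHom_hom₀ _ _

end DGMod

end

section

variable {k : Type u} [CommRing k]

/-- Morphisms between the operads `U(P)` and `U(Q)` underlying two props, where `U(P)(r)` consists
of the morphisms of `P` from the one-letter word to the words of length `r`. -/
structure OpHom (P Q : DGProp k) where
  map : ∀ {b : Word} {n : ℤ}, P.Hom .X b n →ₗ[k] Q.Hom .X b n
  map_id : map (P.str (.id .X)) = Q.str (.id .X)
  map_d : ∀ {b : Word} {n m : ℤ} (h : m + 1 = n) (f : P.Hom .X b n), map (P.d h f) = Q.d h (map f)
  map_str : ∀ {b c : Word} {n : ℤ} (s : Str b c) (f : P.Hom .X b n),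
    map (P.comp (zero_add n) (P.str s) f) = Q.comp (zero_add n) (Q.str s) (map f)
  map_comp : ∀ {a b : Word} {i j n : ℤ} (h : i + j = n) (g : P.Hom .X b i)
    (f : P.Hom .X (a.tens .X) j), map (P.comp h (P.wl a g) f) = Q.comp h (Q.wl a (map g)) (map f)

namespace OpHom
open DGProp

variable {P Q R P' Q' : DGProp k}

/-- The underlying morphism of operads of a morphism of props. -/
def ofProp (φ : PropHom P Q) : OpHom P Q where
  map := φ.map
  map_id := φ.map_str _
  map_d h f := φ.map_d h f
  map_str s f := by rw [φ.map_comp, φ.map_str]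
  map_comp h g f := by rw [φ.map_comp, φ.map_wl]

/-- Composition. -/
def trans (φ : OpHom P Q) (ψ : OpHom Q R) : OpHom P R where
  map := ψ.map ∘ₗ φ.map
  map_id := by rw [LinearMap.comp_apply, φ.map_id, ψ.map_id]
  map_d h f := by rw [LinearMap.comp_apply, LinearMap.comp_apply, φ.map_d, ψ.map_d]
  map_str s f := by rw [LinearMap.comp_apply, LinearMap.comp_apply, φ.map_str, ψ.map_str]
  map_comp h g f := by simp only [LinearMap.comp_apply, φ.map_comp, ψ.map_comp]

/-- The linear maps underlying `prodMap`. -/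
def prodLin (φ : OpHom P P') (ψ : OpHom Q Q') {b : Word} {n : ℤ} :
    THom P Q .X b n →ₗ[k] THom P' Q' .X b n :=
  tdesc fun _ _ h => (tm h).compl₁₂ φ.map ψ.map

@[simp] theorem prodLin_pure (φ : OpHom P P') (ψ : OpHom Q Q') {b : Word} {n i j : ℤ}
    (h : i + j = n) (x : P.Hom .X b i) (y : Q.Hom .X b j) :
    prodLin φ ψ (tm h x y) = tm h (φ.map x) (ψ.map y) := by simp [prodLin]

/-- The tensor product of morphisms. -/
def prodMap (φ : OpHom P P') (ψ : OpHom Q Q') : OpHom (P.prod Q) (P'.prod Q') where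
  map := prodLin φ ψ
  map_id := by
    change prodLin φ ψ (tm _ _ _) = tm _ _ _
    rw [prodLin_pure, φ.map_id, ψ.map_id]
  map_d h f := by
    induction f using tind with
    | zero => simp
    | add x y hx hy => simp only [map_add, hx, hy]
    | tm i j hij x y =>
      rw [prodLin_pure, td_pure h hij (sub_add_cancel i 1) (sub_add_cancel j 1) (by omega)
        (by omega), td_pure h hij (sub_add_cancel i 1) (sub_add_cancel j 1) (by omega) (by omega),
        map_add, map_smul, prodLin_pure, prodLin_pure, φ.map_d, ψ.map_d]
  map_str s f := by
    induction f using tind with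
    | zero => simp
    | add x y hx hy => simp only [map_add, hx, hy]
    | tm i j h x y =>
      rw [str_tcomp_pure, prodLin_pure, prodLin_pure, str_tcomp_pure, φ.map_str, ψ.map_str]
  map_comp h f g := by
    induction f using tind with
    | zero => simp
    | add x y hx hy => simp only [map_add, LinearMap.add_apply, hx, hy]
    | tm i₁ i₂ hi f f' =>
    induction g using tind with
    | zero => simp
    | add x y hx hy => simp only [map_add, hx, hy]
    | tm j₁ j₂ hj g g' =>
      rw [twl_pure, tcomp_pure h hi hj rfl rfl (by omega), map_smul, prodLin_pure, prodLin_pure,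
        prodLin_pure, twl_pure, tcomp_pure h hi hj rfl rfl (by omega), φ.map_comp, ψ.map_comp]

end OpHom

namespace DGMod
open DGProp

/-- The tensor product of two homogeneous operations on `C` and `D`, as an operation on `C ⊗ D`. -/
def shHom (C D : DGMod k) {a b : Word} {i j n : ℤ} (h : i + j = n) :
    homDeg (a.pow C) (b.pow C) i →ₗ[k] homDeg (a.pow D) (b.pow D) j →ₗ[k]
      homDeg (a.pow (tens C D)) (b.pow (tens C D)) n :=
  (tensHom (a.pow C) (b.pow C) (a.pow D) (b.pow D) h).compr₂
    (compHom _ _ _ (zero_add n) (hom₀ (b.shuf C D).hom) ∘ₗ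
      (compHom _ _ _ (add_zero n)).flip (hom₀ (a.shuf C D).inv))

theorem shHom_apply (C D : DGMod k) {a b : Word} {i j n : ℤ} (h : i + j = n)
    (f : homDeg (a.pow C) (b.pow C) i) (g : homDeg (a.pow D) (b.pow D) j) :
    (shHom C D h f g).1 = (b.shuf C D).hom.lin ∘ₗ (tensHom _ _ _ _ h f g).1 ∘ₗ
      (a.shuf C D).inv.lin := rfl

theorem inv_hom_lin {C D : DGMod k} (e : C ≅ D) : e.inv.lin ∘ₗ e.hom.lin = LinearMap.id :=
  congrArg Hom.lin e.hom_inv_id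

theorem hom_inv_lin {C D : DGMod k} (e : C ≅ D) : e.hom.lin ∘ₗ e.inv.lin = LinearMap.id :=
  congrArg Hom.lin e.inv_hom_id

theorem shHom_ext {C D : DGMod k} {a b : Word} {n : ℤ}
    {f g : homDeg (a.pow (tens C D)) (b.pow (tens C D)) n}
    (h : f.1 ∘ₗ (a.shuf C D).hom.lin = g.1 ∘ₗ (a.shuf C D).hom.lin) : f = g := by
  apply Subtype.ext
  rw [← LinearMap.comp_id f.1, ← LinearMap.comp_id g.1, ← hom_inv_lin (a.shuf C D),
    ← LinearMap.comp_assoc, h, LinearMap.comp_assoc]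

theorem shHom_shuf (C D : DGMod k) {a b : Word} {i j n : ℤ} (h : i + j = n)
    (f : homDeg (a.pow C) (b.pow C) i) (g : homDeg (a.pow D) (b.pow D) j) :
    (shHom C D h f g).1 ∘ₗ (a.shuf C D).hom.lin = (b.shuf C D).hom.lin ∘ₗ
      (tensHom _ _ _ _ h f g).1 := by
  rw [shHom_apply, LinearMap.comp_assoc, LinearMap.comp_assoc, inv_hom_lin, LinearMap.comp_id]

theorem shHom_comp (C D : DGMod k) {a b c : Word} {i i' j j' n m p q r : ℤ} (hn : i + i' = n)
    (hm : j + j' = m) (hp : n + m = p) (hq : i + j = q) (hr : i' + j' = r) (hp' : q + r = p)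
    (f : homDeg (b.pow C) (c.pow C) i) (f' : homDeg (b.pow D) (c.pow D) i')
    (g : homDeg (a.pow C) (b.pow C) j) (g' : homDeg (a.pow D) (b.pow D) j') :
    compHom _ _ _ hp (shHom C D hn f f') (shHom C D hm g g') =
      sg k (i' * j) • shHom C D hp' (compHom _ _ _ hq f g) (compHom _ _ _ hr f' g') := by
  apply shHom_ext
  have h₁ := congrArg Subtype.val (tensHom_comp hn hm hp hq hr hp' f f' g g')
  change (tensHom _ _ _ _ hn f f').1 ∘ₗ (tensHom _ _ _ _ hm g g').1 =
    sg k (i' * j) • (tensHom _ _ _ _ hp' _ _).1 at h₁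
  change ((shHom C D hn f f').1 ∘ₗ (shHom C D hm g g').1) ∘ₗ _ =
    (sg k (i' * j) • (shHom C D hp' _ _).1) ∘ₗ _
  rw [LinearMap.comp_assoc, shHom_shuf, ← LinearMap.comp_assoc, shHom_shuf, LinearMap.smul_comp,
    shHom_shuf, LinearMap.comp_assoc, h₁, LinearMap.comp_smul]

theorem tensorμ_whl {A A' B B' : DGMod k} (E E' : DGMod k) {i j n : ℤ} (h : i + j = n)
    (f : homDeg A A' i) (g : homDeg B B' j) :
    (tensorμ E A' E' B').lin ∘ₗ (tensHom _ _ _ _ h (whl E f) (whl E' g)).1 =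
      (whl (tens E E') (tensHom _ _ _ _ h f g)).1 ∘ₗ (tensorμ E A E' B).lin := by
  apply lin_ext₄
  intro a b c d x y z w hx hy hz hw
  change (tensorμ E A' E' B').lin ((tensHom _ _ _ _ h (whl E f) (whl E' g)).1 _) =
    (whl (tens E E') (tensHom _ _ _ _ h f g)).1 ((tensorμ E A E' B).lin _)
  rw [tensHom_tmul _ _ _ (tmul_mem rfl hx hy), whl_apply, whl_apply, whl_apply,
    tensorμ_tmul _ _ hy hz, map_smul, map_smul, TensorProduct.map_tmul, TensorProduct.map_tmul,
    TensorProduct.map_tmul, sgn_apply _ hx, sgn_apply _ hz,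
    sgn_apply (C := tens E E') _ (tmul_mem rfl hx hz), tensHom_tmul _ _ _ hy]
  simp only [← TensorProduct.smul_tmul', TensorProduct.tmul_smul, map_smul]
  rw [tensorμ_tmul _ _ (f.2 _ _ hy) hz]
  simp only [smul_smul, ← sg_add, ← h]
  congr 1
  apply sg_congr; push_cast
  generalize (a : ZMod 2) = a; generalize (b : ZMod 2) = b; generalize (c : ZMod 2) = c
  generalize (i : ZMod 2) = i; generalize (j : ZMod 2) = j
  revert a b c i j; decide

theorem tensorμ_whr {A A' B B' : DGMod k} (E E' : DGMod k) {i j n : ℤ} (h : i + j = n)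
    (f : homDeg A A' i) (g : homDeg B B' j) :
    (tensorμ A' E B' E').lin ∘ₗ (tensHom _ _ _ _ h (whr E f) (whr E' g)).1 =
      (whr (tens E E') (tensHom _ _ _ _ h f g)).1 ∘ₗ (tensorμ A E B E').lin := by
  apply lin_ext₄
  intro a b c d x y z w hx hy hz hw
  change (tensorμ A' E B' E').lin ((tensHom _ _ _ _ h (whr E f) (whr E' g)).1 _) =
    (whr (tens E E') (tensHom _ _ _ _ h f g)).1 ((tensorμ A E B E').lin _)
  rw [tensHom_tmul _ _ _ (tmul_mem rfl hx hy), whr_apply, whr_apply, whr_apply,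
    tensorμ_tmul _ _ hy hz, map_smul, map_smul, TensorProduct.map_tmul, TensorProduct.map_tmul,
    TensorProduct.map_tmul, tensHom_tmul _ _ _ hx]
  simp only [LinearMap.id_apply]
  rw [tensorμ_tmul _ _ hy (g.2 _ _ hz)]
  simp only [← TensorProduct.smul_tmul', smul_smul, ← sg_add]
  congr 1
  apply sg_congr; push_cast
  generalize (a : ZMod 2) = a; generalize (b : ZMod 2) = b; generalize (c : ZMod 2) = c
  generalize (j : ZMod 2) = j
  revert a b c j; decide

theorem shHom_wl_aux {A A' B B' E E' P Q R : DGMod k} {i j n : ℤ} (h : i + j = n)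
    (f : homDeg A A' i) (g : homDeg B B' j) (F : homDeg Q R n) (s : tens E E' ⟶ P)
    (t : tens A B ⟶ Q) (u : tens A' B' ⟶ R)
    (w : F.1 ∘ₗ t.lin = u.lin ∘ₗ (tensHom _ _ _ _ h f g).1) :
    (whl P F).1 ∘ₗ (mapT s t).lin ∘ₗ (tensorμ E A E' B).lin =
      ((mapT s u).lin ∘ₗ (tensorμ E A' E' B').lin) ∘ₗ
        (tensHom _ _ _ _ h (whl E f) (whl E' g)).1 := by
  rw [LinearMap.comp_assoc, tensorμ_whl, whl_apply, whl_apply, ← LinearMap.comp_assoc,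
    ← LinearMap.comp_assoc]
  congr 1
  change TensorProduct.map _ _ ∘ₗ TensorProduct.map _ _ =
    TensorProduct.map _ _ ∘ₗ TensorProduct.map _ _
  rw [← TensorProduct.map_comp, ← TensorProduct.map_comp, w, sgn_hom]

theorem shHom_wr_aux {A A' B B' E E' P Q R : DGMod k} {i j n : ℤ} (h : i + j = n)
    (f : homDeg A A' i) (g : homDeg B B' j) (F : homDeg Q R n) (s : tens E E' ⟶ P)
    (t : tens A B ⟶ Q) (u : tens A' B' ⟶ R)
    (w : F.1 ∘ₗ t.lin = u.lin ∘ₗ (tensHom _ _ _ _ h f g).1) :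
    (whr P F).1 ∘ₗ (mapT t s).lin ∘ₗ (tensorμ A E B E').lin =
      ((mapT u s).lin ∘ₗ (tensorμ A' E B' E').lin) ∘ₗ
        (tensHom _ _ _ _ h (whr E f) (whr E' g)).1 := by
  rw [LinearMap.comp_assoc, tensorμ_whr, whr_apply, whr_apply, ← LinearMap.comp_assoc,
    ← LinearMap.comp_assoc]
  congr 1
  change TensorProduct.map _ _ ∘ₗ TensorProduct.map _ _ =
    TensorProduct.map _ _ ∘ₗ TensorProduct.map _ _
  rw [← TensorProduct.map_comp, ← TensorProduct.map_comp, w, LinearMap.id_comp, LinearMap.comp_id]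

theorem shHom_wl (C D : DGMod k) (c : Word) {a b : Word} {i j n : ℤ} (h : i + j = n)
    (f : homDeg (a.pow C) (b.pow C) i) (g : homDeg (a.pow D) (b.pow D) j) :
    whl (c.pow (tens C D)) (shHom C D h f g) =
      shHom (a := c.tens a) (b := c.tens b) C D h (whl (c.pow C) f) (whl (c.pow D) g) := by
  apply shHom_ext (a := c.tens a) (b := c.tens b)
  refine Eq.trans ?_ (shHom_shuf (a := c.tens a) (b := c.tens b) C D h _ _).symm
  exact shHom_wl_aux h f g _ (c.shuf C D).hom _ _ (shHom_shuf C D h f g)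

theorem shHom_wr (C D : DGMod k) (c : Word) {a b : Word} {i j n : ℤ} (h : i + j = n)
    (f : homDeg (a.pow C) (b.pow C) i) (g : homDeg (a.pow D) (b.pow D) j) :
    whr (c.pow (tens C D)) (shHom C D h f g) =
      shHom (a := a.tens c) (b := b.tens c) C D h (whr (c.pow C) f) (whr (c.pow D) g) := by
  apply shHom_ext (a := a.tens c) (b := b.tens c)
  refine Eq.trans ?_ (shHom_shuf (a := a.tens c) (b := b.tens c) C D h _ _).symm
  exact shHom_wr_aux h f g _ (c.shuf C D).hom _ _ (shHom_shuf C D h f g)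

theorem dHom_conj {A B A' B' : DGMod k} {n m : ℤ} (h : m + 1 = n) (p : B ⟶ B') (q : A' ⟶ A)
    (f : homDeg A B n) :
    dHom _ _ h (compHom _ _ _ (zero_add n) (hom₀ p) (compHom _ _ _ (add_zero n) f (hom₀ q))) =
      compHom _ _ _ (zero_add m) (hom₀ p) (compHom _ _ _ (add_zero m) (dHom _ _ h f) (hom₀ q)) := by
  apply Subtype.ext
  apply LinearMap.ext; intro x
  change B'.d (p.lin (f.1 (q.lin x))) - sg k n • p.lin (f.1 (q.lin (A'.d x))) =
    p.lin (B.d (f.1 (q.lin x)) - sg k n • f.1 (A.d (q.lin x)))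
  rw [map_sub, map_smul, p.comm, q.comm]

theorem shHom_d (C D : DGMod k) {a b : Word} {i i' j j' n m : ℤ} (h : m + 1 = n) (hij : i + j = n)
    (hi : i' + 1 = i) (hj : j' + 1 = j) (h₁ : i' + j = m) (h₂ : i + j' = m)
    (f : homDeg (a.pow C) (b.pow C) i) (g : homDeg (a.pow D) (b.pow D) j) :
    dHom _ _ h (shHom C D hij f g) = shHom C D h₁ (dHom _ _ hi f) g +
      sg k i • shHom C D h₂ f (dHom _ _ hj g) := by
  refine (dHom_conj h _ _ _).trans ?_
  erw [tensHom_d h hij hi hj h₁ h₂]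
  rw [map_add, LinearMap.add_apply, map_add, map_smul, LinearMap.smul_apply, map_smul]
  rfl

theorem shHom_str (C D : DGMod k) {a b : Word} (s : Str a b) :
    shHom C D (add_zero 0) (hom₀ (s.map C)) (hom₀ (s.map D)) = hom₀ (s.map (tens C D)) := by
  apply shHom_ext
  rw [shHom_shuf, tensHom_hom₀_hom₀]
  exact congrArg DGMod.Hom.lin (s.shuf C D)

/-- The action of the tensor product of the coendomorphism props of `C` and `D` on `C ⊗ D`. -/
def endTens (C D : DGMod k) : PropHom ((endProp C).prod (endProp D)) (endProp (tens C D)) where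
  map := tdesc fun _ _ h => shHom C D h
  map_comp h f g := by
    induction f using tind with
    | zero => simp
    | add x y hx hy => simp only [map_add, LinearMap.add_apply, hx, hy]
    | tm i₁ i₂ hi f f' =>
    induction g using tind with
    | zero => simp
    | add x y hx hy => simp only [map_add, hx, hy]
    | tm j₁ j₂ hj g g' =>
      rw [tcomp_pure h hi hj rfl rfl (by omega), map_smul, tdesc_pure, tdesc_pure, tdesc_pure]
      exact (shHom_comp C D hi hj h rfl rfl (by omega) f f' g g').symm
  map_wl c _ _ _ f := by
    induction f using tind with
    | zero =>
      rw [map_zero, map_zero, map_zero]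
      exact (map_zero (whl (c.pow (tens C D)))).symm
    | add x y hx hy =>
      rw [map_add, map_add, map_add, hx, hy]
      exact (map_add (whl (c.pow (tens C D))) _ _).symm
    | tm i j h x y =>
      rw [twl_pure, tdesc_pure, tdesc_pure]
      exact (shHom_wl C D c h x y).symm
  map_wr c _ _ _ f := by
    induction f using tind with
    | zero =>
      rw [map_zero, map_zero, map_zero]
      exact (map_zero (whr (c.pow (tens C D)))).symm
    | add x y hx hy =>
      rw [map_add, map_add, map_add, hx, hy]
      exact (map_add (whr (c.pow (tens C D))) _ _).symm
    | tm i j h x y =>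
      rw [twr_pure, tdesc_pure, tdesc_pure]
      exact (shHom_wr C D c h x y).symm
  map_d h f := by
    induction f using tind with
    | zero => simp
    | add x y hx hy => simp only [map_add, hx, hy]
    | tm i j hij x y =>
      rw [td_pure h hij (sub_add_cancel i 1) (sub_add_cancel j 1) (by omega)
        (by omega), map_add, map_smul, tdesc_pure, tdesc_pure, tdesc_pure]
      exact (shHom_d C D h hij (sub_add_cancel i 1) (sub_add_cancel j 1) _ _ x y).symm
  map_str s := by
    change tdesc _ (tm _ _ _) = _
    rw [tdesc_pure]
    exact shHom_str C D s

/-- The canonical isomorphism between two tensor powers of the unit. -/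
def unitPows (k : Type u) [CommRing k] (a b : Word) : a.pow (unit k) ⟶ b.pow (unit k) :=
  (a.unitPow (DGMod k)).inv ≫ (b.unitPow (DGMod k)).hom

theorem unitPows_comp (a b c : Word) : unitPows k a b ≫ unitPows k b c = unitPows k a c := by
  simp [unitPows]

theorem unitPows_str {a b : Word} (s : Str a b) : s.map (unit k) = unitPows k a b :=
  ((a.unitPow (DGMod k)).eq_inv_comp).2 s.unitPow

theorem unitPows_wl_aux {V : Type v} [Category.{w} V] [MonoidalCategory V] {A B E : V}
    (p : 𝟙_ V ≅ A) (q : 𝟙_ V ≅ B) (r : 𝟙_ V ≅ E) : (𝟙 E ⊗ₘ (p.inv ≫ q.hom)) =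
      ((λ_ (𝟙_ V)).symm ≪≫ (r ⊗ᵢ p)).inv ≫ ((λ_ (𝟙_ V)).symm ≪≫ (r ⊗ᵢ q)).hom := by
  simp [tensorHom_comp_tensorHom]

theorem unitPows_wr_aux {V : Type v} [Category.{w} V] [MonoidalCategory V] {A B E : V}
    (p : 𝟙_ V ≅ A) (q : 𝟙_ V ≅ B) (r : 𝟙_ V ≅ E) : ((p.inv ≫ q.hom) ⊗ₘ 𝟙 E) =
      ((λ_ (𝟙_ V)).symm ≪≫ (p ⊗ᵢ r)).inv ≫ ((λ_ (𝟙_ V)).symm ≪≫ (q ⊗ᵢ r)).hom := by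
  simp [tensorHom_comp_tensorHom]

theorem unitPows_wl (a b c : Word) : mapT (𝟙 (c.pow (unit k))) (unitPows k a b) =
    unitPows k (c.tens a) (c.tens b) :=
  unitPows_wl_aux (a.unitPow (DGMod k)) (b.unitPow (DGMod k)) (c.unitPow (DGMod k))

theorem unitPows_wr (a b c : Word) : mapT (unitPows k a b) (𝟙 (c.pow (unit k))) =
    unitPows k (a.tens c) (b.tens c) :=
  unitPows_wr_aux (a.unitPow (DGMod k)) (b.unitPow (DGMod k)) (c.unitPow (DGMod k))

theorem unitPows_deg {n : ℤ} (a b : Word) (r : (unit k).gr n) :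
    r.1 • (unitPows k a b).lin ∈ homDeg (a.pow (unit k)) (b.pow (unit k)) n := by
  by_cases hn : n = 0
  · subst hn; exact Submodule.smul_mem _ _ (hom_isDeg _)
  · rw [unit_gr hn r.2, zero_smul]; exact Submodule.zero_mem _

/-- The linear maps underlying `endUnit`. -/
def endUnitLin {n : ℤ} (a b : Word) :
    (unit k).gr n →ₗ[k] homDeg (a.pow (unit k)) (b.pow (unit k)) n where
  toFun r := ⟨r.1 • (unitPows k a b).lin, unitPows_deg a b r⟩
  map_add' _ _ := Subtype.ext (add_smul _ _ _)
  map_smul' _ _ := Subtype.ext (mul_smul _ _ _)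

theorem endUnitLin_eq (a b : Word) (r : (unit k).gr 0) :
    endUnitLin a b r = r.1 • hom₀ (unitPows k a b) := rfl

/-- The action of the unit prop on the unit. -/
def endUnit (k : Type u) [CommRing k] : PropHom (DGProp.unit k) (endProp (unit k)) where
  map {a b n} := endUnitLin a b
  map_comp {a b c _ _ _} h f g := by
    apply Subtype.ext
    change (f.1 * g.1) • (unitPows k a c).lin =
      (f.1 • (unitPows k b c).lin) ∘ₗ (g.1 • (unitPows k a b).lin)
    rw [← unitPows_comp a b c, comp_lin, LinearMap.smul_comp, LinearMap.comp_smul, smul_smul]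
  map_wl c a b n f := by
    by_cases hn : n = 0
    · subst hn
      refine (endUnitLin_eq _ _ _).trans (Eq.trans ?_
        (congrArg (whl (c.pow (unit k))) (endUnitLin_eq a b f)).symm)
      refine Eq.trans ?_ (map_smul (whl (c.pow (unit k))) _ _).symm
      exact congrArg (f.1 • ·) (Eq.trans (congrArg hom₀ (unitPows_wl a b c).symm)
        (whl_hom₀ _ _).symm)
    · obtain rfl : f = 0 := Subtype.ext (unit_gr hn f.2)
      rw [map_zero, map_zero, map_zero]
      exact (map_zero (whl (c.pow (unit k)))).symm
  map_wr c a b n f := by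
    by_cases hn : n = 0
    · subst hn
      refine (endUnitLin_eq _ _ _).trans (Eq.trans ?_
        (congrArg (whr (c.pow (unit k))) (endUnitLin_eq a b f)).symm)
      refine Eq.trans ?_ (map_smul (whr (c.pow (unit k))) _ _).symm
      exact congrArg (f.1 • ·) (Eq.trans (congrArg hom₀ (unitPows_wr a b c).symm)
        (whr_hom₀ _ _).symm)
    · obtain rfl : f = 0 := Subtype.ext (unit_gr hn f.2)
      rw [map_zero, map_zero, map_zero]
      exact (map_zero (whr (c.pow (unit k)))).symm
  map_d {a b n m} h f := by
    by_cases hn : n = 0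
    · subst hn
      rw [endUnitLin_eq, map_smul, dHom_hom₀, smul_zero]
      exact map_zero (endUnitLin a b)
    · obtain rfl : f = 0 := Subtype.ext (unit_gr hn f.2)
      simp
  map_str {a b} s := by
    apply Subtype.ext
    change (1 : k) • (unitPows k a b).lin = (s.map (unit k)).lin
    rw [one_smul, unitPows_str]

end DGMod

/-- The operation on `C` given by an element of an operad acting on `C`. -/
def OpHom.ap {P : DGProp k} {C : DGMod k} (φ : OpHom P C.endProp) {b : Word} {n : ℤ} :
    P.Hom .X b n →ₗ[k] C →ₗ[k] (b.pow C : DGMod k) :=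
  (DGMod.homDeg C (b.pow C) n).subtype ∘ₗ φ.map

theorem OpHom.ap_mem {P : DGProp k} {C : DGMod k} (φ : OpHom P C.endProp) {b : Word} {n : ℤ}
    (f : P.Hom .X b n) {m : ℤ} {x : C} (hx : x ∈ C.gr m) :
    φ.ap f x ∈ (b.pow C : DGMod k).gr (n + m) := (φ.map f).2 m x hx

/-- Coalgebras over the operad `U(P)`: a differential graded module with a morphism of operads from
`U(P)` to its coendomorphism operad. -/
structure Coalg (P : DGProp k) where
  toMod : DGMod k
  act : OpHom P toMod.endProp

namespace Coalg

variable {P : DGProp k}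

/-- Morphisms of coalgebras: chain maps compatible with all operations. -/
@[ext] structure Hom (C D : Coalg P) where
  hom : C.toMod ⟶ D.toMod
  comm : ∀ {b : Word} {n : ℤ} (f : P.Hom .X b n) (x : C.toMod),
    (b.powMap hom).lin (C.act.ap f x) = D.act.ap f (hom.lin x)

instance : Category (Coalg P) where
  Hom := Hom
  id C := ⟨𝟙 _, fun f x => by rw [Word.powMap_id]; rfl⟩
  comp {C D E} f g := ⟨f.hom ≫ g.hom, fun {b _} x y => by
    rw [Word.powMap_comp]
    exact (congrArg (b.powMap g.hom).lin (f.comm x y)).trans (g.comm x (f.hom.lin y))⟩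

/-- The underlying differential graded module. -/
@[simps] def forget (P : DGProp k) : Coalg P ⥤ DGMod k where
  obj := toMod
  map := Hom.hom

instance : (forget P).Faithful := ⟨fun h => Hom.ext h⟩

end Coalg

end

section

variable {k : Type u} [CommRing k]

namespace Coalg
open DGProp DGMod

variable {P Q R : DGProp k}

/-- Two operations acting on a tensor product. -/
def tact {C D : DGMod k} (φ : OpHom P C.endProp) (ψ : OpHom Q D.endProp) :
    OpHom (P.prod Q) (tens C D).endProp :=
  (φ.prodMap ψ).trans (OpHom.ofProp (endTens C D))

theorem tact_tm {C D : DGMod k} (φ : OpHom P C.endProp) (ψ : OpHom Q D.endProp) {b : Word}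
    {i j n : ℤ} (h : i + j = n) (x : P.Hom .X b i) (y : Q.Hom .X b j) {m : ℤ} {s : C}
    (hs : s ∈ C.gr m) (t : D) : (tact φ ψ).ap (tm h x y) (s ⊗ₜ t) =
      sg k (j * m) • (b.shuf C D).hom.lin (φ.ap x s ⊗ₜ ψ.ap y t) := by
  rw [← map_smul]
  refine Eq.trans ?_ (congrArg _ (tensHom_tmul h (φ.map x) (ψ.map y) hs t))
  change (tdesc (fun _ _ h => shHom C D h) (OpHom.prodLin φ ψ (tm h x y))).1 _ = _
  rw [OpHom.prodLin_pure, tdesc_pure]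
  rfl

theorem tact_nat {C D C' D' : DGMod k} (φ : OpHom P C.endProp) (ψ : OpHom Q D.endProp)
    (φ' : OpHom P C'.endProp) (ψ' : OpHom Q D'.endProp) (f : C ⟶ C') (g : D ⟶ D') {b : Word} {n : ℤ}
    (hf : ∀ {n : ℤ} (x : P.Hom .X b n) (s : C), (b.powMap f).lin (φ.ap x s) = φ'.ap x (f.lin s))
    (hg : ∀ {n : ℤ} (x : Q.Hom .X b n) (s : D), (b.powMap g).lin (ψ.ap x s) = ψ'.ap x (g.lin s))
    (t : THom P Q .X b n) :
    (b.powMap (f ⊗ₘ g)).lin ∘ₗ (tact φ ψ).ap t = (tact φ' ψ').ap t ∘ₗ (mapT f g).lin := by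
  induction t using tind with
  | zero => simp only [map_zero, LinearMap.comp_zero, LinearMap.zero_comp]
  | add x y hx hy =>
    simp only [map_add, LinearMap.comp_add, LinearMap.add_comp, hx, hy]
  | tm i j h x y =>
    apply lin_ext₂
    intro p q s t hs ht
    change (b.powMap (f ⊗ₘ g)).lin ((tact φ ψ).ap (tm h x y) (s ⊗ₜ t)) =
      (tact φ' ψ').ap (tm h x y) (f.lin s ⊗ₜ g.lin t)
    rw [tact_tm _ _ _ _ _ hs, tact_tm _ _ _ _ _ (f.deg hs), map_smul]
    have := LinearMap.congr_fun (congrArg DGMod.Hom.lin (Word.shuf_natural f g b))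
      (φ.ap x s ⊗ₜ ψ.ap y t)
    refine congrArg _ (this.symm.trans ?_)
    change (b.shuf C' D').hom.lin ((b.powMap f).lin (φ.ap x s) ⊗ₜ (b.powMap g).lin (ψ.ap y t)) = _
    rw [hf, hg]

theorem prodLin_trans_left {P' P'' Q' : DGProp k} (α : OpHom P P') (β : OpHom P' P'')
    (γ : OpHom Q Q') {b : Word} {n : ℤ} (t : THom P Q .X b n) :
    OpHom.prodLin (α.trans β) γ t = OpHom.prodLin β γ (OpHom.prodLin α (.ofProp (.id Q)) t) := by
  induction t using tind with
  | zero => simp only [map_zero]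
  | add x y hx hy => simp only [map_add, hx, hy]
  | tm i j h x y => simp only [OpHom.prodLin_pure]; rfl

theorem prodLin_trans_right {P' Q' Q'' : DGProp k} (α : OpHom P P') (β : OpHom Q Q')
    (γ : OpHom Q' Q'') {b : Word} {n : ℤ} (t : THom P Q .X b n) :
    OpHom.prodLin α (β.trans γ) t = OpHom.prodLin α γ (OpHom.prodLin (.ofProp (.id P)) β t) := by
  induction t using tind with
  | zero => simp only [map_zero]
  | add x y hx hy => simp only [map_add, hx, hy]
  | tm i j h x y => simp only [OpHom.prodLin_pure]; rfl

theorem tact_left {P' : DGProp k} {C D : DGMod k} (α : OpHom P P') (φ : OpHom P' C.endProp)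
    (ψ : OpHom Q D.endProp) {b : Word} {n : ℤ} (t : THom P Q .X b n) :
    (tact (α.trans φ) ψ).ap t = (tact φ ψ).ap (OpHom.prodLin α (.ofProp (.id Q)) t) :=
  congrArg (fun t => ((endTens C D).map t).1) (prodLin_trans_left α φ ψ t)

theorem tact_right {Q' : DGProp k} {C D : DGMod k} (φ : OpHom P C.endProp) (β : OpHom Q Q')
    (ψ : OpHom Q' D.endProp) {b : Word} {n : ℤ} (t : THom P Q .X b n) :
    (tact φ (β.trans ψ)).ap t = (tact φ ψ).ap (OpHom.prodLin (.ofProp (.id P)) β t) :=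
  congrArg (fun t => ((endTens C D).map t).1) (prodLin_trans_right φ β ψ t)

theorem tact_assoc {C D E : DGMod k} (φ : OpHom P C.endProp) (ψ : OpHom Q D.endProp)
    (χ : OpHom R E.endProp) {b : Word} {n : ℤ} (t : THom (P.prod Q) R .X b n) :
    (b.powMap (assocIso C D E).hom).lin ∘ₗ (tact (tact φ ψ) χ).ap t =
      (tact φ (tact ψ χ)).ap (PropHom.assocLin t) ∘ₗ (assocIso C D E).hom.lin := by
  induction t using PropHom.tind₃ with
  | zero => simp only [map_zero, LinearMap.comp_zero, LinearMap.zero_comp]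
  | add x y hx hy =>
    simp only [map_add, LinearMap.comp_add, LinearMap.add_comp, hx, hy]
  | tm i j l m h h' x y z =>
    apply lin_ext₃
    intro p q r s t u hs ht hu
    change (b.powMap (assocIso C D E).hom).lin ((tact (tact φ ψ) χ).ap _ ((s ⊗ₜ t) ⊗ₜ u)) =
      (tact φ (tact ψ χ)).ap _ (s ⊗ₜ (t ⊗ₜ u))
    rw [PropHom.assocLin_pure h h' rfl (show i + (j + l) = n by omega)]
    have e₁ : (tact (tact φ ψ) χ).ap (tm (P := P.prod Q) h' (tm h x y) z) ((s ⊗ₜ t) ⊗ₜ u) =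
        sg k (l * (p + q)) • (b.shuf (tens C D) E).hom.lin (sg k (j * p) •
          ((b.shuf C D).hom.lin (φ.ap x s ⊗ₜ ψ.ap y t) ⊗ₜ χ.ap z u)) := by
      refine (tact_tm (tact φ ψ) χ h' (tm h x y) z (m := p + q) (tmul_mem rfl hs ht) u).trans ?_
      rw [tact_tm φ ψ h x y hs t]
      exact congrArg (fun v => _ • (b.shuf (tens C D) E).hom.lin v)
        (TensorProduct.smul_tmul' _ _ _)
    have e₂ : (tact φ (tact ψ χ)).ap (tm (Q := Q.prod R) (show i + (j + l) = n by omega) x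
        (tm rfl y z)) (s ⊗ₜ (t ⊗ₜ u)) =
        sg k ((j + l) * p) • (b.shuf C (tens D E)).hom.lin (sg k (l * q) •
          (φ.ap x s ⊗ₜ (b.shuf D E).hom.lin (ψ.ap y t ⊗ₜ χ.ap z u))) := by
      refine (tact_tm φ (tact ψ χ) _ x (tm rfl y z) hs (t ⊗ₜ u)).trans ?_
      rw [tact_tm ψ χ rfl y z ht u]
      exact congrArg (fun v => _ • (b.shuf C (tens D E)).hom.lin v)
        (TensorProduct.tmul_smul _ _ _)
    refine (congrArg _ e₁).trans (Eq.trans ?_ e₂.symm)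
    rw [map_smul, map_smul, map_smul, map_smul, smul_smul, smul_smul, ← sg_add, ← sg_add]
    have h₁ := LinearMap.congr_fun (congrArg DGMod.Hom.lin (Word.shuf_assoc C D E b))
      ((φ.ap x s ⊗ₜ ψ.ap y t) ⊗ₜ χ.ap z u)
    refine congrArg₂ (· • ·) ?_ h₁
    congr 1; ring

theorem tact_lun {C : DGMod k} (φ : OpHom P C.endProp) {b : Word} {n : ℤ}
    (t : THom (DGProp.unit k) P .X b n) :
    (b.powMap (lunitIso C).hom).lin ∘ₗ (tact (.ofProp (endUnit k)) φ).ap t =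
      φ.ap (PropHom.lunLin t) ∘ₗ (lunitIso C).hom.lin := by
  induction t using PropHom.lind with
  | zero => simp only [map_zero, LinearMap.comp_zero, LinearMap.zero_comp]
  | add x y hx hy =>
    simp only [map_add, LinearMap.comp_add, LinearMap.add_comp, hx, hy]
  | tm r x =>
    rw [PropHom.lunLin_pure]
    apply TensorProduct.ext'
    intro s y
    change (b.powMap (lunitIso C).hom).lin ((tact (.ofProp (endUnit k)) φ).ap (tm _ r x) (s ⊗ₜ y)) =
      φ.ap (r.1 • x) (s • y)
    have h₀ := tact_tm (.ofProp (endUnit k)) φ (zero_add n) r x (mem_gr_zero s) y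
    rw [mul_zero, sg_zero, one_smul] at h₀
    have h₁ := LinearMap.congr_fun (congrArg DGMod.Hom.lin (Word.shuf_lun C b))
      ((r.1 * s) ⊗ₜ φ.ap x y)
    have h₂ : (OpHom.ofProp (endUnit k)).ap r s = (b.unitPow (DGMod k)).hom.lin (r.1 * s) :=
      (map_smul (b.unitPow (DGMod k)).hom.lin r.1 s).symm
    rw [h₂] at h₀
    refine (congrArg _ h₀).trans (h₁.trans ?_)
    rw [map_smul, map_smul, LinearMap.smul_apply, ← mul_smul, mul_comm s]
    rfl

theorem tact_run {C : DGMod k} (φ : OpHom P C.endProp) {b : Word} {n : ℤ}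
    (t : THom P (DGProp.unit k) .X b n) :
    (b.powMap (runitIso C).hom).lin ∘ₗ (tact φ (.ofProp (endUnit k))).ap t =
      φ.ap (PropHom.runLin t) ∘ₗ (runitIso C).hom.lin := by
  induction t using PropHom.rind with
  | zero => simp only [map_zero, LinearMap.comp_zero, LinearMap.zero_comp]
  | add x y hx hy =>
    simp only [map_add, LinearMap.comp_add, LinearMap.add_comp, hx, hy]
  | tm x r =>
    rw [PropHom.runLin_pure]
    apply lin_ext₂ (D := DGMod.unit k)
    intro i _ y s hy _
    change (b.powMap (runitIso C).hom).lin ((tact φ (.ofProp (endUnit k))).ap (tm _ x r) (y ⊗ₜ s)) =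
      φ.ap (r.1 • x) (s • y)
    have h₀ := tact_tm φ (.ofProp (endUnit k)) (add_zero n) x r hy s
    rw [zero_mul, sg_zero, one_smul] at h₀
    have h₁ := LinearMap.congr_fun (congrArg DGMod.Hom.lin (Word.shuf_run C b))
      (φ.ap x y ⊗ₜ (r.1 * s))
    have h₂ : (OpHom.ofProp (endUnit k)).ap r s = (b.unitPow (DGMod k)).hom.lin (r.1 * s) :=
      (map_smul (b.unitPow (DGMod k)).hom.lin r.1 s).symm
    rw [h₂] at h₀
    refine (congrArg _ h₀).trans (h₁.trans ?_)
    rw [map_smul, map_smul, LinearMap.smul_apply, ← mul_smul, mul_comm s]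
    rfl

variable (H : Hopf P)

/-- The tensor product of coalgebras over an operad coming from a Hopf prop: an operation `f` acts
on `C ⊗ D` through `Δ f`. -/
def tensor (C D : Coalg P) : Coalg P where
  toMod := tens C.toMod D.toMod
  act := (OpHom.ofProp H.Δ).trans (tact C.act D.act)

/-- The unit coalgebra: an operation acts through its counit. -/
def unit : Coalg P where
  toMod := DGMod.unit k
  act := (OpHom.ofProp H.ε).trans (OpHom.ofProp (endUnit k))

theorem Hom.comm_lin {C D : Coalg P} (f : C ⟶ D) {b : Word} {n : ℤ} (x : P.Hom .X b n) :
    (b.powMap f.hom).lin ∘ₗ C.act.ap x = D.act.ap x ∘ₗ f.hom.lin :=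
  LinearMap.ext (f.comm x)

/-- Isomorphisms of coalgebras from isomorphisms of the underlying differential graded modules. -/
def isoMk {C D : Coalg P} (e : C.toMod ≅ D.toMod) (h : ∀ {b : Word} {n : ℤ} (x : P.Hom .X b n),
    (b.powMap e.hom).lin ∘ₗ C.act.ap x = D.act.ap x ∘ₗ e.hom.lin) : C ≅ D where
  hom := ⟨e.hom, fun x => LinearMap.congr_fun (h x)⟩
  inv := ⟨e.inv, fun {b n} x y => by
    have h₁ := LinearMap.congr_fun (h x) (e.inv.lin y)
    have h₂ : e.hom.lin (e.inv.lin y) = y := LinearMap.congr_fun (hom_inv_lin e) y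
    rw [LinearMap.comp_apply, LinearMap.comp_apply, h₂] at h₁
    rw [← h₁]
    change ((b.powMap e.hom) ≫ (b.powMap e.inv)).lin _ = _
    rw [← Word.powMap_comp, e.hom_inv_id, Word.powMap_id]; rfl⟩
  hom_inv_id := Hom.ext e.hom_inv_id
  inv_hom_id := Hom.ext e.inv_hom_id

/-- The tensor product of morphisms. -/
def tensorMap {C C' D D' : Coalg P} (f : C ⟶ C') (g : D ⟶ D') : tensor H C D ⟶ tensor H C' D' :=
  ⟨mapT f.hom g.hom, fun x => LinearMap.congr_fun
    (tact_nat C.act D.act C'.act D'.act f.hom g.hom f.comm g.comm (H.Δ.map x))⟩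

/-- The structure of the monoidal category of coalgebras. -/
abbrev monoidalStruct : MonoidalCategoryStruct (Coalg P) where
  tensorObj := tensor H
  tensorUnit := unit H
  tensorHom := tensorMap H
  whiskerLeft C _ _ f := tensorMap H (𝟙 C) f
  whiskerRight f D := tensorMap H f (𝟙 D)
  associator C D E := isoMk (assocIso C.toMod D.toMod E.toMod) fun {b n} x => by
    have h₁ := tact_assoc C.act D.act E.act (b := b)
      ((H.Δ.prodMap (.id P)).map (H.Δ.map x))
    rw [show PropHom.assocLin _ = _ from H.coassoc x] at h₁
    refine Eq.trans (congrArg _ (tact_left (.ofProp H.Δ) _ _ _)) (h₁.trans ?_)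
    exact congrArg (· ∘ₗ _) (tact_right _ (.ofProp H.Δ) _ _).symm
  leftUnitor C := isoMk (lunitIso C.toMod) fun {b n} x => by
    have h₁ := tact_lun C.act (b := b) ((H.ε.prodMap (.id P)).map (H.Δ.map x))
    rw [H.counit_left x] at h₁
    exact Eq.trans (congrArg _ (tact_left (.ofProp H.ε) _ _ _)) h₁
  rightUnitor C := isoMk (runitIso C.toMod) fun {b n} x => by
    have h₁ := tact_run C.act (b := b) ((PropHom.prodMap (.id P) H.ε).map (H.Δ.map x))
    rw [H.counit_right x] at h₁
    exact Eq.trans (congrArg _ (tact_right _ (.ofProp H.ε) _ _)) h₁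

/-- The monoidal category of coalgebras over an operad coming from a Hopf prop. -/
abbrev monoidal : MonoidalCategory (Coalg P) :=
  letI := monoidalStruct H
  MonoidalCategory.ofTensorHom
    (id_tensorHom_id := fun C D => Hom.ext (id_tensorHom_id C.toMod D.toMod))
    (id_tensorHom := fun _ _ _ _ => rfl)
    (tensorHom_id := fun _ _ => rfl)
    (tensorHom_comp_tensorHom := fun f g f' g' =>
      Hom.ext (tensorHom_comp_tensorHom f.hom g.hom f'.hom g'.hom))
    (associator_naturality := fun f g h => Hom.ext (associator_naturality f.hom g.hom h.hom))
    (leftUnitor_naturality := fun f => Hom.ext (leftUnitor_naturality f.hom))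
    (rightUnitor_naturality := fun f => Hom.ext (rightUnitor_naturality f.hom))
    (pentagon := fun A B C D => Hom.ext (pentagon A.toMod B.toMod C.toMod D.toMod))
    (triangle := fun C D => Hom.ext (triangle C.toMod D.toMod))

end Coalg

instance : MonoidalCategory (Coalg (M k)) := Coalg.monoidal (M.hopf k)

end

section

/-- The product of two maps between vertex sets of cubes. -/
def cubeProd {m n m' n' : ℕ} (f : (Fin m → Bool) → (Fin n → Bool))
    (g : (Fin m' → Bool) → (Fin n' → Bool)) : (Fin (m + m') → Bool) → (Fin (n + n') → Bool) :=
  fun x => Fin.append (f fun i => x (Fin.castAdd m' i)) (g fun i => x (Fin.natAdd m i))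

/-- The maps between vertex sets of cubes that belong to the cube category with connections: those
generated under composition and product by the two vertices of the interval, the projection of the
interval to the point, and the maximum. -/
inductive IsCubeMap : ∀ {m n : ℕ}, ((Fin m → Bool) → (Fin n → Bool)) → Prop
  | id (n : ℕ) : IsCubeMap (fun x : Fin n → Bool => x)
  | comp {l m n : ℕ} {g : (Fin m → Bool) → (Fin n → Bool)} {f : (Fin l → Bool) → (Fin m → Bool)} :
      IsCubeMap g → IsCubeMap f → IsCubeMap (fun x => g (f x))
  | prod {m n m' n' : ℕ} {f : (Fin m → Bool) → (Fin n → Bool)}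
      {g : (Fin m' → Bool) → (Fin n' → Bool)} :
      IsCubeMap f → IsCubeMap g → IsCubeMap (cubeProd f g)
  | face (e : Bool) : IsCubeMap (fun (_ : Fin 0 → Bool) (_ : Fin 1) => e)
  | deg : IsCubeMap (fun (_ : Fin 1 → Bool) (_ : Fin 0) => false)
  | conn : IsCubeMap (fun (x : Fin 2 → Bool) (_ : Fin 1) => x 0 || x 1)

/-- The cube category with connections; `⟨n⟩` is the object `2 ^ n`. -/
structure Cube : Type where
  dim : ℕ

namespace Cube

instance : Category Cube where
  Hom a b := {f : (Fin a.dim → Bool) → (Fin b.dim → Bool) // IsCubeMap f}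
  id a := ⟨fun x => x, .id a.dim⟩
  comp f g := ⟨fun x => g.1 (f.1 x), .comp g.2 f.2⟩

theorem hom_ext {a b : Cube} {f g : a ⟶ b} (h : ∀ x i, f.1 x i = g.1 x i) : f = g :=
  Subtype.ext (funext fun x => funext (h x))

theorem isCubeMap_cast {m n : ℕ} (h : n = m) :
    IsCubeMap (fun (x : Fin m → Bool) (i : Fin n) => x (Fin.cast h i)) := by
  subst h; exact .id _

/-- The isomorphism between cubes of equal dimension. -/
def castIso {m n : ℕ} (h : m = n) : Cube.mk m ≅ Cube.mk n where
  hom := ⟨fun x i => x (Fin.cast h.symm i), isCubeMap_cast h.symm⟩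
  inv := ⟨fun x i => x (Fin.cast h i), isCubeMap_cast h⟩
  hom_inv_id := rfl
  inv_hom_id := rfl

/-- The tensor product of morphisms. -/
def tensorMap {a b a' b' : Cube} (f : a ⟶ b) (g : a' ⟶ b') :
    Cube.mk (a.dim + a'.dim) ⟶ Cube.mk (b.dim + b'.dim) :=
  ⟨cubeProd f.1 g.1, .prod f.2 g.2⟩

instance : MonoidalCategoryStruct Cube where
  tensorObj a b := ⟨a.dim + b.dim⟩
  tensorUnit := ⟨0⟩
  tensorHom := tensorMap
  whiskerLeft a _ _ f := tensorMap (𝟙 a) f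
  whiskerRight f b := tensorMap f (𝟙 b)
  associator a b c := castIso (add_assoc a.dim b.dim c.dim)
  leftUnitor a := castIso (zero_add a.dim)
  rightUnitor a := castIso (add_zero a.dim)

theorem prod_id (a b : Cube) : tensorMap (𝟙 a) (𝟙 b) = 𝟙 (⟨a.dim + b.dim⟩ : Cube) := by
  apply hom_ext
  intro x i
  refine Fin.addCases (fun i => ?_) (fun i => ?_) i
  · exact Fin.append_left _ _ i
  · exact Fin.append_right _ _ i

theorem prod_comp {a b c a' b' c' : Cube} (f : a ⟶ b) (g : a' ⟶ b') (f' : b ⟶ c)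
    (g' : b' ⟶ c') : tensorMap f g ≫ tensorMap f' g' = tensorMap (f ≫ f') (g ≫ g') := by
  apply Subtype.ext
  funext x
  refine congrArg₂ Fin.append (congrArg f'.1 ?_) (congrArg g'.1 ?_)
  · funext i; exact Fin.append_left _ _ i
  · funext i; exact Fin.append_right _ _ i

/-- Morphisms that only identify coordinates. -/
def IsCast {a b : Cube} (f : a ⟶ b) : Prop :=
  ∃ h : a.dim = b.dim, ∀ x i, f.1 x i = x (Fin.cast h.symm i)

theorem IsCast.eq {a b : Cube} {f g : a ⟶ b} (hf : IsCast f) (hg : IsCast g) : f = g := by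
  obtain ⟨_, hf⟩ := hf
  obtain ⟨_, hg⟩ := hg
  exact hom_ext fun x i => (hf x i).trans (hg x i).symm

theorem IsCast.comp {a b c : Cube} {f : a ⟶ b} {g : b ⟶ c} (hf : IsCast f) (hg : IsCast g) :
    IsCast (f ≫ g) := by
  obtain ⟨h, hf⟩ := hf
  obtain ⟨h', hg⟩ := hg
  exact ⟨h.trans h', fun x i => (hg _ _).trans (hf _ _)⟩

theorem isCast_id (a : Cube) : IsCast (𝟙 a) := ⟨rfl, fun _ _ => rfl⟩

theorem isCast_castIso {m n : ℕ} (h : m = n) : IsCast (castIso h).hom := ⟨h, fun _ _ => rfl⟩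

theorem isCast_tensor {a b a' b' : Cube} {f : a ⟶ b} {g : a' ⟶ b'} (hf : IsCast f)
    (hg : IsCast g) : IsCast (tensorMap f g) := by
  obtain ⟨h, hf⟩ := hf
  obtain ⟨h', hg⟩ := hg
  refine ⟨congrArg₂ (· + ·) h h', fun x i => ?_⟩
  refine Fin.addCases (fun i => ?_) (fun i => ?_) i
  · refine (Fin.append_left _ _ i).trans ((hf _ _).trans ?_)
    exact congrArg x (Fin.ext rfl)
  · refine (Fin.append_right _ _ i).trans ((hg _ _).trans ?_)
    exact congrArg x (Fin.ext (congrArg (· + i.1) h))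

instance : MonoidalCategory Cube := MonoidalCategory.ofTensorHom
  (id_tensorHom_id := prod_id)
  (id_tensorHom := fun _ _ _ _ => rfl)
  (tensorHom_id := fun _ _ => rfl)
  (tensorHom_comp_tensorHom := prod_comp)
  (associator_naturality := fun {a b c a' b' c'} f g h => by
    apply hom_ext
    intro x i
    change Fin.append (Fin.append (f.1 _) (g.1 _)) (h.1 _) (Fin.cast _ i) =
      Fin.append (f.1 _) (Fin.append (g.1 _) (h.1 _)) i
    rw [Fin.append_assoc, Function.comp_apply]
    refine congrArg₂ (fun s t => Fin.append (f.1 _) (Fin.append (g.1 s) (h.1 t)) i) rfl ?_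
    funext j
    exact congrArg x (Fin.ext (add_assoc a.dim b.dim j.1)))
  (leftUnitor_naturality := fun {a b} f => by
    apply hom_ext
    intro x i
    change cubeProd (fun (x : Fin 0 → Bool) => x) f.1 x (Fin.cast (zero_add b.dim).symm i) =
      f.1 (fun j => x (Fin.cast (zero_add a.dim).symm j)) i
    rw [cubeProd, show Fin.cast (zero_add b.dim).symm i = Fin.natAdd 0 i from
      Fin.ext (zero_add i.1).symm, Fin.append_right]
    refine congrArg (fun s => f.1 s i) ?_
    funext j
    exact congrArg x (Fin.ext (zero_add j.1)))
  (rightUnitor_naturality := fun {a b} f => by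
    apply hom_ext
    intro x i
    exact Fin.append_left _ _ i)
  (pentagon := fun a b c d => ((isCast_tensor (isCast_castIso _) (isCast_id d)).comp
    ((isCast_castIso _).comp (isCast_tensor (isCast_id a) (isCast_castIso _)))).eq
      ((isCast_castIso _).comp (isCast_castIso _)))
  (triangle := fun a b => ((isCast_castIso _).comp (isCast_tensor (isCast_id a)
    (isCast_castIso _))).eq (isCast_tensor (isCast_castIso _) (isCast_id b)))

end Cube

end

section

variable {k : Type u} [CommRing k]

/-- The cells of the interval: `some false` is `[0]`, `some true` is `[1]` and `none` is the edge
`[0,1]`. -/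
abbrev Cell : Type := Option Bool

/-- The dimension of a cell. -/
def Cell.dim : Cell → ℤ
  | none => 1
  | some _ => 0

namespace DGMod

section interval

variable (k) in
/-- The basis element of the cellular chains of the interval given by a cell. -/
def ce (c : Cell) : Cell →₀ k := Finsupp.single c 1

/-- Linear maps out of the chains of the interval. -/
def clift {E : Type*} [AddCommMonoid E] [Module k E] (v : Cell → E) : (Cell →₀ k) →ₗ[k] E :=
  Finsupp.linearCombination k v

@[simp] theorem clift_ce {E : Type*} [AddCommMonoid E] [Module k E] (v : Cell → E) (c : Cell) :
    clift v (ce k c) = v c := by simp [clift, ce]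

theorem cext {E : Type*} [AddCommMonoid E] [Module k E] {f g : (Cell →₀ k) →ₗ[k] E}
    (h : ∀ c, f (ce k c) = g (ce k c)) : f = g :=
  Finsupp.lhom_ext' fun c => LinearMap.ext_ring (h c)

variable (k) in
/-- The homogeneous parts of the chains of the interval. -/
def cgr (n : ℤ) : Submodule k (Cell →₀ k) := Submodule.span k (ce k '' {c | c.dim = n})

theorem ce_mem (c : Cell) : ce k c ∈ cgr k c.dim := Submodule.subset_span ⟨c, rfl, rfl⟩

theorem cgr_le {n : ℤ} {S : Submodule k (Cell →₀ k)} (h : ∀ c : Cell, c.dim = n → ce k c ∈ S) :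
    cgr k n ≤ S := by
  rw [cgr, Submodule.span_le]
  rintro _ ⟨c, hc, rfl⟩
  exact h c hc

theorem cgr_internal : DirectSum.IsInternal (cgr k) := by
  apply isInternal_mk (cgr k)
    (clift fun c => DirectSum.lof k ℤ (fun n => cgr k n) c.dim ⟨ce k c, ce_mem c⟩)
  · intro n z hz
    have : cgr k n ≤ Submodule.comap (clift fun c => DirectSum.lof k ℤ (fun n => cgr k n) c.dim
        ⟨ce k c, ce_mem c⟩) (LinearMap.range (DirectSum.lof k ℤ (fun n => cgr k n) n)) := by
      apply cgr_le
      rintro c rfl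
      rw [Submodule.mem_comap, clift_ce]
      exact ⟨_, rfl⟩
    obtain ⟨w, hw⟩ := this hz
    exact ⟨w, hw.symm⟩
  · apply cext
    intro c
    simp

variable (k) in
/-- The differential of the chains of the interval: `d [0,1] = [1] - [0]`. -/
def cd : (Cell →₀ k) →ₗ[k] Cell →₀ k := clift fun
  | none => ce k (some true) - ce k (some false)
  | some _ => 0

theorem cd_none : cd k (ce k none) = ce k (some true) - ce k (some false) := clift_ce _ _

theorem cd_some (b : Bool) : cd k (ce k (some b)) = 0 := clift_ce _ _

theorem cd_mem {n : ℤ} : cgr k n ≤ Submodule.comap (cd k) (cgr k (n - 1)) := by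
  apply cgr_le
  rintro (_ | b) rfl
  · rw [Submodule.mem_comap, cd_none]
    exact Submodule.sub_mem _ (ce_mem (some true)) (ce_mem (some false))
  · rw [Submodule.mem_comap, cd_some]
    exact Submodule.zero_mem _

theorem cd_cd : cd k ∘ₗ cd k = 0 := by
  apply cext
  rintro (_ | b)
  · rw [LinearMap.comp_apply, cd_none, map_sub, cd_some, cd_some, sub_zero, LinearMap.zero_apply]
  · rw [LinearMap.comp_apply, cd_some, map_zero, LinearMap.zero_apply]

variable (k) in
/-- The cellular chains of the interval. -/
abbrev interval : DGMod k where
  carrier := Cell →₀ k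
  gr := cgr k
  internal := cgr_internal
  d := cd k
  d_mem hx := cd_mem hx
  d_d x := LinearMap.congr_fun cd_cd x

theorem interval_deg {D : DGMod k} {m : ℤ} {f : (Cell →₀ k) →ₗ[k] D}
    (h : ∀ c : Cell, f (ce k c) ∈ D.gr (m + c.dim)) : IsDeg (interval k) D m f := by
  intro n x hx
  refine cgr_le (S := Submodule.comap f (D.gr (m + n))) ?_ hx
  rintro c rfl
  exact h c

theorem cext₂ {E : Type*} [AddCommMonoid E] [Module k E]
    {f g : (Cell →₀ k) ⊗[k] (Cell →₀ k) →ₗ[k] E}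
    (h : ∀ c c', f (ce k c ⊗ₜ ce k c') = g (ce k c ⊗ₜ ce k c')) : f = g :=
  TensorProduct.ext (cext fun c => cext fun c' => h c c')

theorem interval_deg₂ {D : DGMod k} {m : ℤ} {f : (Cell →₀ k) ⊗[k] (Cell →₀ k) →ₗ[k] D}
    (h : ∀ c c' : Cell, f (ce k c ⊗ₜ ce k c') ∈ D.gr (m + (c.dim + c'.dim))) :
    IsDeg (tens (interval k) (interval k)) D m f := by
  apply deg_tens
  intro i j x y hx hy
  refine cgr_le (S := Submodule.comap (f ∘ₗ (TensorProduct.mk k _ _).flip y)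
    (D.gr (m + (i + j)))) ?_ hx
  rintro c rfl
  refine cgr_le (S := Submodule.comap (f ∘ₗ (TensorProduct.mk k _ _) (ce k c))
    (D.gr (m + (c.dim + j)))) ?_ hy
  rintro c' rfl
  exact h c c'

/-- The augmentation of the interval. -/
def cellε : Cell → k
  | none => 0
  | some _ => 1

/-- The Serre coproduct of the interval. -/
def cellΔ : Cell → (Cell →₀ k) ⊗[k] (Cell →₀ k)
  | none => ce k (some false) ⊗ₜ ce k none + ce k none ⊗ₜ ce k (some true)
  | some b => ce k (some b) ⊗ₜ ce k (some b)

/-- The coefficient of `[0,1]` in `x ∗ y` for cells of the interval: `1` for `[0] ∗ [1]`, `-1` for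
`[1] ∗ [0]` and `0` otherwise. -/
def cellJoin : Cell → Cell → k
  | some false, some true => 1
  | some true, some false => -1
  | _, _ => 0

variable (k) in
/-- The linear extension of `cellε`. -/
def epsLin : (Cell →₀ k) →ₗ[k] k := clift cellε

variable (k) in
/-- The linear extension of `cellΔ`. -/
def deltaLin : (Cell →₀ k) →ₗ[k] (Cell →₀ k) ⊗[k] (Cell →₀ k) := clift cellΔ

variable (k) in
/-- The bilinear extension of the product of cells. -/
def joinLin : (Cell →₀ k) ⊗[k] (Cell →₀ k) →ₗ[k] (Cell →₀ k) :=
  TensorProduct.lift (clift fun c => clift fun c' => (cellJoin c c' : k) • ce k none)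

theorem eps_none : epsLin k (ce k none) = 0 := clift_ce _ _
theorem eps_some (b : Bool) : epsLin k (ce k (some b)) = 1 := clift_ce _ _
theorem delta_ce (c : Cell) : deltaLin k (ce k c) = cellΔ c := clift_ce _ _
theorem join_ce (c c' : Cell) : joinLin k (ce k c ⊗ₜ ce k c') = (cellJoin c c' : k) • ce k none := by
  simp [joinLin]

theorem cellε_mem (c : Cell) : epsLin k (ce k c) ∈ (unit k).gr (0 + c.dim) := by
  rcases c with _ | b
  · rw [eps_none]; exact Submodule.zero_mem _
  · rw [eps_some]; exact one_mem_gr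

theorem cellΔ_mem (c : Cell) :
    deltaLin k (ce k c) ∈ (tens (interval k) (interval k)).gr (0 + c.dim) := by
  rw [delta_ce]
  rcases c with _ | b
  · exact Submodule.add_mem _ (tmul_mem (C := interval k) (D := interval k)
      (show (0 : ℤ) + 1 = 0 + 1 from rfl) (ce_mem (some false)) (ce_mem none))
      (tmul_mem (C := interval k) (D := interval k)
      (show (1 : ℤ) + 0 = 0 + 1 from rfl) (ce_mem none) (ce_mem (some true)))
  · exact tmul_mem (C := interval k) (D := interval k) (show (0 : ℤ) + 0 = 0 + 0 from rfl)
      (ce_mem (some b)) (ce_mem (some b))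

theorem cellJoin_none_left (c : Cell) : (cellJoin none c : k) = 0 := by
  rcases c with _ | _ | _ <;> rfl

theorem cellJoin_none_right (c : Cell) : (cellJoin c none : k) = 0 := by
  rcases c with _ | _ | _ <;> rfl

theorem cellJoin_mem (c c' : Cell) :
    joinLin k (ce k c ⊗ₜ ce k c') ∈ cgr k (1 + (c.dim + c'.dim)) := by
  rw [join_ce]
  rcases c with _ | b
  · rw [cellJoin_none_left, zero_smul]; exact Submodule.zero_mem _
  rcases c' with _ | b'
  · rw [cellJoin_none_right, zero_smul]; exact Submodule.zero_mem _
  · exact Submodule.smul_mem _ _ (ce_mem none)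

variable (k) in
/-- The augmentation of the interval. -/
def intε : homDeg (interval k) (unit k) 0 := ⟨epsLin k, interval_deg cellε_mem⟩

variable (k) in
/-- The coproduct of the interval. -/
def intΔ : homDeg (interval k) (tens (interval k) (interval k)) 0 :=
  ⟨deltaLin k, interval_deg cellΔ_mem⟩

variable (k) in
/-- The product of the interval. -/
def intJoin : homDeg (tens (interval k) (interval k)) (interval k) 1 :=
  ⟨joinLin k, interval_deg₂ cellJoin_mem⟩

theorem tens_d_ce (c c' : Cell) : (tens (interval k) (interval k)).d (ce k c ⊗ₜ ce k c') =
    cd k (ce k c) ⊗ₜ ce k c' + sg k c.dim • (ce k c ⊗ₜ[k] cd k (ce k c')) :=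
  tens_d_tmul (C := interval k) (D := interval k) (ce_mem c) (ce k c')

variable (k) in
/-- The structure on the interval. -/
def intGens : Gens (endProp (interval k)) where
  cu := intε k
  cp := intΔ k
  pr := intJoin k
  d_cu := by
    apply Subtype.ext
    apply cext
    intro c
    change 0 - sg k 0 • epsLin k (cd k (ce k c)) = 0
    rcases c with _ | b
    · rw [cd_none, map_sub, eps_some, eps_some, sub_self, smul_zero, sub_zero]
    · rw [cd_some, map_zero, smul_zero, sub_zero]
  d_cp := by
    apply Subtype.ext
    apply cext
    intro c
    change (tens (interval k) (interval k)).d (deltaLin k (ce k c)) -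
      sg k 0 • deltaLin k (cd k (ce k c)) = 0
    rw [delta_ce, sg_zero, one_smul]
    rcases c with _ | b
    · rw [cd_none, map_sub, delta_ce, delta_ce, cellΔ, cellΔ, cellΔ, map_add, tens_d_ce, tens_d_ce,
        cd_none, cd_some, cd_some]
      simp only [Cell.dim, sg_zero, one_smul, TensorProduct.zero_tmul, TensorProduct.tmul_zero,
        smul_zero, TensorProduct.sub_tmul, TensorProduct.tmul_sub]
      abel
    · rw [cd_some, map_zero, sub_zero, cellΔ, tens_d_ce, cd_some, TensorProduct.zero_tmul,
        TensorProduct.tmul_zero, smul_zero, add_zero]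
  d_pr := by
    apply Subtype.ext
    apply cext₂
    intro c c'
    change cd k (joinLin k (ce k c ⊗ₜ ce k c')) -
      sg k 1 • joinLin k ((tens (interval k) (interval k)).d (ce k c ⊗ₜ ce k c')) =
      TensorProduct.lid k _ ((whr (interval k) (intε k)).1 (ce k c ⊗ₜ ce k c')) -
      TensorProduct.rid k _ ((whl (interval k) (intε k)).1 (ce k c ⊗ₜ ce k c'))
    rw [whr_apply, whl_apply, sgn_zero, TensorProduct.map_tmul, TensorProduct.map_tmul,
      TensorProduct.lid_tmul, TensorProduct.rid_tmul, tens_d_ce, map_add, map_smul, join_ce]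
    change _ = epsLin k (ce k c) • ce k c' - epsLin k (ce k c') • ce k c
    rcases c with _ | _ | _ <;> rcases c' with _ | _ | _ <;>
      simp [cd_some, cd_none, eps_some, eps_none, cellJoin, Cell.dim, TensorProduct.sub_tmul,
        TensorProduct.tmul_sub, join_ce]
  counit_left := by
    apply Subtype.ext
    apply cext
    intro c
    change (whr (interval k) (intε k)).1 (deltaLin k (ce k c)) = (1 : k) ⊗ₜ ce k c
    rw [delta_ce, whr_apply]
    change TensorProduct.map (epsLin k) LinearMap.id _ = _
    rcases c with _ | b <;> simp [cellΔ, eps_some, eps_none]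
  counit_right := by
    apply Subtype.ext
    apply cext
    intro c
    change (whl (interval k) (intε k)).1 (deltaLin k (ce k c)) = ce k c ⊗ₜ (1 : k)
    rw [delta_ce, whl_apply, sgn_zero]
    change TensorProduct.map LinearMap.id (epsLin k) _ = _
    rcases c with _ | b <;> simp [cellΔ, eps_some, eps_none]
  coassoc := by
    apply Subtype.ext
    apply cext
    intro c
    change TensorProduct.assoc k _ _ _ ((whr (interval k) (intΔ k)).1 (deltaLin k (ce k c))) =
      (whl (interval k) (intΔ k)).1 (deltaLin k (ce k c))
    rw [delta_ce, whl_apply, whr_apply, sgn_zero]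
    change TensorProduct.assoc k _ _ _ (TensorProduct.map (deltaLin k) LinearMap.id _) =
      TensorProduct.map LinearMap.id (deltaLin k) _
    rcases c with _ | b <;> simp [cellΔ, delta_ce, TensorProduct.add_tmul, TensorProduct.tmul_add,
      add_assoc]
  cu_pr := by
    apply Subtype.ext
    apply cext₂
    intro c c'
    change epsLin k (joinLin k (ce k c ⊗ₜ ce k c')) = 0
    rw [join_ce, map_smul, eps_none, smul_zero]

end interval

end DGMod

end

section

variable {k : Type u} [CommRing k]

namespace DGMod
open DGProp

section tensorGens
variable {C D : DGMod k}

theorem endTens_tm {a b : Word} {i j n : ℤ} (h : i + j = n) (f : homDeg (a.pow C) (b.pow C) i)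
    (g : homDeg (a.pow D) (b.pow D) j) :
    (endTens C D).map (tm (P := endProp C) (Q := endProp D) h f g) = shHom C D h f g :=
  tdesc_pure (P := endProp C) (Q := endProp D) (fun _ _ h => shHom C D h) h f g

variable (G : Gens (endProp C)) (H : Gens (endProp D))

/-- The augmentation of a dg module with structure. -/
def gε : C →ₗ[k] k := G.cu.1

/-- The coproduct of a dg module with structure. -/
def gΔ : C →ₗ[k] C ⊗[k] C := G.cp.1

/-- The product of a dg module with structure. -/
def gJ : C ⊗[k] C →ₗ[k] C := G.pr.1

/-- The structure on a tensor product. -/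
abbrev gtens : Gens (endProp (tens C D)) := (G.prod H).map (endTens C D)

theorem gcr_apply (s s' : C) : G.cr.1 (s ⊗ₜ s') = gε G s' • s := by
  change TensorProduct.rid k C ((whl C G.cu).1 (s ⊗ₜ s')) = _
  rw [whl_apply, sgn_zero]; rfl

theorem gcl_apply (s s' : C) : G.cl.1 (s ⊗ₜ s') = gε G s • s' := by
  change TensorProduct.lid k C ((whr C G.cu).1 (s ⊗ₜ s')) = _
  rw [whr_apply]; rfl

theorem gtens_cu : (gtens G H).cu = shHom C D (add_zero 0) G.cu H.cu := endTens_tm _ _ _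

theorem gtens_cp : (gtens G H).cp = shHom C D (add_zero 0) G.cp H.cp := endTens_tm _ _ _

theorem gtens_pr : (gtens G H).pr = shHom C D (zero_add 1) G.cr H.pr +
    shHom C D (add_zero 1) G.pr H.cl := by
  refine (map_add (endTens C D).map _ _).trans ?_
  rw [endTens_tm, endTens_tm]

theorem gtens_ε (s : C) (t : D) : gε (gtens G H) (s ⊗ₜ t) = gε G s * gε H t := by
  rw [gε, gtens_cu]
  change TensorProduct.lid k k (TensorProduct.map (G.cu.1 ∘ₗ C.sgn 0) H.cu.1 (s ⊗ₜ t)) = _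
  rw [sgn_zero]; rfl

theorem gtens_Δ (x : tens C D) : gΔ (gtens G H) x =
    (tensorμ C C D D).lin (TensorProduct.map (gΔ G) (gΔ H) x) := by
  rw [gΔ, gtens_cp]
  change TensorProduct.map LinearMap.id LinearMap.id ((tensorμ C C D D).lin
    (TensorProduct.map (G.cp.1 ∘ₗ C.sgn 0) H.cp.1 x)) = _
  rw [sgn_zero, TensorProduct.map_id]; rfl

theorem shHom_XX {i j n : ℤ} (h : i + j = n) (f : homDeg (tens C C) C i) (g : homDeg (tens D D) D j)
    {a b c : ℤ} {s s' : C} {t t' : D} (hs : s ∈ C.gr a) (ht : t ∈ D.gr b) (hs' : s' ∈ C.gr c) :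
    (shHom (a := .tens .X .X) (b := .X) C D h f g).1
      ((s ⊗ₜ[k] t) ⊗ₜ[k] (s' ⊗ₜ[k] t') : tens (tens C D) (tens C D)) =
      sg k (b * c + j * (a + c)) • ((f.1 (s ⊗ₜ[k] s') : C) ⊗ₜ[k] (g.1 (t ⊗ₜ[k] t') : D)) := by
  let F : (C ⊗[k] D) ⊗[k] (C ⊗[k] D) →ₗ[k] C ⊗[k] D :=
    (shHom (a := .tens .X .X) (b := .X) C D h f g).1
  have h₁ : F ((tensorμ C C D D).lin ((s ⊗ₜ[k] s') ⊗ₜ[k] (t ⊗ₜ[k] t'))) =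
      (tensHom (tens C C) C (tens D D) D h f g).1 ((s ⊗ₜ[k] s') ⊗ₜ[k] (t ⊗ₜ[k] t')) := by
    refine Eq.trans (congrArg F ?_) (LinearMap.congr_fun
      (shHom_shuf (a := .tens .X .X) (b := .X) C D h f g) ((s ⊗ₜ[k] s') ⊗ₜ[k] (t ⊗ₜ[k] t')))
    exact (LinearMap.congr_fun TensorProduct.map_id _).symm
  rw [tensorμ_tmul s t' hs' ht, map_smul, tensHom_tmul (C := tens C C) h f g
    (tmul_mem rfl hs hs')] at h₁
  change F ((s ⊗ₜ[k] t) ⊗ₜ[k] (s' ⊗ₜ[k] t')) = _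
  rw [sg_add, mul_smul, ← h₁, smul_smul, mul_comm b c, sg_self, one_smul]

theorem gtens_J {a b c : ℤ} {s s' : C} {t t' : D} (hs : s ∈ C.gr a) (ht : t ∈ D.gr b)
    (hs' : s' ∈ C.gr c) : gJ (gtens G H) ((s ⊗ₜ t) ⊗ₜ (s' ⊗ₜ t')) =
      sg k (b * c + (a + c)) • ((gε G s' • s) ⊗ₜ gJ H (t ⊗ₜ t')) +
        sg k (b * c) • (gJ G (s ⊗ₜ s') ⊗ₜ (gε H t • t')) := by
  rw [gJ, gtens_pr]
  have e₁ := shHom_XX (C := C) (D := D) (zero_add 1) G.cr H.pr (t' := t') hs ht hs'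
  have e₂ := shHom_XX (C := C) (D := D) (add_zero 1) G.pr H.cl (t' := t') hs ht hs'
  refine congrArg₂ (· + ·) (e₁.trans ?_) (e₂.trans ?_)
  · exact congrArg₂ (· • ·) (by rw [one_mul]) (congrArg (· ⊗ₜ[k] _) (gcr_apply G s s'))
  · exact congrArg₂ (· • ·) (by rw [zero_mul, add_zero])
      (congrArg (_ ⊗ₜ[k] ·) (gcl_apply H t t'))

end tensorGens

variable (k) in
/-- The chains of the cube `2 ^ n` as the `n`-fold tensor power of the chains of the interval. -/
def cubeMod : ℕ → DGMod k
  | 0 => unit k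
  | n + 1 => tens (cubeMod n) (interval k)

variable (k) in
/-- The basis element `x₁ ⊗ ⋯ ⊗ xₙ`. -/
def cell : ∀ {n : ℕ}, (Fin n → Cell) → cubeMod k n
  | 0, _ => ((1 : k) : unit k)
  | _ + 1, x => cell (Fin.init x) ⊗ₜ[k] ce k (x (Fin.last _))

/-- The dimension of a cell. -/
def cdim {n : ℕ} (x : Fin n → Cell) : ℤ := ∑ i, (x i).dim

theorem cdim_succ {n : ℕ} (x : Fin (n + 1) → Cell) :
    cdim x = cdim (Fin.init x) + (x (Fin.last n)).dim := Fin.sum_univ_castSucc _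

theorem cell_mem : ∀ {n : ℕ} (x : Fin n → Cell), cell k x ∈ (cubeMod k n).gr (cdim x)
  | 0, _ => one_mem_gr (k := k)
  | n + 1, x => tmul_mem (C := cubeMod k n) (D := interval k) (cdim_succ x).symm (cell_mem _)
      (ce_mem _)

/-- The identification of the cells of a cube with pairs of cells. -/
def cellEquiv (n : ℕ) : (Fin n → Cell) × Cell ≃ (Fin (n + 1) → Cell) :=
  (Equiv.prodComm _ _).trans (Fin.snocEquiv fun _ => Cell)

variable (k) in
/-- The cells form a basis. -/
def cubeBasis : ∀ n : ℕ, Module.Basis (Fin n → Cell) k (cubeMod k n)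
  | 0 => (Module.Basis.singleton (Fin 0 → Cell) k : Module.Basis (Fin 0 → Cell) k (unit k))
  | n + 1 => (((cubeBasis n).tensorProduct (Finsupp.basisSingleOne (R := k) (ι := Cell))).reindex
      (cellEquiv n) : Module.Basis _ k (cubeMod k n ⊗[k] (Cell →₀ k)))

theorem cubeBasis_apply : ∀ {n : ℕ} (x : Fin n → Cell), cubeBasis k n x = cell k x
  | 0, x => Module.Basis.singleton_apply (Fin 0 → Cell) k x
  | n + 1, x => by
    refine (Module.Basis.reindex_apply ((cubeBasis k n).tensorProduct
      (Finsupp.basisSingleOne (R := k) (ι := Cell))) (cellEquiv n) x).trans ?_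
    rw [Module.Basis.tensorProduct_apply', cubeBasis_apply, Finsupp.coe_basisSingleOne]
    rfl

variable (k) in
/-- Linear maps given by their values on cells. -/
def cellLift {n : ℕ} {E : Type*} [AddCommMonoid E] [Module k E] (v : (Fin n → Cell) → E) :
    cubeMod k n →ₗ[k] E := (cubeBasis k n).constr k v

@[simp] theorem cellLift_cell {n : ℕ} {E : Type*} [AddCommMonoid E] [Module k E]
    (v : (Fin n → Cell) → E) (x : Fin n → Cell) : cellLift k v (cell k x) = v x := by
  rw [cellLift, ← cubeBasis_apply, Module.Basis.constr_basis]

theorem cell_ext {n : ℕ} {E : Type*} [AddCommMonoid E] [Module k E] {f g : cubeMod k n →ₗ[k] E}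
    (h : ∀ x, f (cell k x) = g (cell k x)) : f = g :=
  (cubeBasis k n).ext fun x => by rw [cubeBasis_apply, h]

theorem cell_ext₂ {m n : ℕ} {E : Type*} [AddCommMonoid E] [Module k E]
    {f g : cubeMod k m ⊗[k] cubeMod k n →ₗ[k] E}
    (h : ∀ x y, f (cell k x ⊗ₜ cell k y) = g (cell k x ⊗ₜ cell k y)) : f = g :=
  TensorProduct.ext (cell_ext fun x => cell_ext fun y => h x y)

variable (k) in
/-- The augmentation: `ε (x₁ ⊗ ⋯ ⊗ xₙ) = ε x₁ ⋯ ε xₙ`. -/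
def cubeε (n : ℕ) : cubeMod k n →ₗ[k] k := cellLift k fun x => ∏ i, cellε (x i)

variable (k) in
/-- The Serre coproduct: the shuffle map applied to the tensor product of the coproducts of the
factors. -/
def cubeΔ : ∀ n : ℕ, cubeMod k n →ₗ[k] cubeMod k n ⊗[k] cubeMod k n
  | 0 => (λ_ (unit k)).inv.lin
  | n + 1 => (tensorμ (cubeMod k n) (cubeMod k n) (interval k) (interval k)).lin ∘ₗ
      TensorProduct.map (cubeΔ n) (deltaLin k)

variable (k) in
/-- The summand `x_{<i} ε(y_{<i}) ⊗ xᵢ ∗ yᵢ ⊗ ε(x_{>i}) y_{>i}` of the product of two cells. -/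
def joinTerm {n : ℕ} (x y : Fin n → Cell) (i : Fin n) : cubeMod k n :=
  ((∏ j with j < i, cellε (y j)) * cellJoin (x i) (y i) * ∏ j with i < j, cellε (x j) : k) •
    cell k (fun j => if j < i then x j else if j = i then none else y j)

variable (k) in
/-- The product
`x ∗ y = (-1)^|x| ∑ x_{<i} ε(y_{<i}) ⊗ xᵢ ∗ yᵢ ⊗ ε(x_{>i}) y_{>i}`. -/
def cubeJoin (n : ℕ) : cubeMod k n ⊗[k] cubeMod k n →ₗ[k] cubeMod k n :=
  TensorProduct.lift (cellLift k fun x => cellLift k fun y =>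
    sg k (cdim x) • ∑ i, joinTerm k x y i)

@[simp] theorem cubeε_cell {n : ℕ} (x : Fin n → Cell) :
    cubeε k n (cell k x) = ∏ i, cellε (x i) := cellLift_cell _ _

@[simp] theorem cubeJoin_cell {n : ℕ} (x y : Fin n → Cell) :
    cubeJoin k n (cell k x ⊗ₜ cell k y) = sg k (cdim x) • ∑ i, joinTerm k x y i := by
  simp [cubeJoin]

end DGMod

end

section

variable {k : Type u} [CommRing k]

namespace DGMod
open DGProp

variable (k) in
/-- An inductive description of the structure on the chains of cubes, used to verify the
relations. -/
def recGens : ∀ n : ℕ, Gens (endProp (cubeMod k n))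
  | 0 => (Gens.unit k).map (endUnit k)
  | n + 1 => gtens (recGens n) (intGens k)

theorem gε_int (c : Cell) : gε (intGens k) (ce k c) = cellε c :=
  (clift_ce cellε c : epsLin k (ce k c) = cellε c)

theorem gJ_int (c c' : Cell) :
    gJ (intGens k) (ce k c ⊗ₜ ce k c') = (cellJoin c c' : k) • ce k none :=
  (join_ce c c' : joinLin k (ce k c ⊗ₜ ce k c') = _)

theorem rec_ε : ∀ n : ℕ, gε (recGens k n) = cubeε k n
  | 0 => by
    apply cell_ext
    intro x
    rw [cubeε_cell, Finset.univ_eq_empty, Finset.prod_empty]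
    change (1 : k) • ((Iso.refl (unit k)).inv ≫ (Iso.refl (unit k)).hom).lin (1 : k) = 1
    rw [one_smul]; rfl
  | n + 1 => by
    apply cell_ext
    intro x
    rw [cubeε_cell, Fin.prod_univ_castSucc]
    have h := gtens_ε (recGens k n) (intGens k) (cell k (Fin.init x)) (ce k (x (Fin.last n)))
    rw [rec_ε n, cubeε_cell, gε_int] at h
    exact h

theorem rec_Δ : ∀ n : ℕ, gΔ (recGens k n) = cubeΔ k n
  | 0 => by
    change (1 : k) • ((Iso.refl (unit k)).inv ≫ (λ_ (unit k)).inv ≫ ((Iso.refl (unit k)).hom ⊗ₘ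
      (Iso.refl (unit k)).hom)).lin = (λ_ (unit k)).inv.lin
    rw [one_smul, Iso.refl_inv, Iso.refl_hom, Category.id_comp]
    exact congrArg DGMod.Hom.lin ((congrArg ((λ_ (𝟙_ (DGMod k))).inv ≫ ·)
      (id_tensorHom_id (𝟙_ (DGMod k)) (𝟙_ (DGMod k)))).trans (Category.comp_id _))
  | n + 1 => by
    refine LinearMap.ext fun x => (gtens_Δ (recGens k n) (intGens k) x).trans ?_
    rw [rec_Δ n]; rfl

theorem joinTerm_castSucc {n : ℕ} (x y : Fin (n + 1) → Cell) (i : Fin n) :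
    joinTerm k x y i.castSucc = joinTerm k (Fin.init x) (Fin.init y) i ⊗ₜ[k]
      ((cellε (x (Fin.last n)) : k) • ce k (y (Fin.last n))) := by
  have h₁ : Fin.init (fun j => if j < i.castSucc then x j else if j = i.castSucc then none else y j)
      = fun j => if j < i then Fin.init x j else if j = i then none else Fin.init y j := by
    funext j
    simp only [Fin.init, Fin.castSucc_lt_castSucc_iff, Fin.castSucc_inj]
  have h₂ : ¬ Fin.last n < i.castSucc := not_lt.2 (Fin.le_last _)
  have h₃ : Fin.last n ≠ i.castSucc := (Fin.castSucc_lt_last i).ne'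
  rw [joinTerm, joinTerm, cell, h₁, if_neg h₂, if_neg h₃, Finset.prod_filter, Finset.prod_filter,
    Finset.prod_filter, Finset.prod_filter, Fin.prod_univ_castSucc, Fin.prod_univ_castSucc,
    if_neg h₂, if_pos (Fin.castSucc_lt_last i), TensorProduct.smul_tmul_smul, mul_one]
  simp only [Fin.castSucc_lt_castSucc_iff, Fin.init, mul_assoc]
  rfl

theorem joinTerm_last {n : ℕ} (x y : Fin (n + 1) → Cell) :
    joinTerm k x y (Fin.last n) = ((∏ i, cellε (Fin.init y i) : k) • cell k (Fin.init x)) ⊗ₜ[k]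
      ((cellJoin (x (Fin.last n)) (y (Fin.last n)) : k) • ce k none) := by
  have h₁ : Fin.init (fun j => if j < Fin.last n then x j else if j = Fin.last n then none else y j)
      = Fin.init x := by
    funext j
    simp only [Fin.init, Fin.castSucc_lt_last, if_true]
  rw [joinTerm, cell, h₁, if_neg (lt_irrefl _), if_pos rfl, Finset.prod_filter, Finset.prod_filter,
    Fin.prod_univ_castSucc, Fin.prod_univ_castSucc, if_neg (lt_irrefl _), if_neg (lt_irrefl _),
    TensorProduct.smul_tmul_smul, mul_one]
  simp only [Fin.castSucc_lt_last, not_lt_of_ge (Fin.le_last _), if_true, if_false,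
    Finset.prod_const_one, mul_one, Fin.init]
  rfl

theorem cellε_prod_ne {n : ℕ} (y : Fin n → Cell) :
    (∏ i, cellε (y i) : k) = 0 ∨ cdim y = 0 := by
  by_cases h : ∃ i, y i = none
  · obtain ⟨i, hi⟩ := h
    exact Or.inl (Finset.prod_eq_zero (Finset.mem_univ i) (by rw [hi]; rfl))
  · refine Or.inr (Finset.sum_eq_zero fun i _ => ?_)
    rcases hy : y i with _ | b
    · exact (h ⟨i, hy⟩).elim
    · rfl

theorem rec_J_aux {C : DGMod k} (S T : C) (e : k) (c c' : Cell) {a b : ℤ} (h : e = 0 ∨ b = 0) :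
    sg k (c.dim * b + (a + b)) • ((e • T) ⊗ₜ[k] ((cellJoin c c' : k) • ce k none)) +
      sg k (c.dim * b) • ((sg k a • S) ⊗ₜ[k] ((cellε c : k) • ce k c')) =
    sg k (a + c.dim) • (S ⊗ₜ[k] ((cellε c : k) • ce k c') +
      (e • T) ⊗ₜ[k] ((cellJoin c c' : k) • ce k none)) := by
  rcases c with _ | c
  · rw [cellJoin_none_left, show (cellε none : k) = 0 from rfl]
    simp only [zero_smul, TensorProduct.tmul_zero, smul_zero, add_zero]
  · rw [show Cell.dim (some c) = 0 from rfl, zero_mul, zero_add, add_zero, sg_zero, one_smul,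
      smul_add, add_comm, TensorProduct.smul_tmul']
    congr 1
    rcases h with h | h
    · simp only [h, zero_smul, TensorProduct.zero_tmul, smul_zero]
    · rw [h, add_zero, TensorProduct.smul_tmul']

theorem rec_J : ∀ n : ℕ, gJ (recGens k n) = cubeJoin k n
  | 0 => by
    apply cell_ext₂
    intro x y
    rw [cubeJoin_cell, Finset.univ_eq_empty, Finset.sum_empty, smul_zero]
    exact congrArg (fun f => f.1 (cell k x ⊗ₜ cell k y))
      (map_zero ((endUnit k).map (a := .tens .X .X) (b := .X) (n := 1)))
  | n + 1 => by
    apply cell_ext₂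
    intro x y
    have hs : ∑ i : Fin n, joinTerm k x y i.castSucc =
        (∑ i, joinTerm k (Fin.init x) (Fin.init y) i) ⊗ₜ[k]
          ((cellε (x (Fin.last n)) : k) • ce k (y (Fin.last n))) :=
      (Finset.sum_congr rfl fun i _ => joinTerm_castSucc x y i).trans
        (TensorProduct.sum_tmul _ _ _).symm
    rw [cubeJoin_cell, Fin.sum_univ_castSucc, joinTerm_last, hs]
    refine (gtens_J (recGens k n) (intGens k) (cell_mem (Fin.init x))
      (ce_mem (x (Fin.last n))) (cell_mem (Fin.init y))).trans ?_
    rw [rec_ε, rec_J n, cubeJoin_cell, cubeε_cell, gJ_int, gε_int, cdim_succ x]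
    exact rec_J_aux _ _ _ _ _ (cellε_prod_ne _)

variable (k) in
/-- The structure on the chains of a cube: the generators act by the augmentation, the Serre
coproduct and the product `∗`. -/
def cubeGens (n : ℕ) : Gens (endProp (cubeMod k n)) :=
  have hε : cubeε k n = (recGens k n).cu.1 := (rec_ε n).symm
  have hΔ : cubeΔ k n = (recGens k n).cp.1 := (rec_Δ n).symm
  have hJ : cubeJoin k n = (recGens k n).pr.1 := (rec_J n).symm
  have eε : ⟨cubeε k n, hε ▸ (recGens k n).cu.2⟩ = (recGens k n).cu := Subtype.ext hε
  have eΔ : ⟨cubeΔ k n, hΔ ▸ (recGens k n).cp.2⟩ = (recGens k n).cp := Subtype.ext hΔ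
  have eJ : ⟨cubeJoin k n, hJ ▸ (recGens k n).pr.2⟩ = (recGens k n).pr := Subtype.ext hJ
  { cu := ⟨cubeε k n, hε ▸ (recGens k n).cu.2⟩
    cp := ⟨cubeΔ k n, hΔ ▸ (recGens k n).cp.2⟩
    pr := ⟨cubeJoin k n, hJ ▸ (recGens k n).pr.2⟩
    d_cu := by rw [eε]; exact (recGens k n).d_cu
    d_cp := by rw [eΔ]; exact (recGens k n).d_cp
    d_pr := by rw [eε, eJ]; exact (recGens k n).d_pr
    counit_left := by rw [eε, eΔ]; exact (recGens k n).counit_left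
    counit_right := by rw [eε, eΔ]; exact (recGens k n).counit_right
    coassoc := by rw [eΔ]; exact (recGens k n).coassoc
    cu_pr := by rw [eε, eJ]; exact (recGens k n).cu_pr }

theorem cubeGens_eq (n : ℕ) : cubeGens k n = recGens k n := by
  have hε : cubeε k n = (recGens k n).cu.1 := (rec_ε n).symm
  have hΔ : cubeΔ k n = (recGens k n).cp.1 := (rec_Δ n).symm
  have hJ : cubeJoin k n = (recGens k n).pr.1 := (rec_J n).symm
  have eε : (cubeGens k n).cu = (recGens k n).cu := Subtype.ext hε
  have eΔ : (cubeGens k n).cp = (recGens k n).cp := Subtype.ext hΔ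
  have eJ : (cubeGens k n).pr = (recGens k n).pr := Subtype.ext hJ
  revert eε eΔ eJ
  cases cubeGens k n
  cases recGens k n
  rintro rfl rfl rfl
  rfl

end DGMod

namespace Coalg
open DGProp DGMod

/-- The coalgebra underlying a structure on a differential graded module. -/
def ofGens {C : DGMod k} (G : Gens (endProp C)) : Coalg (M k) := ⟨C, .ofProp (M.lift G)⟩

variable (k) in
/-- The coalgebra of chains of the cube `2 ^ n`. -/
def cube (n : ℕ) : Coalg (M k) := ofGens (cubeGens k n)

end Coalg

end

section

variable {k : Type u} [CommRing k]

namespace DGMod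
open DGProp

section
variable {E E' A A' B B' : DGMod k} {n : ℤ} (p : E ⟶ E') (q : B ⟶ B') (r : A ⟶ A')
  (x : homDeg A B n) (y : homDeg A' B' n)

theorem whl_nat (h : q.lin ∘ₗ x.1 = y.1 ∘ₗ r.lin) :
    TensorProduct.map p.lin q.lin ∘ₗ (whl E x).1 = (whl E' y).1 ∘ₗ TensorProduct.map p.lin r.lin := by
  rw [whl_apply, whl_apply, ← TensorProduct.map_comp, ← TensorProduct.map_comp, h, sgn_hom]

theorem whr_nat (h : q.lin ∘ₗ x.1 = y.1 ∘ₗ r.lin) :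
    TensorProduct.map q.lin p.lin ∘ₗ (whr E x).1 = (whr E' y).1 ∘ₗ TensorProduct.map r.lin p.lin := by
  rw [whr_apply, whr_apply, ← TensorProduct.map_comp, ← TensorProduct.map_comp, h,
    LinearMap.comp_id, LinearMap.id_comp]

theorem dHom_nat {m : ℤ} (hm : m + 1 = n) (h : q.lin ∘ₗ x.1 = y.1 ∘ₗ r.lin) :
    q.lin ∘ₗ (dHom A B hm x).1 = (dHom A' B' hm y).1 ∘ₗ r.lin := by
  have h' : ∀ z, q.lin (x.1 z) = y.1 (r.lin z) := LinearMap.congr_fun h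
  apply LinearMap.ext
  intro z
  change q.lin (B.d (x.1 z) - sg k n • x.1 (A.d z)) =
    B'.d (y.1 (r.lin z)) - sg k n • y.1 (A'.d (r.lin z))
  rw [map_sub, map_smul, q.comm, h', h', r.comm]

end

section
variable {C D : DGMod k} {G : Gens (endProp C)} {H : Gens (endProp D)} (f : C ⟶ D)

theorem eval_nat (hε : gε H ∘ₗ f.lin = gε G)
    (hΔ : gΔ H ∘ₗ f.lin = TensorProduct.map f.lin f.lin ∘ₗ gΔ G)
    (hJ : gJ H ∘ₗ TensorProduct.map f.lin f.lin = f.lin ∘ₗ gJ G) {a b : Word} {n : ℤ}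
    (e : Expr k a b n) :
    (b.powMap f).lin ∘ₗ (e.eval G).1 = (e.eval H).1 ∘ₗ (a.powMap f).lin := by
  induction e with
  | zero a b n =>
    change (b.powMap f).lin ∘ₗ 0 = 0 ∘ₗ (a.powMap f).lin
    rw [LinearMap.comp_zero, LinearMap.zero_comp]
  | @add a b n x y hx hy =>
    change (b.powMap f).lin ∘ₗ ((x.eval G).1 + (y.eval G).1) =
      ((x.eval H).1 + (y.eval H).1) ∘ₗ (a.powMap f).lin
    rw [LinearMap.comp_add, LinearMap.add_comp, hx, hy]
  | @smul a b n r x hx =>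
    change (b.powMap f).lin ∘ₗ (r • (x.eval G).1) = (r • (x.eval H).1) ∘ₗ (a.powMap f).lin
    rw [LinearMap.comp_smul, LinearMap.smul_comp, hx]
  | @comp a b c i j n h x y hx hy =>
    change (c.powMap f).lin ∘ₗ ((x.eval G).1 ∘ₗ (y.eval G).1) =
      ((x.eval H).1 ∘ₗ (y.eval H).1) ∘ₗ (a.powMap f).lin
    rw [LinearMap.comp_assoc, ← hy, ← LinearMap.comp_assoc, ← LinearMap.comp_assoc, hx]
  | @wl c a b n x hx =>
    exact whl_nat (c.powMap f) (b.powMap f) (a.powMap f) (x.eval G) (x.eval H) hx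
  | @wr a b c n x hx =>
    exact whr_nat (a.powMap f) (c.powMap f) (b.powMap f) (x.eval G) (x.eval H) hx
  | @d a b n m h x hx => exact dHom_nat (b.powMap f) (a.powMap f) (x.eval G) (x.eval H) h hx
  | str s => exact congrArg Hom.lin (Str.map_natural f s)
  | cu => exact (hε.symm : LinearMap.id ∘ₗ gε G = gε H ∘ₗ f.lin)
  | cp => exact hΔ.symm
  | pr => exact hJ.symm

end

end DGMod

namespace Coalg
open DGProp DGMod

/-- Morphisms between coalgebras given by generators. -/
def ofGensHom {C D : DGMod k} {G : Gens (endProp C)} {H : Gens (endProp D)} (f : C ⟶ D)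
    (hε : gε H ∘ₗ f.lin = gε G) (hΔ : gΔ H ∘ₗ f.lin = TensorProduct.map f.lin f.lin ∘ₗ gΔ G)
    (hJ : gJ H ∘ₗ TensorProduct.map f.lin f.lin = f.lin ∘ₗ gJ G) : ofGens G ⟶ ofGens H where
  hom := f
  comm {b n} x := by
    induction x using Quotient.inductionOn with
    | h e => exact LinearMap.congr_fun (eval_nat f hε hΔ hJ e)

theorem ofGens_tens {C D : DGMod k} (G : Gens (endProp C)) (H : Gens (endProp D)) {a b : Word}
    {n : ℤ} (x : (M k).Hom a b n) : (M.lift (gtens G H)).map x =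
      (endTens C D).map ((((M.lift G).prodMap (M.lift H))).map ((M.hopf k).Δ.map x)) := by
  refine M.hom_eq (M.lift (gtens G H))
    (((M.hopf k).Δ.trans ((M.lift G).prodMap (M.lift H))).trans (endTens C D)) ?_ ?_ ?_ x
  · rw [PropHom.trans_map, PropHom.trans_map, PropHom.prodMap_map, M.hopf, M.lift_cu, M.lift_cu,
      Gens.prod_cu, PropHom.prodLin_pure, M.lift_cu, M.lift_cu]
    rfl
  · rw [PropHom.trans_map, PropHom.trans_map, PropHom.prodMap_map, M.hopf, M.lift_cp, M.lift_cp,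
      Gens.prod_cp, PropHom.prodLin_pure, M.lift_cp, M.lift_cp]
    rfl
  · rw [PropHom.trans_map, PropHom.trans_map, PropHom.prodMap_map, M.hopf, M.lift_pr, M.lift_pr,
      Gens.prod_pr, map_add, PropHom.prodLin_pure, PropHom.prodLin_pure, M.lift_pr, M.lift_pr,
      M.lift_cr, M.lift_cl]
    rfl

/-- Coalgebras with the same underlying module and the same operations. -/
def isoRefl {P : DGProp k} {C : DGMod k} {φ ψ : OpHom P C.endProp}
    (h : ∀ {b : Word} {n : ℤ} (x : P.Hom .X b n), φ.map x = ψ.map x) :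
    (⟨C, φ⟩ : Coalg P) ≅ ⟨C, ψ⟩ :=
  isoMk (Iso.refl C) fun {b n} x => by
    rw [Iso.refl_hom, Word.powMap_id]
    exact congrArg Subtype.val (h x)

/-- The coalgebra of a tensor product of structures is the tensor product of the coalgebras. -/
def ofGensTens {C D : DGMod k} (G : Gens (endProp C)) (H : Gens (endProp D)) :
    ofGens (gtens G H) ≅ ofGens G ⊗ ofGens H :=
  isoRefl fun x => ofGens_tens G H x

theorem ofGens_unit {a b : Word} {n : ℤ} (x : (M k).Hom a b n) :
    (M.lift ((Gens.unit k).map (endUnit k))).map x = (endUnit k).map ((M.hopf k).ε.map x) :=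
  M.hom_eq (M.lift ((Gens.unit k).map (endUnit k))) ((M.hopf k).ε.trans (endUnit k)) rfl rfl rfl x

variable (k) in
/-- The chains of the point are the unit. -/
def cubeZero : cube k 0 ≅ 𝟙_ (Coalg (M k)) :=
  isoRefl fun x => (congrArg (fun G => (M.lift G).map x) (cubeGens_eq 0)).trans (ofGens_unit x)

variable (k) in
/-- The chains of a cube as a tensor product. -/
def cubeSucc (n : ℕ) : cube k (n + 1) ≅ cube k n ⊗ ofGens (intGens k) :=
  isoRefl fun x => (congrArg (fun G => (M.lift G).map x) ((cubeGens_eq (n + 1)).trans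
    (congrArg (gtens · (intGens k)) (cubeGens_eq n).symm))).trans
      (ofGens_tens (cubeGens k n) (intGens k) x)

variable (k) in
/-- The isomorphism between the tensor product of the chains of two cubes and the chains of their
product. -/
def cubeMul (m : ℕ) : ∀ n : ℕ, cube k m ⊗ cube k n ≅ cube k (m + n)
  | 0 => whiskerLeftIso (cube k m) (cubeZero k) ≪≫ ρ_ (cube k m)
  | n + 1 => whiskerLeftIso (cube k m) (cubeSucc k n) ≪≫ (α_ _ _ _).symm ≪≫
      whiskerRightIso (cubeMul m n) (ofGens (intGens k)) ≪≫ (cubeSucc k (m + n)).symm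

theorem append_init {m n : ℕ} (x : Fin m → Cell) (y : Fin (n + 1) → Cell) :
    Fin.init (n := m + n) (Fin.append (n := n + 1) x y) =
      Fin.append x (Fin.init y) := by
  funext i
  refine Fin.addCases (fun i => ?_) (fun i => ?_) i
  · rw [Fin.append_left]; exact Fin.append_left x y i
  · rw [Fin.append_right]; exact Fin.append_right x y i.castSucc

theorem cubeMul_cell {m : ℕ} (x : Fin m → Cell) : ∀ {n : ℕ} (y : Fin n → Cell),
    (cubeMul k m n).hom.hom.lin (cell k x ⊗ₜ cell k y) = cell k (Fin.append x y)
  | 0, y => by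
    refine (one_smul k (cell k x)).trans (congrArg (cell k) ?_)
    funext i
    exact (Fin.append_left x y i).symm
  | n + 1, y => by
    have h := congrArg (fun v : cubeMod k (m + n) => (v ⊗ₜ[k] ce k (y (Fin.last n)) :
      cubeMod k (m + n) ⊗[k] (Cell →₀ k))) (cubeMul_cell x (Fin.init y))
    refine Eq.trans ?_ (h.trans ?_)
    · rfl
    · rw [← append_init]
      exact congrArg (fun c => cell k (Fin.init (n := m + n) (Fin.append (n := n + 1) x y)) ⊗ₜ[k] ce k c)
        (Fin.append_right (m := m) (n := n + 1) x y (Fin.last n)).symm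

end Coalg

end

section

variable {k : Type u} [CommRing k]

section faces

/-- The vertices of a cell. -/
def face {n : ℕ} (x : Fin n → Cell) : Set (Fin n → Bool) := {v | ∀ i b, x i = some b → v i = b}

instance {n : ℕ} (x : Fin n → Cell) (v : Fin n → Bool) : Decidable (v ∈ face x) :=
  inferInstanceAs (Decidable (∀ i b, x i = some b → v i = b))

theorem face_nonempty {n : ℕ} (x : Fin n → Cell) : (face x).Nonempty :=
  ⟨fun i => (x i).getD false, fun i b h => by simp [h]⟩

theorem face_inj {n : ℕ} {x y : Fin n → Cell} (h : face x = face y) : x = y := by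
  have key : ∀ {x y : Fin n → Cell}, face x = face y → ∀ i b, x i = some b → y i = some b := by
    intro x y h i b hb
    rcases hy : y i with _ | b'
    · have h₁ : (fun j => if j = i then !b else (y j).getD false) ∈ face y := by
        intro j c hc
        by_cases hj : j = i
        · subst hj; rw [hy] at hc; cases hc
        · simp [hj, hc]
      rw [← h] at h₁
      have := h₁ i b hb
      simp at this
    · obtain ⟨v, hv⟩ := face_nonempty y
      have h₁ := hv i b' hy
      rw [← h] at hv
      rw [← h₁, hv i b hb]
  funext i
  rcases hx : x i with _ | b
  · rcases hy : y i with _ | b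
    · rfl
    · rw [key h.symm i b hy] at hx; cases hx
  · exact (key h i b hx).symm

theorem mem_face_append {m n : ℕ} {x : Fin m → Cell} {y : Fin n → Cell} {v : Fin (m + n) → Bool} :
    v ∈ face (Fin.append x y) ↔
      (fun i => v (Fin.castAdd n i)) ∈ face x ∧ (fun i => v (Fin.natAdd m i)) ∈ face y := by
  constructor
  · intro h
    exact ⟨fun i b hb => h _ b (by rw [Fin.append_left, hb]),
      fun i b hb => h _ b (by rw [Fin.append_right, hb])⟩
  · rintro ⟨h₁, h₂⟩ i
    refine Fin.addCases (fun i b hb => ?_) (fun i b hb => ?_) i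
    · rw [Fin.append_left] at hb; exact h₁ i b hb
    · rw [Fin.append_right] at hb; exact h₂ i b hb

theorem append_mem_face {m n : ℕ} {x : Fin m → Cell} {y : Fin n → Cell} {v : Fin m → Bool}
    {w : Fin n → Bool} (hv : v ∈ face x) (hw : w ∈ face y) :
    Fin.append v w ∈ face (Fin.append x y) := by
  rw [mem_face_append]
  simp only [Fin.append_left, Fin.append_right]
  exact ⟨hv, hw⟩

theorem append_split {α : Type*} {m n : ℕ} (x : Fin (m + n) → α) :
    Fin.append (fun i => x (Fin.castAdd n i)) (fun i => x (Fin.natAdd m i)) = x := by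
  funext i
  refine Fin.addCases (fun i => ?_) (fun i => ?_) i
  · rw [Fin.append_left]
  · rw [Fin.append_right]

theorem append_inj {α : Type*} {m n : ℕ} {x x' : Fin m → α} {y y' : Fin n → α}
    (h : Fin.append x y = Fin.append x' y') : x = x' ∧ y = y' := by
  constructor
  · funext i
    have := congrFun h (Fin.castAdd n i)
    rwa [Fin.append_left, Fin.append_left] at this
  · funext i
    have := congrFun h (Fin.natAdd m i)
    rwa [Fin.append_right, Fin.append_right] at this

/-- Maps sending cells onto cells. -/
def Onto {m n : ℕ} (f : (Fin m → Bool) → (Fin n → Bool)) : Prop :=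
  ∀ x, ∃ y, f '' face x = face y

theorem onto_prod {m n m' n' : ℕ} {f : (Fin m → Bool) → (Fin n → Bool)}
    {g : (Fin m' → Bool) → (Fin n' → Bool)} {x : Fin m → Cell} {x' : Fin m' → Cell}
    {y : Fin n → Cell} {y' : Fin n' → Cell} (hf : f '' face x = face y)
    (hg : g '' face x' = face y') :
    cubeProd f g '' face (Fin.append x x') = face (Fin.append y y') := by
  ext w
  rw [mem_face_append, ← hf, ← hg]
  constructor
  · rintro ⟨v, hv, rfl⟩
    rw [mem_face_append] at hv
    simp only [cubeProd, Fin.append_left, Fin.append_right]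
    exact ⟨⟨_, hv.1, rfl⟩, ⟨_, hv.2, rfl⟩⟩
  · rintro ⟨⟨v, hv, h⟩, ⟨v', hv', h'⟩⟩
    refine ⟨Fin.append v v', append_mem_face hv hv', ?_⟩
    simp only [cubeProd, Fin.append_left, Fin.append_right]
    exact (congrArg₂ Fin.append h h').trans (append_split w)

theorem injOn_prod {m n m' n' : ℕ} {f : (Fin m → Bool) → (Fin n → Bool)}
    {g : (Fin m' → Bool) → (Fin n' → Bool)} {x : Fin m → Cell} {x' : Fin m' → Cell} :
    Set.InjOn (cubeProd f g) (face (Fin.append x x')) ↔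
      Set.InjOn f (face x) ∧ Set.InjOn g (face x') := by
  constructor
  · intro h
    obtain ⟨v₀, hv₀⟩ := face_nonempty x
    obtain ⟨v₀', hv₀'⟩ := face_nonempty x'
    constructor
    · intro v hv w hw hvw
      refine (append_inj (h (append_mem_face hv hv₀') (append_mem_face hw hv₀') ?_)).1
      simp only [cubeProd, Fin.append_left, Fin.append_right]
      exact congrArg (Fin.append · _) hvw
    · intro v hv w hw hvw
      refine (append_inj (h (append_mem_face hv₀ hv) (append_mem_face hv₀ hw) ?_)).2
      simp only [cubeProd, Fin.append_left, Fin.append_right]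
      exact congrArg (Fin.append _) hvw
  · rintro ⟨h, h'⟩ v hv w hw hvw
    rw [mem_face_append] at hv hw
    obtain ⟨h₁, h₂⟩ := append_inj hvw
    rw [← append_split v, ← append_split w]
    exact congrArg₂ Fin.append (h hv.1 hw.1 h₁) (h' hv.2 hw.2 h₂)

theorem onto_of_subsingleton {n : ℕ} (f : (Fin 0 → Bool) → (Fin n → Bool)) : Onto f := by
  intro x
  refine ⟨fun i => some (f finZeroElim i), ?_⟩
  ext w
  constructor
  · rintro ⟨v, -, rfl⟩ i b h
    rw [Subsingleton.elim v finZeroElim]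
    exact Option.some.inj h
  · intro h
    exact ⟨finZeroElim, fun i => i.elim0, funext fun i => (h i _ rfl).symm⟩

theorem IsCubeMap.onto {m n : ℕ} {f : (Fin m → Bool) → (Fin n → Bool)} (hf : IsCubeMap f) :
    Onto f := by
  induction hf with
  | id n => exact fun x => ⟨x, Set.image_id _⟩
  | comp _ _ hg hf =>
    intro x
    obtain ⟨y, hy⟩ := hf x
    obtain ⟨z, hz⟩ := hg y
    exact ⟨z, by rw [← hz, ← hy, Set.image_image]⟩
  | prod _ _ hf hg =>
    intro x
    obtain ⟨y, hy⟩ := hf fun i => x (Fin.castAdd _ i)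
    obtain ⟨y', hy'⟩ := hg fun i => x (Fin.natAdd _ i)
    exact ⟨_, by rw [← onto_prod hy hy', append_split]⟩
  | face e => exact onto_of_subsingleton _
  | deg =>
    intro x
    refine ⟨finZeroElim, Set.eq_of_subset_of_subset (fun w _ i => i.elim0) fun w _ => ?_⟩
    obtain ⟨v, hv⟩ := face_nonempty x
    exact ⟨v, hv, Subsingleton.elim _ _⟩
  | conn =>
    intro x
    have key : ∀ a b : Cell, ∃ c : Cell, ∀ w : Bool,
        (∃ p q : Bool, (∀ e, a = some e → p = e) ∧ (∀ e, b = some e → q = e) ∧ (p || q) = w) ↔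
          ∀ e, c = some e → w = e := by decide
    obtain ⟨c, hc⟩ := key (x 0) (x 1)
    refine ⟨fun _ => c, ?_⟩
    ext w
    refine Iff.trans ?_ ((hc (w 0)).trans ?_)
    · constructor
      · rintro ⟨v, hv, rfl⟩
        exact ⟨v 0, v 1, hv 0, hv 1, rfl⟩
      · rintro ⟨p, q, hp, hq, h⟩
        refine ⟨![p, q], fun i b hb => ?_, funext fun i => ?_⟩
        · fin_cases i
          · exact hp b hb
          · exact hq b hb
        · fin_cases i; exact h
    · constructor
      · intro h i b hb
        fin_cases i; exact h b hb
      · exact fun h => h 0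

end faces

namespace DGMod

open Classical in
variable (k) in
/-- The action of a map between cubes on chains: a cell goes to the cell it is mapped onto
bijectively, and to `0` if there is no such cell. -/
def cubeMapLin {m n : ℕ} (f : (Fin m → Bool) → (Fin n → Bool)) : cubeMod k m →ₗ[k] cubeMod k n :=
  cellLift k fun x => ∑ y, if Set.BijOn f (face x) (face y) then cell k y else 0

section cubeMapLin
variable {m n l : ℕ} {f : (Fin m → Bool) → (Fin n → Bool)}

theorem cubeMapLin_bij {x : Fin m → Cell} {y : Fin n → Cell} (h : Set.BijOn f (face x) (face y)) :
    cubeMapLin k f (cell k x) = cell k y := by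
  classical
  rw [cubeMapLin, cellLift_cell, Finset.sum_eq_single y, if_pos h]
  · intro z _ hz
    rw [if_neg]
    intro h'
    exact hz (face_inj (h'.image_eq.symm.trans h.image_eq))
  · intro h; exact (h (Finset.mem_univ _)).elim

theorem cubeMapLin_not {x : Fin m → Cell} (h : ¬ Set.InjOn f (face x)) :
    cubeMapLin k f (cell k x) = 0 := by
  classical
  rw [cubeMapLin, cellLift_cell]
  exact Finset.sum_eq_zero fun y _ => if_neg fun h' => h h'.injOn

theorem cubeMapLin_id : cubeMapLin k (fun x : Fin n → Bool => x) = LinearMap.id :=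
  cell_ext fun _ => cubeMapLin_bij (Set.bijOn_id _)

theorem cubeMapLin_comp {g : (Fin n → Bool) → (Fin l → Bool)} (hf : Onto f) (hg : Onto g) :
    cubeMapLin k (fun x => g (f x)) = cubeMapLin k g ∘ₗ cubeMapLin k f := by
  apply cell_ext
  intro x
  rw [LinearMap.comp_apply]
  obtain ⟨y, hy⟩ := hf x
  obtain ⟨z, hz⟩ := hg y
  by_cases h : Set.InjOn f (face x)
  · have hb : Set.BijOn f (face x) (face y) := hy ▸ h.bijOn_image
    rw [cubeMapLin_bij hb]
    by_cases h' : Set.InjOn g (face y)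
    · have hb' : Set.BijOn g (face y) (face z) := hz ▸ h'.bijOn_image
      rw [cubeMapLin_bij hb']; exact cubeMapLin_bij (hb'.comp hb)
    · rw [cubeMapLin_not h', cubeMapLin_not]
      intro h''
      refine h' ?_
      rw [← hy]
      exact Set.InjOn.image_of_comp h''
  · rw [cubeMapLin_not h, map_zero, cubeMapLin_not]
    intro h'
    exact h fun v hv w hw hvw => h' hv hw (congrArg g hvw)

theorem cubeMapLin_prod {m' n' : ℕ} {g : (Fin m' → Bool) → (Fin n' → Bool)} (hf : Onto f)
    (hg : Onto g) (x : Fin m → Cell) (x' : Fin m' → Cell) :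
    cubeMapLin k (cubeProd f g) (cell k (Fin.append x x')) =
      (Coalg.cubeMul k n n').hom.hom.lin
        (cubeMapLin k f (cell k x) ⊗ₜ[k] cubeMapLin k g (cell k x')) := by
  obtain ⟨y, hy⟩ := hf x
  obtain ⟨y', hy'⟩ := hg x'
  by_cases h : Set.InjOn f (face x)
  · by_cases h' : Set.InjOn g (face x')
    · rw [cubeMapLin_bij (hy ▸ h.bijOn_image : Set.BijOn f (face x) (face y)),
        cubeMapLin_bij (hy' ▸ h'.bijOn_image : Set.BijOn g (face x') (face y'))]
      refine Eq.trans ?_ (Coalg.cubeMul_cell y y').symm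
      exact cubeMapLin_bij (onto_prod hy hy' ▸ (injOn_prod.2 ⟨h, h'⟩).bijOn_image)
    · rw [cubeMapLin_not h', cubeMapLin_not fun e => h' (injOn_prod.1 e).2]
      exact ((congrArg _ (TensorProduct.tmul_zero _ _)).trans (map_zero _)).symm
  · rw [cubeMapLin_not h, cubeMapLin_not fun e => h (injOn_prod.1 e).1]
    exact ((congrArg _ (TensorProduct.zero_tmul _ _)).trans (map_zero _)).symm

end cubeMapLin

end DGMod

end

section

variable {k : Type u} [CommRing k]

namespace DGMod
open DGProp

section generators

theorem interval_sgn_ce (m : ℤ) (c : Cell) : (interval k).sgn m (ce k c) = sg k (m * c.dim) • ce k c :=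
  sgn_apply (C := interval k) m (ce_mem c)

variable (k) in
/-- The inclusion of an endpoint of the interval. -/
def faceHom (e : Bool) : unit k ⟶ interval k where
  lin := LinearMap.toSpanSingleton k _ (ce k (some e))
  deg {n x} hx := by
    by_cases hn : n = 0
    · subst hn; exact Submodule.smul_mem _ _ (ce_mem (some e))
    · rw [unit_gr hn hx, map_zero]; exact Submodule.zero_mem _
  comm x := by
    change (0 : k) • ce k (some e) = cd k (x • ce k (some e))
    rw [map_smul, cd_some, smul_zero, zero_smul]

variable (k) in
/-- The projection of the interval to the point. -/
def degHom : interval k ⟶ unit k where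
  lin := epsLin k
  deg {n x} hx := by
    have := interval_deg cellε_mem n x hx
    rwa [zero_add] at this
  comm x := by
    change (epsLin k ∘ₗ cd k) x = 0
    refine LinearMap.congr_fun (cext (f := epsLin k ∘ₗ cd k) (g := 0) ?_) x
    rintro (_ | b)
    · rw [LinearMap.comp_apply, cd_none, map_sub, eps_some, eps_some, sub_self]; rfl
    · rw [LinearMap.comp_apply, cd_some, map_zero]; rfl

/-- The value of the connection on a product of two cells. -/
def cellConn : Cell → Cell → (Cell →₀ k)
  | some false, c => ce k c
  | none, some false => ce k none
  | none, _ => 0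
  | some true, some _ => ce k (some true)
  | some true, none => 0

variable (k) in
/-- The map induced by the connection. -/
def connLin : (Cell →₀ k) ⊗[k] (Cell →₀ k) →ₗ[k] (Cell →₀ k) :=
  TensorProduct.lift (clift fun c => clift fun c' => cellConn c c')

theorem conn_ce (c c' : Cell) : connLin k (ce k c ⊗ₜ ce k c') = cellConn c c' := by
  simp [connLin]

theorem conn_mem (c c' : Cell) :
    connLin k (ce k c ⊗ₜ ce k c') ∈ (interval k).gr (0 + (c.dim + c'.dim)) := by
  rw [conn_ce]
  rcases c with _ | _ | _ <;> rcases c' with _ | _ | _ <;>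
    first
    | exact ce_mem (some false)
    | exact ce_mem (some true)
    | exact ce_mem none
    | exact Submodule.zero_mem _

variable (k) in
/-- The map induced by the connection. -/
def connHom : tens (interval k) (interval k) ⟶ interval k where
  lin := connLin k
  deg {n x} hx := by
    have := interval_deg₂ conn_mem n x hx
    rwa [zero_add] at this
  comm x := by
    refine (LinearMap.congr_fun (cext₂ (f := cd k ∘ₗ connLin k)
      (g := connLin k ∘ₗ (tens (interval k) (interval k)).d) ?_) x).symm
    intro c c'
    rw [LinearMap.comp_apply, LinearMap.comp_apply, tens_d_ce, conn_ce]
    rcases c with _ | _ | _ <;> rcases c' with _ | _ | _ <;>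
      simp [cellConn, cd_none, cd_some, Cell.dim, TensorProduct.sub_tmul, TensorProduct.tmul_sub,
        conn_ce]

variable (k) in
/-- The exchange of the two middle factors. -/
def swapLin : ((Cell →₀ k) ⊗[k] (Cell →₀ k)) ⊗[k] ((Cell →₀ k) ⊗[k] (Cell →₀ k)) →ₗ[k]
    ((Cell →₀ k) ⊗[k] (Cell →₀ k)) ⊗[k] ((Cell →₀ k) ⊗[k] (Cell →₀ k)) :=
  (tensorμ (interval k) (interval k) (interval k) (interval k)).lin

theorem swap_ce (c₁ c₂ c₃ c₄ : Cell) :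
    swapLin k ((ce k c₁ ⊗ₜ ce k c₂) ⊗ₜ (ce k c₃ ⊗ₜ ce k c₄)) =
      sg k (c₂.dim * c₃.dim) • ((ce k c₁ ⊗ₜ[k] ce k c₃) ⊗ₜ[k] (ce k c₂ ⊗ₜ[k] ce k c₄)) :=
  tensorμ_tmul (A := interval k) (B := interval k) (C := interval k) (D := interval k) _ _
    (ce_mem c₂) (ce_mem c₃)

theorem conn_ε (c c' : Cell) : epsLin k (connLin k (ce k c ⊗ₜ ce k c')) = cellε c * cellε c' := by
  rw [conn_ce]
  rcases c with _ | _ | _ <;> rcases c' with _ | _ | _ <;>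
    simp [cellConn, cellε, eps_none, eps_some]

theorem conn_Δ (c c' : Cell) : deltaLin k (connLin k (ce k c ⊗ₜ ce k c')) =
    TensorProduct.map (connLin k) (connLin k)
      (swapLin k (TensorProduct.map (deltaLin k) (deltaLin k) (ce k c ⊗ₜ ce k c'))) := by
  rw [conn_ce, TensorProduct.map_tmul, delta_ce, delta_ce]
  rcases c with _ | _ | _ <;> rcases c' with _ | _ | _ <;>
    simp [cellConn, cellΔ, delta_ce, TensorProduct.add_tmul, TensorProduct.tmul_add, swap_ce,
      conn_ce, Cell.dim]

theorem conn_J (c₁ c₂ c₃ c₄ : Cell) :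
    joinLin k (connLin k (ce k c₁ ⊗ₜ ce k c₂) ⊗ₜ connLin k (ce k c₃ ⊗ₜ ce k c₄)) =
      connLin k (sg k (c₂.dim * c₃.dim + (c₁.dim + c₃.dim)) •
          (((cellε c₃ : k) • ce k c₁) ⊗ₜ[k] ((cellJoin c₂ c₄ : k) • ce k none)) +
        sg k (c₂.dim * c₃.dim) •
          (((cellJoin c₁ c₃ : k) • ce k none) ⊗ₜ[k] ((cellε c₂ : k) • ce k c₄))) := by
  rw [conn_ce, conn_ce, map_add, map_smul, map_smul, TensorProduct.smul_tmul_smul,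
    TensorProduct.smul_tmul_smul, map_smul, map_smul, conn_ce, conn_ce]
  rcases c₁ with _ | _ | _ <;> rcases c₂ with _ | _ | _ <;> rcases c₃ with _ | _ | _ <;>
    rcases c₄ with _ | _ | _ <;>
    simp [cellConn, cellJoin, cellε, join_ce, Cell.dim]

end generators
end DGMod

namespace Coalg
open DGProp DGMod

variable (k) in
/-- The structure on the unit. -/
abbrev ptGens : Gens (endProp (DGMod.unit k)) := (Gens.unit k).map (endUnit k)

theorem pt_ε : gε (ptGens k) = LinearMap.id := by
  change (1 : k) • ((Iso.refl (DGMod.unit k)).inv ≫ (Iso.refl (DGMod.unit k)).hom).lin = _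
  rw [one_smul]; rfl

theorem pt_Δ : gΔ (ptGens k) = (λ_ (DGMod.unit k)).inv.lin := rec_Δ 0

theorem pt_J : gJ (ptGens k) = 0 :=
  congrArg Subtype.val (map_zero ((endUnit k).map (a := .tens .X .X) (b := .X) (n := 1)))

variable (k) in
/-- The inclusion of an endpoint of the interval. -/
def faceCoalg (e : Bool) : ofGens (ptGens k) ⟶ ofGens (intGens k) :=
  ofGensHom (faceHom k e)
    (by
      rw [pt_ε]
      apply LinearMap.ext_ring
      change epsLin k ((1 : k) • ce k (some e)) = 1
      rw [one_smul, eps_some])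
    (by
      rw [pt_Δ]
      apply LinearMap.ext_ring
      change deltaLin k ((1 : k) • ce k (some e)) =
        ((1 : k) • ce k (some e)) ⊗ₜ[k] ((1 : k) • ce k (some e))
      rw [one_smul, delta_ce]; rfl)
    (by
      rw [pt_J, LinearMap.comp_zero]
      apply TensorProduct.ext'
      intro x y
      change joinLin k ((x • ce k (some e)) ⊗ₜ[k] (y • ce k (some e))) = 0
      rw [TensorProduct.smul_tmul_smul, map_smul, join_ce]
      cases e <;> simp [cellJoin])

variable (k) in
/-- The projection of the interval to the point. -/
def degCoalg : ofGens (intGens k) ⟶ ofGens (ptGens k) :=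
  ofGensHom (degHom k)
    (by rw [pt_ε, LinearMap.id_comp]; rfl)
    (by
      rw [pt_Δ]
      apply cext
      intro c
      change (1 : k) ⊗ₜ[k] epsLin k (ce k c) =
        TensorProduct.map (epsLin k) (epsLin k) (deltaLin k (ce k c))
      rw [delta_ce]
      rcases c with _ | _ | _ <;> simp [cellΔ, eps_none, eps_some])
    (by
      rw [pt_J, LinearMap.zero_comp]
      apply cext₂
      intro c c'
      change 0 = epsLin k (joinLin k (ce k c ⊗ₜ ce k c'))
      rw [join_ce, map_smul, eps_none, smul_zero])

variable (k) in
/-- The connection. -/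
def connCoalg : ofGens (gtens (intGens k) (intGens k)) ⟶ ofGens (intGens k) :=
  ofGensHom (connHom k)
    (cext₂ fun c c' => (conn_ε c c').trans
      ((gtens_ε (intGens k) (intGens k) (ce k c) (ce k c')).trans
        (congrArg₂ (· * ·) (gε_int c) (gε_int c'))).symm)
    (cext₂ fun c c' => (conn_Δ c c').trans
      (congrArg (TensorProduct.map (connLin k) (connLin k))
        (gtens_Δ (intGens k) (intGens k) (ce k c ⊗ₜ ce k c'))).symm)
    (TensorProduct.ext <| cext₂ fun c₁ c₂ => cext₂ fun c₃ c₄ => by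
      have h := gtens_J (intGens k) (intGens k) (t' := ce k c₄) (ce_mem c₁) (ce_mem c₂) (ce_mem c₃)
      rw [gε_int, gε_int, gJ_int, gJ_int] at h
      exact (conn_J c₁ c₂ c₃ c₄).trans (congrArg (connLin k) h).symm)

end Coalg

end

section

variable {k : Type u} [CommRing k]

namespace Coalg
open DGProp DGMod

theorem inv_lin {C D : Coalg (M k)} (e : C ≅ D) {x : C.toMod} {y : D.toMod}
    (h : e.hom.hom.lin x = y) : e.inv.hom.lin y = x := by
  rw [← h]
  exact LinearMap.congr_fun (congrArg (fun f => f.hom.lin) e.hom_inv_id) x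

theorem comp_lin {C D E : Coalg (M k)} (f : C ⟶ D) (g : D ⟶ E) (x : C.toMod) :
    (f ≫ g).hom.lin x = g.hom.lin (f.hom.lin x) := rfl

variable (k) in
/-- The chains of the cube `2 ^ 1` are the chains of the interval. -/
def cubeOne : cube k 1 ≅ ofGens (intGens k) :=
  cubeSucc k 0 ≪≫ whiskerRightIso (cubeZero k) (ofGens (intGens k)) ≪≫ λ_ _

theorem cubeOne_cell (x : Fin 1 → Cell) : (cubeOne k).hom.hom.lin (cell k x) = ce k (x 0) :=
  one_smul k (ce k (x 0))

theorem cubeOne_inv (c : Cell) : (cubeOne k).inv.hom.lin (ce k c) = cell k fun _ : Fin 1 => c :=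
  inv_lin (cubeOne k) (cubeOne_cell _)

theorem cubeMul_inv {m n : ℕ} (x : Fin m → Cell) (y : Fin n → Cell) :
    (cubeMul k m n).inv.hom.lin (cell k (Fin.append x y)) = cell k x ⊗ₜ[k] cell k y :=
  inv_lin (cubeMul k m n) (cubeMul_cell x y)

variable (k) in
/-- The chains of the point through generators. -/
def cubePt : cube k 0 ≅ ofGens (ptGens k) :=
  isoRefl fun x => congrArg (fun G => (M.lift G).map x) (cubeGens_eq 0)

variable (k) in
/-- Linear maps underlying morphisms of coalgebras. -/
def IsMap {m n : ℕ} (f : cubeMod k m →ₗ[k] cubeMod k n) : Prop :=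
  ∃ φ : cube k m ⟶ cube k n, φ.hom.lin = f

theorem isMap_face (e : Bool) :
    IsMap k (cubeMapLin k fun (_ : Fin 0 → Bool) (_ : Fin 1) => e) := by
  refine ⟨(cubePt k).hom ≫ faceCoalg k e ≫ (cubeOne k).inv, ?_⟩
  apply cell_ext
  intro x
  have h₁ : ((cubePt k).hom ≫ faceCoalg k e ≫ (cubeOne k).inv).hom.lin (cell k x) =
      (cubeOne k).inv.hom.lin ((1 : k) • ce k (some e)) := rfl
  refine h₁.trans ((congrArg (cubeOne k).inv.hom.lin (one_smul k _)).trans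
    ((cubeOne_inv (some e)).trans (cubeMapLin_bij ?_).symm))
  refine ⟨fun v _ i b hb => Option.some.inj hb, fun v _ w _ _ => Subsingleton.elim _ _,
    fun w hw => ⟨finZeroElim, fun i => i.elim0, funext fun i => (hw i e rfl).symm⟩⟩

theorem isMap_deg : IsMap k (cubeMapLin k fun (_ : Fin 1 → Bool) (_ : Fin 0) => false) := by
  refine ⟨(cubeOne k).hom ≫ degCoalg k ≫ (cubePt k).inv, ?_⟩
  apply cell_ext
  intro x
  have h₁ : ((cubeOne k).hom ≫ degCoalg k ≫ (cubePt k).inv).hom.lin (cell k x) =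
      epsLin k ((cubeOne k).hom.hom.lin (cell k x)) := rfl
  refine h₁.trans ((congrArg (epsLin k) (cubeOne_cell x)).trans ?_)
  rcases hx : x 0 with _ | b
  · refine (eps_none (k := k)).trans (cubeMapLin_not (k := k) (m := 1) (n := 0) ?_).symm
    intro h
    have h₂ : ∀ b : Bool, (fun _ : Fin 1 => b) ∈ face x := by
      intro b i c hc
      fin_cases i
      exact (Option.some_ne_none c (hc.symm.trans hx)).elim
    exact Bool.false_ne_true (congrFun (h (h₂ false) (h₂ true) rfl) 0)
  · refine (eps_some (k := k) b).trans (cubeMapLin_bij (y := finZeroElim) ?_).symm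
    refine ⟨fun v _ i => i.elim0, fun v hv w hw _ => ?_, fun w _ => ?_⟩
    · funext i
      fin_cases i
      exact (hv 0 b hx).trans (hw 0 b hx).symm
    · obtain ⟨v, hv⟩ := face_nonempty x
      exact ⟨v, hv, Subsingleton.elim _ _⟩

theorem conn_cell (x y : Fin 1 → Cell) :
    cubeMapLin k (fun (v : Fin 2 → Bool) (_ : Fin 1) => v 0 || v 1) (cell k (Fin.append x y)) =
      (cubeOne k).inv.hom.lin (cellConn (x 0) (y 0)) := by
  have key : ∀ a b : Cell, (∃ c : Cell, (cellConn a b : Cell →₀ k) = ce k c ∧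
      Set.BijOn (fun (v : Fin 2 → Bool) (_ : Fin 1) => v 0 || v 1)
        (face (Fin.append (fun _ : Fin 1 => a) fun _ : Fin 1 => b)) (face fun _ : Fin 1 => c)) ∨
      ((cellConn a b : Cell →₀ k) = 0 ∧
      ¬ Set.InjOn (fun (v : Fin 2 → Bool) (_ : Fin 1) => v 0 || v 1)
        (face (Fin.append (fun _ : Fin 1 => a) fun _ : Fin 1 => b))) := by
    have hb : ∀ a b c : Cell,
        (∀ v : Fin 2 → Bool, v ∈ face (Fin.append (fun _ : Fin 1 => a) fun _ : Fin 1 => b) →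
          (fun (_ : Fin 1) => v 0 || v 1) ∈ face fun _ : Fin 1 => c) →
        (∀ v : Fin 2 → Bool, v ∈ face (Fin.append (fun _ : Fin 1 => a) fun _ : Fin 1 => b) →
         ∀ w : Fin 2 → Bool, w ∈ face (Fin.append (fun _ : Fin 1 => a) fun _ : Fin 1 => b) →
          (fun (_ : Fin 1) => v 0 || v 1) = (fun (_ : Fin 1) => w 0 || w 1) → v = w) →
        (∀ w : Fin 1 → Bool, w ∈ (face fun _ : Fin 1 => c) → ∃ v : Fin 2 → Bool,
          v ∈ face (Fin.append (fun _ : Fin 1 => a) fun _ : Fin 1 => b) ∧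
          (fun (_ : Fin 1) => v 0 || v 1) = w) →
        Set.BijOn (fun (v : Fin 2 → Bool) (_ : Fin 1) => v 0 || v 1)
        (face (Fin.append (fun _ : Fin 1 => a) fun _ : Fin 1 => b)) (face fun _ : Fin 1 => c) :=
      fun a b c h₁ h₂ h₃ => ⟨h₁, fun v hv w hw => h₂ v hv w hw, h₃⟩
    have hn : ∀ (a b : Cell) (v w : Fin 2 → Bool),
        v ∈ face (Fin.append (fun _ : Fin 1 => a) fun _ : Fin 1 => b) →
        w ∈ face (Fin.append (fun _ : Fin 1 => a) fun _ : Fin 1 => b) →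
        (v 0 || v 1) = (w 0 || w 1) → v ≠ w →
      ¬ Set.InjOn (fun (v : Fin 2 → Bool) (_ : Fin 1) => v 0 || v 1)
        (face (Fin.append (fun _ : Fin 1 => a) fun _ : Fin 1 => b)) :=
      fun a b v w h₁ h₂ h₃ h₄ h => h₄ (h h₁ h₂ (funext fun _ => h₃))
    intro a b
    rcases a with _ | _ | _ <;> rcases b with _ | _ | _
    · exact Or.inr ⟨rfl, hn _ _ ![true, false] ![false, true] (by decide) (by decide) (by decide) (by decide)⟩
    · exact Or.inl ⟨none, rfl, hb _ _ _ (by decide) (by decide) (by decide)⟩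
    · exact Or.inr ⟨rfl, hn _ _ ![true, true] ![false, true] (by decide) (by decide) (by decide) (by decide)⟩
    · exact Or.inl ⟨none, rfl, hb _ _ _ (by decide) (by decide) (by decide)⟩
    · exact Or.inl ⟨some false, rfl, hb _ _ _ (by decide) (by decide) (by decide)⟩
    · exact Or.inl ⟨some true, rfl, hb _ _ _ (by decide) (by decide) (by decide)⟩
    · exact Or.inr ⟨rfl, hn _ _ ![true, true] ![true, false] (by decide) (by decide) (by decide) (by decide)⟩
    · exact Or.inl ⟨some true, rfl, hb _ _ _ (by decide) (by decide) (by decide)⟩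
    · exact Or.inl ⟨some true, rfl, hb _ _ _ (by decide) (by decide) (by decide)⟩
  have hx : x = fun _ => x 0 := funext fun i => congrArg x (Subsingleton.elim _ _)
  have hy : y = fun _ => y 0 := funext fun i => congrArg y (Subsingleton.elim _ _)
  rcases key (x 0) (y 0) with ⟨c, h₁, h₂⟩ | ⟨h₁, h₂⟩
  · rw [h₁, cubeOne_inv, hx, hy]
    exact cubeMapLin_bij h₂
  · rw [h₁, hx, hy]
    exact (cubeMapLin_not h₂).trans (map_zero _).symm

theorem isMap_conn :
    IsMap k (cubeMapLin k fun (x : Fin 2 → Bool) (_ : Fin 1) => x 0 || x 1) := by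
  refine ⟨(cubeMul k 1 1).inv ≫ ((cubeOne k).hom ⊗ₘ (cubeOne k).hom) ≫
    (ofGensTens (intGens k) (intGens k)).inv ≫ connCoalg k ≫ (cubeOne k).inv, ?_⟩
  apply cell_ext
  intro x
  obtain ⟨y, z, rfl⟩ : ∃ y z : Fin 1 → Cell, x = Fin.append y z :=
    ⟨_, _, (append_split (m := 1) (n := 1) x).symm⟩
  refine Eq.trans ?_ (conn_cell y z).symm
  refine (congrArg (((cubeOne k).hom ⊗ₘ (cubeOne k).hom) ≫
    (ofGensTens (intGens k) (intGens k)).inv ≫ connCoalg k ≫ (cubeOne k).inv).hom.lin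
    (cubeMul_inv y z)).trans ?_
  refine congrArg (cubeOne k).inv.hom.lin (Eq.trans ?_ (conn_ce (y 0) (z 0)))
  exact congrArg (connLin k) (congrArg₂ (fun a b => a ⊗ₜ[k] b) (cubeOne_cell y) (cubeOne_cell z))

theorem isMap_cubeMapLin {m n : ℕ} {f : (Fin m → Bool) → (Fin n → Bool)} (hf : IsCubeMap f) :
    IsMap k (cubeMapLin k f) := by
  induction hf with
  | id n => exact ⟨𝟙 _, cubeMapLin_id.symm⟩
  | comp hg hf ihg ihf =>
    obtain ⟨φ, hφ⟩ := ihf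
    obtain ⟨ψ, hψ⟩ := ihg
    exact ⟨φ ≫ ψ, (congrArg₂ (fun a b => a ∘ₗ b) hψ hφ).trans
      (cubeMapLin_comp hf.onto hg.onto).symm⟩
  | @prod m n m' n' f g hf hg ihf ihg =>
    obtain ⟨φ, hφ⟩ := ihf
    obtain ⟨ψ, hψ⟩ := ihg
    refine ⟨(cubeMul k m m').inv ≫ (φ ⊗ₘ ψ) ≫ (cubeMul k n n').hom, ?_⟩
    apply cell_ext
    intro x
    obtain ⟨y, z, rfl⟩ : ∃ (y : Fin m → Cell) (z : Fin m' → Cell), x = Fin.append y z :=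
      ⟨_, _, (append_split x).symm⟩
    refine Eq.trans ?_ (cubeMapLin_prod hf.onto hg.onto y z).symm
    refine (congrArg ((φ ⊗ₘ ψ) ≫ (cubeMul k n n').hom).hom.lin (cubeMul_inv y z)).trans ?_
    refine congrArg (cubeMul k n n').hom.hom.lin ?_
    exact congrArg₂ (fun a b => a (cell k y) ⊗ₜ[k] b (cell k z)) hφ hψ
  | face e => exact isMap_face e
  | deg => exact isMap_deg
  | conn => exact isMap_conn

end Coalg

open Coalg DGMod

theorem IsMap.deg {m n : ℕ} {f : cubeMod k m →ₗ[k] cubeMod k n} (h : IsMap k f) {i : ℤ}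
    {x : cubeMod k m} (hx : x ∈ (cubeMod k m).gr i) : f x ∈ (cubeMod k n).gr i := by
  obtain ⟨φ, rfl⟩ := h
  exact φ.hom.deg hx

theorem IsMap.comm {m n : ℕ} {f : cubeMod k m →ₗ[k] cubeMod k n} (h : IsMap k f)
    (x : cubeMod k m) : f ((cubeMod k m).d x) = (cubeMod k n).d (f x) := by
  obtain ⟨φ, rfl⟩ := h
  exact φ.hom.comm x

theorem IsMap.act {m n : ℕ} {f : cubeMod k m ⟶ cubeMod k n} (h : IsMap k f.lin) {b : Word} {i : ℤ}
    (x : (M k).Hom .X b i) (y : cubeMod k m) :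
    (b.powMap f).lin ((cube k m).act.ap x y) = (cube k n).act.ap x (f.lin y) := by
  obtain ⟨φ, hφ⟩ := h
  obtain rfl : φ.hom = f := DGMod.hom_ext hφ
  exact φ.comm x y

variable (k) in
/-- The chain map given by a map of cubes. -/
def cubeHom {p q : Cube} (f : p ⟶ q) : cubeMod k p.dim ⟶ cubeMod k q.dim where
  lin := cubeMapLin k f.1
  deg hx := IsMap.deg (isMap_cubeMapLin f.2) hx
  comm x := IsMap.comm (isMap_cubeMapLin f.2) x

variable (k) in
/-- The functor of chains on the cube category, with values in coalgebras over `U(M)`. -/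
def cubeChains : Cube ⥤ Coalg (M k) where
  obj a := cube k a.dim
  map f := ⟨cubeHom k f, IsMap.act (f := cubeHom k f) (isMap_cubeMapLin f.2)⟩
  map_id a := Hom.ext (DGMod.hom_ext cubeMapLin_id)
  map_comp f g := Hom.ext (DGMod.hom_ext (cubeMapLin_comp f.2.onto g.2.onto))

end

section

variable {k : Type u} [CommRing k]

open scoped DayFunctor

/-- Cubical sets with the Day convolution monoidal structure. -/
abbrev CubSet : Type (u + 1) := Cubeᵒᵖ ⊛⥤ Type u

/-- The Yoneda embedding of the cube category into cubical sets. -/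
def cubes : Cube ⥤ CubSet.{u} := uliftYoneda.{u} ⋙ (DayFunctor.equiv Cubeᵒᵖ (Type u)).inverse

open scoped ExternalProduct in
/-- The map `□^p ⊗ □^q ⟶ □^(p+q)` from the tensor product of two standard cubes given by the
products of maps of cubes. -/
def cubesMul (p q : Cube) : cubes.{u}.obj p ⊗ cubes.obj q ⟶ cubes.obj (p ⊗ q) :=
  DayFunctor.tensorDesc
    { app := fun ab => ↾fun fg => ⟨fg.1.down ⊗ₘ fg.2.down⟩
      naturality := by
        intro X Y f
        ext ⟨⟨g⟩, ⟨h⟩⟩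
        exact congrArg ULift.up (tensorHom_comp_tensorHom f.1.unop f.2.unop g h).symm }

end

end CubChains

end

open CubChains

/-! The chains of a cubical set are glued from the chains of cubes, the chains of a product of cubes
are the tensor product of the chains, and both tensor products (Day convolution and the tensor
product of coalgebras) commute with gluing in each variable. So the isomorphism known on cubes
propagates to all cubical sets. Three ingredients make this precise.

Colimits of coalgebras are created on underlying modules. An operation of a `U(P)`-coalgebra has one
input and several outputs, so a compatible family of operations descends to a colimit without any
comparison between tensor powers and colimits. The operations have nonzero degrees and the tensor
product is handled by currying, so the useful notion of colimit is `DGMod.IsLinColimit`, a universal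
property against all linear maps, not only chain maps. Such colimits exist
(`DGMod.isLinColimit_colimCocone`), they carry the descended operations (`Coalg.colimAct`), every
colimit of coalgebras over a diagram shape for which modules have colimits is of this kind
(`Coalg.isLinColimit_of_isColimit`), and they are stable under tensoring with a fixed object. This
gives the pointwise Kan extension and the preservation of colimits by the tensor product in each
variable.

The functor `cubeChains` on the cube category is strong monoidal: `Coalg.cubeMul` concatenates
cells, and the coherence conditions (`cubeChainsCore`) are identities between concatenations of
tuples.

Finally, a general fact: let `F : B ⥤ V` be strong monoidal and let `N` be a pointwise left Kan
extension of `F` along the Yoneda embedding into presheaves with Day convolution. If the tensor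
product of `V` preserves the relevant colimits in each variable, then `N` is strong monoidal
(`Day.kanMonoidal`). Indeed `N` is left adjoint to the nerve `E ↦ Hom(F -, E)`. An oplax structure
on `F` makes the nerve lax, since two morphisms `F p ⟶ E` and `F q ⟶ E'` multiply to a morphism out
of `F (p ⊗ q)`; hence its left adjoint `N` is oplax, with all coherence supplied by the adjunction.
What is left is invertibility of the comparison maps. An element `x` of `X` over `p` names a
morphism `Day.elt α x : F p ⟶ N X`, and in these terms the comparison maps of `N` restrict to those
of `F` (`Day.elt_tm_δ`, `Day.elt_nu_η`). Since the source `N (X ⊗ Y)` is generated by the `elt α (tm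
x y)` and the target `N X ⊗ N Y` is the colimit of the `F p ⊗ F q`, an inverse is glued from the
multiplication of `F` (`Day.isIso_δ`). Evaluating at the tautological elements of two representables
gives the stated compatibility with `cubeMul`. -/

noncomputable section

namespace CubChains

section

open CategoryTheory.Limits

variable {k : Type u} [CommRing k]

/-! ### Colimits of differential graded modules, tested against arbitrary linear maps. -/

namespace DGMod

variable {J : Type v} [Category.{w} J]

/-- A cocone of differential graded modules has the universal property of a colimit with respect to
arbitrary linear maps. -/
def IsLinColimit {F : J ⥤ DGMod k} (c : Cocone F) : Prop :=
  ∀ (E : Type u) [AddCommGroup E] [Module k E] (f : ∀ j, F.obj j →ₗ[k] E),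
    (∀ (i j : J) (g : i ⟶ j), f j ∘ₗ (F.map g).lin = f i) →
      ∃! h : c.pt →ₗ[k] E, ∀ j, h ∘ₗ (c.ι.app j).lin = f j

theorem ι_map {F : J ⥤ DGMod k} (c : Cocone F) {i j : J} (g : i ⟶ j) :
    (c.ι.app j).lin ∘ₗ (F.map g).lin = (c.ι.app i).lin :=
  congrArg Hom.lin (c.w g)

section
variable {F : J ⥤ DGMod k} {c : Cocone F} (hc : IsLinColimit c)
include hc

theorem IsLinColimit.hom_ext {E : Type u} [AddCommGroup E] [Module k E] {f g : c.pt →ₗ[k] E}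
    (h : ∀ j, f ∘ₗ (c.ι.app j).lin = g ∘ₗ (c.ι.app j).lin) : f = g :=
  (hc E (fun j => g ∘ₗ (c.ι.app j).lin) fun i j φ => by
    rw [LinearMap.comp_assoc, ι_map]).unique h fun _ => rfl

/-- The linear map out of a linear colimit. -/
def IsLinColimit.desc {E : Type u} [AddCommGroup E] [Module k E] (f : ∀ j, F.obj j →ₗ[k] E)
    (hf : ∀ (i j : J) (g : i ⟶ j), f j ∘ₗ (F.map g).lin = f i) : c.pt →ₗ[k] E :=
  (hc E f hf).choose

theorem IsLinColimit.fac {E : Type u} [AddCommGroup E] [Module k E] (f : ∀ j, F.obj j →ₗ[k] E)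
    (hf : ∀ (i j : J) (g : i ⟶ j), f j ∘ₗ (F.map g).lin = f i) (j : J) :
    hc.desc f hf ∘ₗ (c.ι.app j).lin = f j :=
  (hc E f hf).choose_spec.1 j

/-- The quotient map by the submodule generated by the images agrees with the zero map on every
`F.obj j`, so the two coincide by uniqueness and the quotient is trivial. The purpose is to
determine the grading of `c.pt`, about which the universal property says nothing directly. -/
theorem IsLinColimit.iSup_range :
    ⨆ j, LinearMap.range (show F.obj j →ₗ[k] c.pt from (c.ι.app j).lin) = ⊤ := by
  rw [← Submodule.ker_mkQ (⨆ j, LinearMap.range (show F.obj j →ₗ[k] c.pt from (c.ι.app j).lin)),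
    LinearMap.ker_eq_top]
  apply hc.hom_ext
  intro j
  ext x
  exact (Submodule.Quotient.mk_eq_zero _).2 (Submodule.mem_iSup_of_mem j ⟨x, rfl⟩)

/-- The homogeneous components of a linear colimit are generated by homogeneous elements. -/
theorem IsLinColimit.gr_eq (n : ℤ) :
    c.pt.gr n = ⨆ j, Submodule.map (c.ι.app j).lin ((F.obj j).gr n) := by
  apply le_antisymm
  · intro x hx
    -- The projection to the component of degree `n`, as a linear endomorphism of `c.pt`. It fixes
    -- `x`, so it is enough that it maps all of `c.pt` into the supremum, and this can be tested on
    -- the images of the `F.obj j`, which generate.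
    let p : c.pt →ₗ[k] c.pt :=
      (c.pt.gr n).subtype ∘ₗ DirectSum.component k ℤ (fun i => c.pt.gr i) n ∘ₗ c.pt.dec.toLinearMap
    have hp : ∀ (m : ℤ) (y : c.pt), y ∈ c.pt.gr m → p y = if m = n then y else 0 := by
      intro m y hy
      change ((DirectSum.component k ℤ (fun i => c.pt.gr i) n (c.pt.dec y) : c.pt.gr n) : c.pt) = _
      rw [dec_apply hy]
      split_ifs with h
      · subst h; rw [DirectSum.component.lof_self]
      · rw [DirectSum.component.of, dif_neg h]; rfl
    have hx' : p x = x := by rw [hp n x hx, if_pos rfl]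
    rw [← hx']
    have key : (⊤ : Submodule k c.pt) ≤
        Submodule.comap p (⨆ j, Submodule.map (c.ι.app j).lin ((F.obj j).gr n)) := by
      rw [← hc.iSup_range]
      apply iSup_le
      rintro j _ ⟨y, rfl⟩
      rw [Submodule.mem_comap]
      -- Split the element of `F.obj j` into homogeneous components. The leg of the cocone preserves
      -- degrees, so `p` keeps the component of degree `n` and kills the others.
      obtain ⟨z, rfl⟩ := (F.obj j).internal.surjective y
      induction z using DirectSum.induction_on with
      | zero => simp
      | add a b ha hb => rw [map_add, map_add, map_add]; exact Submodule.add_mem _ ha hb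
      | of m z =>
        have e : (DirectSum.coeAddMonoidHom (F.obj j).gr) (DirectSum.of (fun i => (F.obj j).gr i) m z) =
            (z : F.obj j) := DirectSum.coeAddMonoidHom_of _ _ _
        rw [e, hp m _ ((c.ι.app j).deg z.2)]
        split_ifs with h
        · subst h
          exact Submodule.mem_iSup_of_mem j ⟨z, z.2, rfl⟩
        · exact Submodule.zero_mem _
    exact key Submodule.mem_top
  · apply iSup_le
    rintro j _ ⟨y, hy, rfl⟩
    exact (c.ι.app j).deg hy

/-- Linear maps out of a linear colimit are homogeneous if their restrictions are. -/
theorem IsLinColimit.isDeg {D : DGMod k} {n : ℤ} {f : c.pt →ₗ[k] D}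
    (h : ∀ j, IsDeg (F.obj j) D n (f ∘ₗ (c.ι.app j).lin)) : IsDeg c.pt D n f := by
  intro m x hx
  have : c.pt.gr m ≤ Submodule.comap f (D.gr (n + m)) := by
    rw [hc.gr_eq]
    apply iSup_le
    rintro j _ ⟨y, hy, rfl⟩
    exact h j m y hy
  exact this hx

/-- Chain maps out of a linear colimit. -/
def IsLinColimit.descHom {D : DGMod k} (f : ∀ j, F.obj j ⟶ D)
    (hf : ∀ (i j : J) (g : i ⟶ j), F.map g ≫ f j = f i) : c.pt ⟶ D where
  lin := hc.desc (fun j => (f j).lin) fun i j g => congrArg Hom.lin (hf i j g)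
  deg {n x} hx := by
    have := hc.isDeg (n := 0) (f := hc.desc (fun j => (f j).lin) fun i j g =>
      congrArg Hom.lin (hf i j g)) (fun j => by rw [hc.fac]; exact hom_isDeg (f j)) n x hx
    rwa [zero_add] at this
  comm x := by
    -- Both composites lower degrees by one, so they are not chain maps of degree zero; uniqueness
    -- among all linear maps is what allows them to be compared on the objects of the diagram.
    refine LinearMap.congr_fun (f := hc.desc _ _ ∘ₗ c.pt.d) (g := D.d ∘ₗ hc.desc _ _)
      (hc.hom_ext fun j => ?_) x
    have h₁ : c.pt.d ∘ₗ (c.ι.app j).lin = (c.ι.app j).lin ∘ₗ (F.obj j).d :=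
      LinearMap.ext fun y => ((c.ι.app j).comm y).symm
    rw [LinearMap.comp_assoc, LinearMap.comp_assoc, h₁, ← LinearMap.comp_assoc, hc.fac]
    exact LinearMap.ext (f j).comm

theorem IsLinColimit.ι_descHom {D : DGMod k} (f : ∀ j, F.obj j ⟶ D)
    (hf : ∀ (i j : J) (g : i ⟶ j), F.map g ≫ f j = f i) (j : J) :
    c.ι.app j ≫ hc.descHom f hf = f j :=
  DGMod.hom_ext (hc.fac (fun j => (f j).lin) (fun i j g => congrArg Hom.lin (hf i j g)) j)

/-- Linear colimits are colimits. -/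
def IsLinColimit.isColimit : IsColimit c where
  desc s := hc.descHom (fun j => s.ι.app j) fun _ _ g => s.w g
  fac s j := hc.ι_descHom _ _ j
  uniq s m h := DGMod.hom_ext (hc.hom_ext fun j =>
    (congrArg Hom.lin (h j)).trans (congrArg Hom.lin (hc.ι_descHom _ _ j)).symm)

/-- Tensor products of differential graded modules preserve linear colimits. -/
theorem IsLinColimit.tensorLeft (D : DGMod k) : IsLinColimit ((tensorLeft D).mapCocone c) := by
  intro E _ _ f hf
  -- Currying turns the compatible family of maps out of the `D ⊗ F.obj j` into one from the `F.obj
  -- j` to the module of linear maps from `D` to `E`. This target carries no grading or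
  -- differential, which is harmless because the universal property accepts arbitrary linear maps.
  have key : ∀ (i j : J) (g : i ⟶ j),
      (TensorProduct.curry (f j)).flip ∘ₗ (F.map g).lin = (TensorProduct.curry (f i)).flip := by
    intro i j g
    ext x y
    exact LinearMap.congr_fun (hf i j g) (y ⊗ₜ x)
  refine ⟨TensorProduct.lift (hc.desc (fun j => (TensorProduct.curry (f j)).flip) key).flip,
    fun j => ?_, fun h hh => ?_⟩
  · apply TensorProduct.ext'
    intro y x
    exact LinearMap.congr_fun (LinearMap.congr_fun (hc.fac _ key j) x) y
  · apply TensorProduct.ext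
    have : (TensorProduct.curry h).flip =
        hc.desc (fun j => (TensorProduct.curry (f j)).flip) key := by
      apply hc.hom_ext
      intro j
      rw [hc.fac]
      ext x y
      exact LinearMap.congr_fun (hh j) (y ⊗ₜ x)
    ext y x
    exact LinearMap.congr_fun (LinearMap.congr_fun this x) y

/-- The currying argument of `IsLinColimit.tensorLeft` with the diagram in the first variable, so
that no `flip` is needed. -/
theorem IsLinColimit.tensorRight (D : DGMod k) : IsLinColimit ((tensorRight D).mapCocone c) := by
  intro E _ _ f hf
  have key : ∀ (i j : J) (g : i ⟶ j),
      TensorProduct.curry (f j) ∘ₗ (F.map g).lin = TensorProduct.curry (f i) := by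
    intro i j g
    ext x y
    exact LinearMap.congr_fun (hf i j g) (x ⊗ₜ y)
  refine ⟨TensorProduct.lift (hc.desc (fun j => TensorProduct.curry (f j)) key),
    fun j => ?_, fun h hh => ?_⟩
  · apply TensorProduct.ext'
    intro x y
    exact LinearMap.congr_fun (LinearMap.congr_fun (hc.fac _ key j) x) y
  · apply TensorProduct.ext
    have : TensorProduct.curry h = hc.desc (fun j => TensorProduct.curry (f j)) key := by
      apply hc.hom_ext
      intro j
      rw [hc.fac]
      ext x y
      exact LinearMap.congr_fun (hh j) (x ⊗ₜ y)
    ext x y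
    exact LinearMap.congr_fun (LinearMap.congr_fun this x) y

end

/-- The map descended to `c.pt`, precomposed with `e.inv`, is the map descended to `c'.pt`. This
passes the property from one explicitly constructed colimit to a colimit known only through its
universal property. -/
theorem IsLinColimit.of_iso {F : J ⥤ DGMod k} {c c' : Cocone F} (hc : IsLinColimit c)
    (e : c.pt ≅ c'.pt) (h : ∀ j, c.ι.app j ≫ e.hom = c'.ι.app j) : IsLinColimit c' := by
  intro E _ _ f hf
  have he : e.hom.lin ∘ₗ e.inv.lin = LinearMap.id := congrArg Hom.lin e.inv_hom_id
  have hl : ∀ j, e.inv.lin ∘ₗ (c'.ι.app j).lin = (c.ι.app j).lin := fun j => by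
    rw [← h]
    exact congrArg Hom.lin (show (c.ι.app j ≫ e.hom) ≫ e.inv = c.ι.app j by simp)
  refine ⟨hc.desc f hf ∘ₗ e.inv.lin, fun j => ?_, fun g hg => ?_⟩
  · change (_ ∘ₗ _) ∘ₗ _ = _
    rw [LinearMap.comp_assoc, hl, hc.fac]
  · have : g ∘ₗ e.hom.lin = hc.desc f hf := hc.hom_ext fun j => by
      rw [hc.fac, LinearMap.comp_assoc, ← hg j, ← h]; rfl
    rw [← this, LinearMap.comp_assoc, he, LinearMap.comp_id]

/-! ### Construction of these colimits on the colimit of the underlying modules. -/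

section existence

variable (F : J ⥤ DGMod k)

/-- The underlying diagram of modules. -/
def toModules : J ⥤ ModuleCat.{u} k where
  obj j := ModuleCat.of k (F.obj j)
  map g := ModuleCat.ofHom (F.map g).lin
  map_id j := by rw [F.map_id]; rfl
  map_comp f g := by rw [F.map_comp]; rfl

variable [HasColimitsOfShape J (ModuleCat.{u} k)]

/-- The underlying module of a colimit. -/
abbrev colim : Type u := (colimit (toModules F) : ModuleCat.{u} k)

/-- The inclusions into the underlying module of a colimit. -/
def colimι (j : J) : F.obj j →ₗ[k] colim F := (colimit.ι (toModules F) j).hom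

variable {F} in
theorem colim_ext {E : Type u} [AddCommGroup E] [Module k E] {f g : colim F →ₗ[k] E}
    (h : ∀ j, f ∘ₗ colimι F j = g ∘ₗ colimι F j) : f = g :=
  congrArg ModuleCat.Hom.hom (show ModuleCat.ofHom f = ModuleCat.ofHom g from
    colimit.hom_ext fun j => ModuleCat.hom_ext (h j))

variable {F} in
/-- The universal property of the underlying module of a colimit. -/
def colimDesc {E : Type u} [AddCommGroup E] [Module k E] (f : ∀ j, F.obj j →ₗ[k] E)
    (hf : ∀ (i j : J) (g : i ⟶ j), f j ∘ₗ (F.map g).lin = f i) : colim F →ₗ[k] E :=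
  (colimit.desc (toModules F)
    { pt := ModuleCat.of k E
      ι := { app := fun j => ModuleCat.ofHom (f j)
             naturality := fun i j g => ModuleCat.hom_ext (hf i j g) } }).hom

variable {F} in
theorem colimDesc_ι {E : Type u} [AddCommGroup E] [Module k E] (f : ∀ j, F.obj j →ₗ[k] E)
    (hf : ∀ (i j : J) (g : i ⟶ j), f j ∘ₗ (F.map g).lin = f i) (j : J) :
    colimDesc f hf ∘ₗ colimι F j = f j :=
  congrArg ModuleCat.Hom.hom (colimit.ι_desc (F := toModules F) _ j)

theorem colimι_map {i j : J} (g : i ⟶ j) : colimι F j ∘ₗ (F.map g).lin = colimι F i :=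
  congrArg ModuleCat.Hom.hom (colimit.w (toModules F) g)

/-- The grading of a colimit. -/
def colimGr (n : ℤ) : Submodule k (colim F) := ⨆ j, Submodule.map (colimι F j) ((F.obj j).gr n)

variable {F} in
theorem colimι_mem {j : J} {n : ℤ} {x : F.obj j} (hx : x ∈ (F.obj j).gr n) :
    colimι F j x ∈ colimGr F n := Submodule.mem_iSup_of_mem j ⟨x, hx, rfl⟩

/-- The decomposition of the image of an object of the diagram. -/
def colimDecAux (j : J) : F.obj j →ₗ[k] DirectSum ℤ fun n => colimGr F n :=
  (DirectSum.toModule k ℤ _ fun n => DirectSum.lof k ℤ (fun n => colimGr F n) n ∘ₗ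
    LinearMap.restrict (colimι F j) (p := (F.obj j).gr n) (fun _ hx => colimι_mem hx)) ∘ₗ
      (F.obj j).dec.toLinearMap

variable {F} in
theorem colimDecAux_apply {j : J} {n : ℤ} {x : F.obj j} (hx : x ∈ (F.obj j).gr n) :
    colimDecAux F j x = DirectSum.lof k ℤ (fun n => colimGr F n) n ⟨colimι F j x, colimι_mem hx⟩ := by
  change DirectSum.toModule k ℤ _ _ ((F.obj j).dec x) = _
  rw [dec_apply hx, DirectSum.toModule_lof]
  rfl

/-- The decomposition of a colimit. -/
def colimDec : colim F →ₗ[k] DirectSum ℤ fun n => colimGr F n :=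
  colimDesc (colimDecAux F) fun i j g => by
    -- Homogeneous elements suffice. A transition map preserves the degree of such an element, so
    -- both decompositions have their only component in that degree.
    apply lin_ext
    intro n x hx
    rw [LinearMap.comp_apply, colimDecAux_apply hx, colimDecAux_apply ((F.map g).deg hx)]
    congr 1
    exact Subtype.ext (LinearMap.congr_fun (colimι_map F g) x)

/-- The decompositions of the objects of the diagram glue to `colimDec`. It sends each `colimGr F n`
into the summand of index `n`, and it is split by the summation map; by `isInternal_mk` this is
enough, so the independence of the submodules never has to be proved by hand. -/
theorem colimGr_internal : DirectSum.IsInternal (colimGr F) := by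
  have hd : ∀ j x, colimDec F (colimι F j x) = colimDecAux F j x := fun j =>
    LinearMap.congr_fun (colimDesc_ι (colimDecAux F) _ j)
  apply isInternal_mk (colimGr F) (colimDec F)
  · intro n z hz
    have : colimGr F n ≤ Submodule.comap (colimDec F)
        (LinearMap.range (DirectSum.lof k ℤ (fun n => colimGr F n) n)) := by
      apply iSup_le
      rintro j _ ⟨x, hx, rfl⟩
      rw [Submodule.mem_comap, hd, colimDecAux_apply hx]
      exact ⟨_, rfl⟩
    obtain ⟨w, hw⟩ := this hz
    exact ⟨w, hw.symm⟩
  · apply colim_ext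
    intro j
    apply lin_ext
    intro n x hx
    simp only [LinearMap.comp_apply, LinearMap.id_apply]
    rw [hd, colimDecAux_apply hx, DirectSum.coeLinearMap_lof]

/-- The differential of a colimit. -/
def colimD : colim F →ₗ[k] colim F :=
  colimDesc (fun j => colimι F j ∘ₗ (F.obj j).d) fun i j g => by
    -- The differentials of the objects descend because the transition maps are chain maps.
    rw [← colimι_map F g, LinearMap.comp_assoc, LinearMap.comp_assoc]
    exact congrArg (colimι F j ∘ₗ ·) (LinearMap.ext fun x => ((F.map g).comm x).symm)

theorem colimD_ι (j : J) (x : F.obj j) : colimD F (colimι F j x) = colimι F j ((F.obj j).d x) :=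
  LinearMap.congr_fun (colimDesc_ι (fun j => colimι F j ∘ₗ (F.obj j).d) _ j) x

/-- The colimit of a diagram of differential graded modules. -/
def colimMod : DGMod k where
  carrier := colim F
  gr := colimGr F
  internal := colimGr_internal F
  d := colimD F
  d_mem {n x} hx := by
    have : colimGr F n ≤ Submodule.comap (colimD F) (colimGr F (n - 1)) := by
      apply iSup_le
      rintro j _ ⟨x, hx, rfl⟩
      rw [Submodule.mem_comap, colimD_ι]
      exact colimι_mem ((F.obj j).d_mem hx)
    exact this hx
  d_d x := by
    refine LinearMap.congr_fun (f := colimD F ∘ₗ colimD F) (g := 0) (colim_ext fun j => ?_) x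
    ext y
    change colimD F (colimD F (colimι F j y)) = 0
    rw [colimD_ι, colimD_ι, (F.obj j).d_d, map_zero]

/-- The colimit cocone of a diagram of differential graded modules. -/
def colimCocone : Cocone F where
  pt := colimMod F
  ι :=
    { app := fun j =>
        { lin := colimι F j
          deg := colimι_mem
          comm := fun x => (colimD_ι F j x).symm }
      naturality := fun i j g => DGMod.hom_ext (colimι_map F g) }

theorem isLinColimit_colimCocone : IsLinColimit (colimCocone F) := fun _ _ _ f hf =>
  ⟨colimDesc f hf, fun j => colimDesc_ι f hf j, fun _ hh =>
    colim_ext fun j => (hh j).trans (colimDesc_ι f hf j).symm⟩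

end existence

end DGMod

/-! ### Recognition of colimits of coalgebras on underlying modules. -/

namespace Coalg
open DGProp DGMod

variable {P : DGProp k} {J : Type v} [Category.{w} J]

section
variable {F : J ⥤ Coalg P}

/-- If two morphisms of coalgebras differ by a chain map, then this chain map commutes with the
operations on the image of the first one. -/
theorem comm_of_comp {A B C : Coalg P} {f : A ⟶ B} {g : A ⟶ C} {d : B.toMod ⟶ C.toMod}
    (h : f.hom ≫ d = g.hom) {b : Word} {n : ℤ} (x : P.Hom .X b n) (y : A.toMod) :
    (b.powMap d).lin (B.act.ap x (f.hom.lin y)) = C.act.ap x (d.lin (f.hom.lin y)) := by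
  have h₂ : b.powMap f.hom ≫ b.powMap d = b.powMap g.hom := by rw [← Word.powMap_comp, h]
  refine (congrArg (b.powMap d).lin (f.comm x y)).symm.trans
    ((LinearMap.congr_fun (congrArg DGMod.Hom.lin h₂) (A.act.ap x y)).trans ?_)
  exact (g.comm x y).trans (congrArg (C.act.ap x)
    (LinearMap.congr_fun (congrArg DGMod.Hom.lin h) y).symm)

theorem forget_w (s : Cocone F) (i j : J) (g : i ⟶ j) :
    (F ⋙ forget P).map g ≫ (s.ι.app j).hom = (s.ι.app i).hom := congrArg Hom.hom (s.w g)

/-- The morphism of coalgebras out of a linear colimit. -/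
def descOfLin {c : Cocone F} (hc : IsLinColimit ((forget P).mapCocone c)) (s : Cocone F) :
    c.pt ⟶ s.pt where
  hom := hc.descHom (D := s.pt.toMod) _ (forget_w s)
  comm {b n} x := by
    -- For compatibility with the operations only these factorizations matter, so the descended map
    -- itself is replaced by a variable.
    have h : ∀ j, (c.ι.app j).hom ≫ hc.descHom (D := s.pt.toMod) _ (forget_w s) =
        (s.ι.app j).hom := hc.ι_descHom (D := s.pt.toMod) _ (forget_w s)
    generalize hc.descHom (D := s.pt.toMod) _ (forget_w s) = d at h ⊢
    -- Both sides are linear maps of degree `n` out of `c.pt`. Uniqueness for linear maps reduces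
    -- their equality to the images of the `F.obj j`, where it follows from `comm_of_comp`.
    exact LinearMap.congr_fun (f := DGMod.Hom.lin (C := b.pow c.pt.toMod) (b.powMap d) ∘ₗ
      c.pt.act.ap x) (g := s.pt.act.ap x ∘ₗ d.lin)
      (hc.hom_ext fun j => LinearMap.ext (comm_of_comp (h j) x))

theorem ι_descOfLin {c : Cocone F} (hc : IsLinColimit ((forget P).mapCocone c)) (s : Cocone F)
    (j : J) : c.ι.app j ≫ descOfLin hc s = s.ι.app j :=
  Hom.ext (hc.ι_descHom (D := s.pt.toMod) _ (forget_w s) j)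

/-- Cocones of coalgebras that are linear colimits are colimits. -/
def isColimitOfLin (c : Cocone F) (hc : IsLinColimit ((forget P).mapCocone c)) : IsColimit c where
  desc s := descOfLin hc s
  fac s j := ι_descOfLin hc s j
  uniq s _ h := Hom.ext (hc.isColimit.hom_ext fun j =>
    congrArg Hom.hom ((h j).trans (ι_descOfLin hc s j).symm))

end

/-! ### The operations on a colimit of coalgebras. -/

section action
variable {F : J ⥤ Coalg P} {c : Cocone (F ⋙ forget P)} (hc : IsLinColimit c)

/-- The inclusions into a linear colimit of coalgebras. -/
abbrev inc (c : Cocone (F ⋙ forget P)) (j : J) : (F.obj j).toMod ⟶ c.pt := c.ι.app j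

/-- Operations commute with the transition maps, which are morphisms of coalgebras, and iterated
tensor products are functorial. This is the compatibility under which an operation descends. Because
the operation has a single input, the tensor power occurs only in the target and need not commute
with the colimit. -/
theorem act_map {i j : J} (g : i ⟶ j) {b : Word} {n : ℤ} (x : P.Hom .X b n) :
    ((b.powMap (inc c j)).lin ∘ₗ (F.obj j).act.ap x) ∘ₗ (F.map g).hom.lin =
      (b.powMap (inc c i)).lin ∘ₗ (F.obj i).act.ap x := by
  have h : (F.map g).hom ≫ inc c j = inc c i := c.w g
  rw [LinearMap.comp_assoc, ← Hom.comm_lin, ← h, Word.powMap_comp]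
  rfl

/-- The action of an operation on a linear colimit. -/
def colimAp {b : Word} {n : ℤ} (x : P.Hom .X b n) : c.pt →ₗ[k] (b.pow c.pt : DGMod k) :=
  hc.desc (fun j => (b.powMap (inc c j)).lin ∘ₗ (F.obj j).act.ap x) fun _ _ g => act_map g x

/-- The defining property of the descended operation. Read for fixed `j`, it makes the inclusion a
morphism of coalgebras in `colimCocone`. -/
theorem colimAp_inc {b : Word} {n : ℤ} (x : P.Hom .X b n) (j : J) (y : (F.obj j).toMod) :
    (b.powMap (inc c j)).lin ((F.obj j).act.ap x y) = colimAp hc x ((inc c j).lin y) :=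
  (LinearMap.congr_fun (hc.fac (fun j => (b.powMap (inc c j)).lin ∘ₗ (F.obj j).act.ap x)
    (fun _ _ g => act_map g x) j) y).symm

/-- All axioms of an action on the colimit are proved through this uniqueness: the other side of an
axiom only has to extend the operations of the `F.obj j`. -/
theorem colimAp_unique {b : Word} {n : ℤ} (x : P.Hom .X b n) {f : c.pt →ₗ[k] (b.pow c.pt : DGMod k)}
    (h : ∀ (j : J) (y : (F.obj j).toMod),
      (b.powMap (inc c j)).lin ((F.obj j).act.ap x y) = f ((inc c j).lin y)) : colimAp hc x = f :=
  hc.hom_ext fun j => LinearMap.ext fun y => (colimAp_inc hc x j y).symm.trans (h j y)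

theorem colimAp_deg {b : Word} {n : ℤ} (x : P.Hom .X b n) :
    colimAp hc x ∈ homDeg c.pt (b.pow c.pt) n :=
  hc.isDeg fun j m y hy => by
    have h := (b.powMap (inc c j)).deg ((F.obj j).act.ap_mem x hy)
    exact (congrArg (· ∈ (b.pow c.pt : DGMod k).gr (n + m)) (colimAp_inc hc x j y)).mp h

/-- The operations on a linear colimit. -/
def colimAct : OpHom P (endProp c.pt) where
  map {b n} :=
    { toFun := fun x => ⟨colimAp hc x, colimAp_deg hc x⟩
      map_add' := fun x y => Subtype.ext (colimAp_unique hc _ fun j z => by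
        rw [map_add, LinearMap.add_apply, map_add, colimAp_inc hc, colimAp_inc hc]
        rfl)
      map_smul' := fun r x => Subtype.ext (colimAp_unique hc _ fun j z => by
        rw [map_smul, LinearMap.smul_apply, map_smul, colimAp_inc hc]
        rfl) }
  map_id := Subtype.ext (colimAp_unique hc _ fun j z =>
    congrArg (fun t : homDeg (F.obj j).toMod (F.obj j).toMod 0 => (inc c j).lin (t.1 z))
      (F.obj j).act.map_id)
  -- The remaining axioms share one pattern. The axiom holds in `F.obj j`, and the construction it
  -- involves (differential of a linear map, structural isomorphism, whiskering) is natural with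
  -- respect to the inclusion `inc c j`, by `dHom_nat`, `Str.map_natural` and `whl_nat`
  -- respectively.
  map_d {b n m} h f := Subtype.ext (colimAp_unique hc _ fun j z =>
    (congrArg (fun t : homDeg (F.obj j).toMod (b.pow (F.obj j).toMod) m =>
      (b.powMap (inc c j)).lin (t.1 z)) ((F.obj j).act.map_d h f)).trans
        (LinearMap.congr_fun (dHom_nat (b.powMap (inc c j)) (inc c j) ((F.obj j).act.map f)
          ⟨colimAp hc f, colimAp_deg hc f⟩ h (LinearMap.ext (colimAp_inc hc f j))) z))
  map_str {b d n} s f := Subtype.ext (colimAp_unique hc _ fun j z =>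
    (congrArg (fun t : homDeg (F.obj j).toMod (d.pow (F.obj j).toMod) n =>
      (d.powMap (inc c j)).lin (t.1 z)) ((F.obj j).act.map_str s f)).trans
        ((LinearMap.congr_fun (congrArg DGMod.Hom.lin (Str.map_natural (inc c j) s))
          ((F.obj j).act.ap f z)).trans (congrArg (s.map c.pt).lin (colimAp_inc hc f j z))))
  map_comp {a b i l n} h g f := Subtype.ext (colimAp_unique hc _ fun j z =>
    (congrArg (fun t : homDeg (F.obj j).toMod ((a.tens b).pow (F.obj j).toMod) n =>
      ((a.tens b).powMap (inc c j)).lin (t.1 z)) ((F.obj j).act.map_comp h g f)).trans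
        ((LinearMap.congr_fun (whl_nat (a.powMap (inc c j)) (b.powMap (inc c j)) (inc c j)
          ((F.obj j).act.map g) ⟨colimAp hc g, colimAp_deg hc g⟩
          (LinearMap.ext (colimAp_inc hc g j))) ((F.obj j).act.ap f z)).trans
            (congrArg (whl (a.pow c.pt) ⟨colimAp hc g, colimAp_deg hc g⟩).1
              (colimAp_inc hc f j z))))

end action

/-! ### Existence of colimits of coalgebras and their underlying modules. -/

section
variable (F : J ⥤ Coalg P) [HasColimitsOfShape J (ModuleCat.{u} k)]

/-- The colimit cocone of a diagram of coalgebras. -/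
def colimCocone : Cocone F where
  pt := ⟨(DGMod.colimCocone (F ⋙ forget P)).pt, colimAct (isLinColimit_colimCocone (F ⋙ forget P))⟩
  ι :=
    { app := fun j =>
        { hom := (DGMod.colimCocone (F ⋙ forget P)).ι.app j
          comm := fun x y => colimAp_inc (isLinColimit_colimCocone (F ⋙ forget P)) x j y }
      naturality := fun i j g => Hom.ext ((DGMod.colimCocone (F ⋙ forget P)).ι.naturality g) }

/-- The cocone `colimCocone` is a colimit. -/
def isColimitColimCocone : IsColimit (colimCocone F) :=
  isColimitOfLin _ (isLinColimit_colimCocone (F ⋙ forget P))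

instance : HasColimit F := ⟨⟨⟨colimCocone F, isColimitColimCocone F⟩⟩⟩

variable {F} in
/-- The underlying cocone of a colimit of coalgebras is a linear colimit. -/
theorem isLinColimit_of_isColimit {c : Cocone F} (hc : IsColimit c) :
    IsLinColimit ((forget P).mapCocone c) :=
  -- The property holds for the constructed cocone, and the unique isomorphism with any other
  -- colimit cocone of coalgebras has an underlying isomorphism of differential graded modules.
  (isLinColimit_colimCocone (F ⋙ forget P)).of_iso
    ((forget P).mapIso ((isColimitColimCocone F).coconePointUniqueUpToIso hc)) fun j =>
      congrArg Hom.hom ((isColimitColimCocone F).comp_coconePointUniqueUpToIso_hom hc j)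

end

end Coalg

/-! ### Tensor products of coalgebras preserve colimits in each variable; existence of the Kan
extension. -/

namespace Coalg
open DGProp DGMod

variable {J : Type v} [Category.{w} J] [HasColimitsOfShape J (ModuleCat.{u} k)]

/-- Underneath, the tensor product of coalgebras is that of differential graded modules. A colimit
cocone is a linear colimit, `IsLinColimit.tensorLeft` keeps this property, and `isColimitOfLin`
returns to coalgebras; the operations, which go through the Hopf structure, play no part in the
argument. -/
instance (C : Coalg (M k)) : PreservesColimitsOfShape J (tensorLeft C) where
  preservesColimit := { preserves := fun {c} hc =>
    ⟨isColimitOfLin ((tensorLeft C).mapCocone c)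
      ((isLinColimit_of_isColimit hc).tensorLeft C.toMod)⟩ }

instance (C : Coalg (M k)) : PreservesColimitsOfShape J (tensorRight C) where
  preservesColimit := { preserves := fun {c} hc =>
    ⟨isColimitOfLin ((tensorRight C).mapCocone c)
      ((isLinColimit_of_isColimit hc).tensorRight C.toMod)⟩ }

end Coalg

/-- Size is the only question. The category of cubes over `Y` has its objects in `Type u`, because
`Y` takes values there, and its morphisms in `Type`, because the cube category is small.
`ModuleCat.{u} k` has colimits of this size, hence so do coalgebras. -/
theorem cubes_hasPointwiseLeftKanExtension (k : Type u) [CommRing k] :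
    cubes.{u}.HasPointwiseLeftKanExtension (cubeChains k) := fun Y => by
  have : HasColimitsOfSize.{0, u} (ModuleCat.{u} k) := inferInstance
  change HasColimit _
  infer_instance

end

end CubChains

end

noncomputable section

namespace CubChains

section

variable {k : Type u} [CommRing k]

/-! ### Monoidal structure of the chains on the cube category. -/

namespace Coalg
open DGProp DGMod

/-- The associators and unitors of `Cube` are casts of coordinates, so this computes how they act on
chains. -/
theorem cubeMapLin_cast {m n : ℕ} (h : n = m) (x : Fin m → Cell) :
    cubeMapLin k (fun (v : Fin m → Bool) (i : Fin n) => v (Fin.cast h i)) (cell k x) =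
      cell k fun i => x (Fin.cast h i) := by
  subst h
  exact LinearMap.congr_fun cubeMapLin_id _

/-- The cells form a basis, and a morphism of coalgebras is determined by its underlying linear map.
With this and its analogue for three factors, naturality and coherence become statements about
tuples of cells. -/
theorem cube_hom_ext₂ {m n : ℕ} {C : Coalg (M k)} {f g : cube k m ⊗ cube k n ⟶ C}
    (h : ∀ x y, f.hom.lin (cell k x ⊗ₜ[k] cell k y) = g.hom.lin (cell k x ⊗ₜ[k] cell k y)) :
    f = g :=
  Hom.ext (DGMod.hom_ext (cell_ext₂ h))

theorem cube_hom_ext₃ {m n l : ℕ} {C : Coalg (M k)} {f g : (cube k m ⊗ cube k n) ⊗ cube k l ⟶ C}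
    (h : ∀ x y z, f.hom.lin ((cell k x ⊗ₜ[k] cell k y) ⊗ₜ[k] cell k z) =
      g.hom.lin ((cell k x ⊗ₜ[k] cell k y) ⊗ₜ[k] cell k z)) : f = g :=
  Hom.ext (DGMod.hom_ext (TensorProduct.ext (cell_ext₂ fun x y => cell_ext fun z => h x y z)))

/-- The content is `cubeMapLin_prod`: a product of cube maps is injective on a product face exactly
when each factor is injective on its face, and the image is then the product of the image faces. -/
theorem cubeMul_natural {m n m' n' : Cube} (f : m ⟶ n) (g : m' ⟶ n') :
    ((cubeChains k).map f ⊗ₘ (cubeChains k).map g) ≫ (cubeMul k n.dim n'.dim).hom =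
      (cubeMul k m.dim m'.dim).hom ≫ (cubeChains k).map (f ⊗ₘ g) := by
  apply cube_hom_ext₂
  intro x y
  refine (cubeMapLin_prod f.2.onto g.2.onto x y).symm.trans ?_
  exact (congrArg (cubeMapLin k (cubeProd f.1 g.1)) (cubeMul_cell x y)).symm

/-- Both routes concatenate three cells. The two bracketings of a concatenation differ by the cast
of indices that `α_ m n l` induces. -/
theorem cubeMul_assoc (m n l : Cube) :
    (cubeMul k m.dim n.dim).hom ▷ cube k l.dim ≫ (cubeMul k (m.dim + n.dim) l.dim).hom ≫
        (cubeChains k).map (α_ m n l).hom =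
      (α_ (cube k m.dim) (cube k n.dim) (cube k l.dim)).hom ≫
        cube k m.dim ◁ (cubeMul k n.dim l.dim).hom ≫ (cubeMul k m.dim (n.dim + l.dim)).hom := by
  apply cube_hom_ext₃
  intro x y z
  have h₁ : (cubeMul k (m.dim + n.dim) l.dim).hom.hom.lin
      ((cubeMul k m.dim n.dim).hom.hom.lin (cell k x ⊗ₜ[k] cell k y) ⊗ₜ[k] cell k z) =
      cell k (Fin.append (Fin.append x y) z) := by
    rw [cubeMul_cell]; exact cubeMul_cell _ _
  have h₂ : (cubeMul k m.dim (n.dim + l.dim)).hom.hom.lin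
      (cell k x ⊗ₜ[k] (cubeMul k n.dim l.dim).hom.hom.lin (cell k y ⊗ₜ[k] cell k z)) =
      cell k (Fin.append x (Fin.append y z)) := by
    rw [cubeMul_cell]; exact cubeMul_cell _ _
  refine (congrArg (cubeMapLin k (α_ m n l).hom.1) h₁).trans (Eq.trans ?_ h₂.symm)
  refine (cubeMapLin_cast (add_assoc m.dim n.dim l.dim).symm _).trans (congrArg (cell k) ?_)
  rw [Fin.append_assoc]
  rfl

/-- Under `cubeZero` the element `1` corresponds to the empty cell, and concatenation with the empty
tuple changes only the indexing, which the unitor of `Cube` undoes. -/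
theorem cubeMul_zero_left (m : Cube) : (λ_ (cube k m.dim)).hom =
    (cubeZero k).inv ▷ cube k m.dim ≫ (cubeMul k 0 m.dim).hom ≫
      (cubeChains k).map (λ_ m).hom := by
  refine Hom.ext (DGMod.hom_ext (TensorProduct.ext (LinearMap.ext_ring (cell_ext fun y => ?_))))
  let x : Fin 0 → Cell := finZeroElim
  have h₁ : (λ_ (cube k m.dim)).hom.hom.lin ((1 : k) ⊗ₜ[k] cell k y) = cell k y :=
    one_smul k (cell k y)
  refine h₁.trans (Eq.symm ((congrArg (cubeMapLin k (λ_ m).hom.1) (cubeMul_cell x y)).trans ?_))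
  refine (cubeMapLin_cast (zero_add m.dim).symm _).trans (congrArg (cell k) ?_)
  funext i
  refine Eq.trans (congrArg (Fin.append x y) ?_) (Fin.append_right x y i)
  exact Fin.ext (zero_add i.1).symm

theorem cubeMul_zero_right (m : Cube) : (ρ_ (cube k m.dim)).hom =
    cube k m.dim ◁ (cubeZero k).inv ≫ (cubeMul k m.dim 0).hom ≫
      (cubeChains k).map (ρ_ m).hom := by
  refine Hom.ext (DGMod.hom_ext (TensorProduct.ext (cell_ext fun x => LinearMap.ext_ring ?_)))
  let y : Fin 0 → Cell := finZeroElim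
  have h₁ : (ρ_ (cube k m.dim)).hom.hom.lin (cell k x ⊗ₜ[k] (1 : k)) = cell k x :=
    one_smul k (cell k x)
  refine h₁.trans (Eq.symm ((congrArg (cubeMapLin k (ρ_ m).hom.1) (cubeMul_cell x y)).trans ?_))
  refine (cubeMapLin_cast (add_zero m.dim).symm _).trans (congrArg (cell k) ?_)
  funext i
  exact Fin.append_left x y i

end Coalg

open Coalg

variable (k) in
/-- The monoidal structure of the functor of chains on the cube category. -/
def cubeChainsCore : (cubeChains k).CoreMonoidal where
  εIso := (cubeZero k).symm
  μIso p q := cubeMul k p.dim q.dim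
  μIso_hom_natural_left f X' := by
    have h := cubeMul_natural (k := k) f (𝟙 X')
    rw [(cubeChains k).map_id, tensorHom_id, tensorHom_id] at h
    exact h
  μIso_hom_natural_right X' f := by
    have h := cubeMul_natural (k := k) (𝟙 X') f
    rw [(cubeChains k).map_id, id_tensorHom, id_tensorHom] at h
    exact h
  associativity := cubeMul_assoc
  left_unitality := cubeMul_zero_left
  right_unitality := cubeMul_zero_right

instance : (cubeChains k).Monoidal := (cubeChainsCore k).toMonoidal

end

end CubChains

end

noncomputable section

namespace CubChains

open Opposite
open scoped DayFunctor

section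

variable {B : Type} [SmallCategory B] [MonoidalCategory B]

/-! ### Day convolution of presheaves of sets, described by elements. -/

namespace Day

variable {X X' Y Y' Z : Bᵒᵖ ⊛⥤ Type u}

theorem types_congr {S T : Type u} {f g : S ⟶ T} (h : f = g) (x : S) : f x = g x := by rw [h]

/-- The element of a Day convolution given by two elements. -/
def tm {p q : B} (x : X.functor.obj (op p)) (y : Y.functor.obj (op q)) :
    (X ⊗ Y).functor.obj (op (p ⊗ q)) :=
  (DayFunctor.η X Y).app (op p, op q) (x, y)

variable (B) in
/-- The generating element of the unit. -/
def nu : (𝟙_ (Bᵒᵖ ⊛⥤ Type u)).functor.obj (op (𝟙_ B)) :=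
  DayFunctor.ν Bᵒᵖ (Type u) PUnit.unit

theorem naturality_apply (g : X ⟶ Y) {p q : B} (f : p ⟶ q) (x : X.functor.obj (op q)) :
    g.natTrans.app (op p) (X.functor.map f.op x) = Y.functor.map f.op (g.natTrans.app (op q) x) :=
  NatTrans.naturality_apply g.natTrans f.op x

theorem comp_app {g : X ⟶ Y} {h : Y ⟶ Z} {p : B} (x : X.functor.obj (op p)) :
    (g ≫ h).natTrans.app (op p) x = h.natTrans.app (op p) (g.natTrans.app (op p) x) := rfl

theorem map_comp {p q r : B} (f : p ⟶ q) (g : q ⟶ r) (x : X.functor.obj (op r)) :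
    X.functor.map (f ≫ g).op x = X.functor.map f.op (X.functor.map g.op x) :=
  types_congr (X.functor.map_comp g.op f.op) x

theorem map_id {p : B} (x : X.functor.obj (op p)) :
    X.functor.map (𝟙 p).op x = x :=
  types_congr (X.functor.map_id (op p)) x

theorem hom_ext {g h : X ⟶ Y}
    (H : ∀ (p : B) (x : X.functor.obj (op p)), g.natTrans.app (op p) x = h.natTrans.app (op p) x) :
    g = h := by
  ext p x
  exact H p.unop x

/-- Naturality of the universal transformation that exhibits the Day convolution as a left Kan
extension, evaluated at a pair of elements. -/
theorem map_tm {p q p' q' : B} (f : p' ⟶ p) (g : q' ⟶ q) (x : X.functor.obj (op p))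
    (y : Y.functor.obj (op q)) :
    (X ⊗ Y).functor.map (f ⊗ₘ g).op (tm x y) =
      tm (X.functor.map f.op x) (Y.functor.map g.op y) :=
  (NatTrans.naturality_apply (DayFunctor.η X Y) (X := (op p, op q)) (Y := (op p', op q'))
    (f.op, g.op) ((x, y) :)).symm

open LawfulDayConvolutionMonoidalCategoryStruct

/-- The structure maps of the Day convolution are characterised by their composites with the
universal transformations. Evaluated at elements, these characterisations turn into formulas on the
generators `tm x y` and `nu B`; the lemmas on whiskerings, associator and unitors are obtained in
the same way. -/
theorem tensorHom_tm (f : X ⟶ X') (g : Y ⟶ Y') {p q : B} (x : X.functor.obj (op p))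
    (y : Y.functor.obj (op q)) :
    (f ⊗ₘ g).natTrans.app (op (p ⊗ q)) (tm x y) =
      tm (f.natTrans.app (op p) x) (g.natTrans.app (op q) y) :=
  types_congr (convolutionExtensionUnit_comp_ι_map_tensorHom_app Bᵒᵖ (Type u)
    f g (op p) (op q)) ((x, y) :)

theorem whiskerLeft_tm (X : Bᵒᵖ ⊛⥤ Type u) (g : Y ⟶ Y') {p q : B} (x : X.functor.obj (op p))
    (y : Y.functor.obj (op q)) :
    (X ◁ g).natTrans.app (op (p ⊗ q)) (tm x y) = tm x (g.natTrans.app (op q) y) :=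
  types_congr (convolutionExtensionUnit_comp_ι_map_whiskerLeft_app (Type u)
    X g (op p) (op q)) ((x, y) :)

theorem whiskerRight_tm (f : X ⟶ X') (Y : Bᵒᵖ ⊛⥤ Type u) {p q : B} (x : X.functor.obj (op p))
    (y : Y.functor.obj (op q)) :
    (f ▷ Y).natTrans.app (op (p ⊗ q)) (tm x y) = tm (f.natTrans.app (op p) x) y :=
  types_congr (convolutionExtensionUnit_comp_ι_map_whiskerRight_app Bᵒᵖ (Type u)
    f Y (op p) (op q)) ((x, y) :)

/-- The two iterated tensors lie over differently bracketed objects of `B`, so a restriction along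
the associator of `B` is needed to compare them. -/
theorem associator_tm {p q r : B} (x : X.functor.obj (op p)) (y : Y.functor.obj (op q))
    (z : Z.functor.obj (op r)) :
    (α_ X Y Z).hom.natTrans.app (op ((p ⊗ q) ⊗ r)) (tm (tm x y) z) =
      (X ⊗ Y ⊗ Z).functor.map (α_ p q r).hom.op (tm x (tm y z)) :=
  types_congr (associator_hom_unit_unit (Type u) X Y Z (op p) (op q) (op r))
    (((x, y), z) :)

theorem leftUnitor_tm {q : B} (y : Y.functor.obj (op q)) :
    (λ_ Y).hom.natTrans.app (op (𝟙_ B ⊗ q)) (tm (nu B) y) = Y.functor.map (λ_ q).hom.op y :=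
  types_congr (leftUnitor_hom_unit_app (Type u) Y (op q)) ((PUnit.unit, y) :)

theorem rightUnitor_tm {q : B} (y : Y.functor.obj (op q)) :
    (ρ_ Y).hom.natTrans.app (op (q ⊗ 𝟙_ B)) (tm y (nu B)) = Y.functor.map (ρ_ q).hom.op y :=
  types_congr (rightUnitor_hom_unit_app (Type u) Y (op q)) ((y, PUnit.unit) :)

/-- By the pointwise formula, the value at `r` is the colimit of the products of the sets over `p`
and `q`, indexed by the maps `r ⟶ p ⊗ q`. The inclusions into a colimit of sets are jointly
surjective, so the elements `tm x y` generate under restriction. -/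
theorem exists_tm {r : B} (z : (X ⊗ Y).functor.obj (op r)) :
    ∃ (p q : B) (f : r ⟶ p ⊗ q) (x : X.functor.obj (op p)) (y : Y.functor.obj (op q)),
      z = (X ⊗ Y).functor.map f.op (tm x y) := by
  obtain ⟨j, w, hw⟩ := Limits.Types.jointly_surjective_of_isColimit
    (isPointwiseLeftKanExtensionConvolutionExtensionUnit (C := Bᵒᵖ) (V := Type u) X Y (op r)) z
  exact ⟨j.left.1.unop, j.left.2.unop, j.hom.unop, w.1, w.2, hw.symm⟩

/-- The same argument for the unit, which is the left Kan extension of a point placed at `𝟙_ B`. -/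
theorem exists_nu {r : B} (z : (𝟙_ (Bᵒᵖ ⊛⥤ Type u)).functor.obj (op r)) :
    ∃ f : r ⟶ 𝟙_ B, z = (𝟙_ (Bᵒᵖ ⊛⥤ Type u)).functor.map f.op (nu B) := by
  obtain ⟨j, w, hw⟩ := Limits.Types.jointly_surjective_of_isColimit
    (isPointwiseLeftKanExtensionUnitUnit Bᵒᵖ (Type u) (Bᵒᵖ ⊛⥤ Type u) (op r)) z
  exact ⟨j.hom.unop, hw.symm⟩

/-- A map of presheaves commutes with restriction, so it is determined by its values on generators,
which `exists_tm` provides. -/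
theorem tensor_hom_ext {g h : X ⊗ Y ⟶ Z}
    (H : ∀ (p q : B) (x : X.functor.obj (op p)) (y : Y.functor.obj (op q)),
      g.natTrans.app (op (p ⊗ q)) (tm x y) = h.natTrans.app (op (p ⊗ q)) (tm x y)) : g = h := by
  refine hom_ext fun r z => ?_
  obtain ⟨p, q, f, x, y, rfl⟩ := exists_tm z
  rw [naturality_apply, naturality_apply, H]

/-- Every element of the unit is a restriction of `nu B`, and `map_tm` moves that restriction
outside the tensor. The next variants, with the unit on the right and with three factors, use the
same device. -/
theorem unit_tensor_hom_ext {g h : 𝟙_ _ ⊗ Y ⟶ Z}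
    (H : ∀ (q : B) (y : Y.functor.obj (op q)),
      g.natTrans.app (op (𝟙_ B ⊗ q)) (tm (nu B) y) = h.natTrans.app _ (tm (nu B) y)) : g = h := by
  refine tensor_hom_ext fun p q x y => ?_
  obtain ⟨f, rfl⟩ := exists_nu x
  have := map_tm f (𝟙 q) (nu B) y
  rw [map_id] at this
  rw [← this, naturality_apply, naturality_apply, H]

theorem tensor_unit_hom_ext {g h : Y ⊗ 𝟙_ _ ⟶ Z}
    (H : ∀ (q : B) (y : Y.functor.obj (op q)),
      g.natTrans.app (op (q ⊗ 𝟙_ B)) (tm y (nu B)) = h.natTrans.app _ (tm y (nu B))) : g = h := by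
  refine tensor_hom_ext fun q p y x => ?_
  obtain ⟨f, rfl⟩ := exists_nu x
  have := map_tm (𝟙 q) f y (nu B)
  rw [map_id] at this
  rw [← this, naturality_apply, naturality_apply, H]

theorem tensor_tensor_hom_ext {W : Bᵒᵖ ⊛⥤ Type u} {g h : (X ⊗ Y) ⊗ Z ⟶ W}
    (H : ∀ (p q r : B) (x : X.functor.obj (op p)) (y : Y.functor.obj (op q))
      (z : Z.functor.obj (op r)),
      g.natTrans.app (op ((p ⊗ q) ⊗ r)) (tm (tm x y) z) =
        h.natTrans.app (op ((p ⊗ q) ⊗ r)) (tm (tm x y) z)) : g = h := by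
  refine tensor_hom_ext fun s r w z => ?_
  obtain ⟨p, q, f, x, y, rfl⟩ := exists_tm w
  have := map_tm f (𝟙 r) (tm x y) z
  rw [map_id] at this
  rw [← this, naturality_apply, naturality_apply, H]

open scoped ExternalProduct in
/-- A map out of a Day convolution given by its values on the elements `tm x y`. -/
def desc (φ : ∀ p q : B, X.functor.obj (op p) → Y.functor.obj (op q) →
      Z.functor.obj (op (p ⊗ q)))
    (h : ∀ {p q p' q' : B} (f : p' ⟶ p) (g : q' ⟶ q) x y,
      φ p' q' (X.functor.map f.op x) (Y.functor.map g.op y) =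
        Z.functor.map (f ⊗ₘ g).op (φ p q x y)) : X ⊗ Y ⟶ Z :=
  DayFunctor.tensorDesc
    { app := fun ab => ↾fun xy => φ ab.1.unop ab.2.unop xy.1 xy.2
      naturality := by
        intro a b f
        ext ⟨x, y⟩
        exact h f.1.unop f.2.unop x y }

-- This is kept for arbitrary `φ` because it evaluates both `desc` and the map `cubesMul`, which is
-- itself given by `DayFunctor.tensorDesc`.
open scoped ExternalProduct in
theorem tensorDesc_tm (φ : X.functor ⊠ Y.functor ⟶ tensor Bᵒᵖ ⋙ Z.functor) {p q : B}
    (x : X.functor.obj (op p)) (y : Y.functor.obj (op q)) :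
    (DayFunctor.tensorDesc φ).natTrans.app (op (p ⊗ q)) (tm x y) = φ.app (op p, op q) ((x, y) :) :=
  types_congr (DayFunctor.η_comp_tensorDesc_app φ (op p) (op q)) ((x, y) :)

theorem desc_tm (φ : ∀ p q : B, X.functor.obj (op p) → Y.functor.obj (op q) →
      Z.functor.obj (op (p ⊗ q))) (h) {p q : B} (x : X.functor.obj (op p))
    (y : Y.functor.obj (op q)) :
    (desc φ h).natTrans.app (op (p ⊗ q)) (tm x y) = φ p q x y :=
  tensorDesc_tm _ x y

theorem unitDesc_nu (z : Z.functor.obj (op (𝟙_ B))) :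
    (DayFunctor.unitDesc (F := Z) (↾fun _ => z)).natTrans.app (op (𝟙_ B)) (nu B) = z :=
  types_congr (DayFunctor.ν_comp_unitDesc (F := Z) (↾fun _ => z)) PUnit.unit

end Day

end

end CubChains

end

noncomputable section

namespace CubChains

open Opposite
open scoped DayFunctor

section

variable {B : Type} [SmallCategory B] [MonoidalCategory B]
  {V : Type v} [Category.{u} V]

namespace Day

/-! ### The nerve of an oplax monoidal functor is lax monoidal. -/

section nerve

variable (F : B ⥤ V)

/-- The right adjoint of a left Kan extension along the Yoneda embedding. -/
def nerve : V ⥤ (Bᵒᵖ ⊛⥤ Type u) where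
  obj E := .mk (F.op ⋙ yoneda.obj E)
  map g := .mk (Functor.whiskerLeft F.op (yoneda.map g))

variable {F} in
/-- A morphism as an element of the nerve. -/
def toNerve {p : B} {E : V} (x : F.obj p ⟶ E) : ((nerve F).obj E).functor.obj (op p) := x

theorem map_toNerve {p q : B} {E : V} (f : p ⟶ q) (x : F.obj q ⟶ E) :
    ((nerve F).obj E).functor.map f.op (toNerve x) = toNerve (F.map f ≫ x) := rfl

theorem nerve_map_toNerve {p : B} {E E' : V} (g : E ⟶ E') (x : F.obj p ⟶ E) :
    ((nerve F).map g).natTrans.app (op p) (toNerve x) = toNerve (x ≫ g) := rfl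

open Functor.LaxMonoidal Functor.OplaxMonoidal

variable [MonoidalCategory V] [F.OplaxMonoidal]

/-- The multiplication of the nerve. -/
def nerveMul (E E' : V) : (nerve F).obj E ⊗ (nerve F).obj E' ⟶ (nerve F).obj (E ⊗ E') :=
  desc (fun p q x y => toNerve (F := F) (E := E ⊗ E') (p := p ⊗ q) (δ F p q ≫ (x ⊗ₘ y))) (by
    intro p q p' q' f g (x : F.obj p ⟶ E) (y : F.obj q ⟶ E')
    change δ F p' q' ≫ ((F.map f ≫ x) ⊗ₘ (F.map g ≫ y)) = F.map (f ⊗ₘ g) ≫ δ F p q ≫ (x ⊗ₘ y)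
    rw [← δ_natural_assoc, tensorHom_comp_tensorHom])

theorem nerveMul_tm {E E' : V} {p q : B} (x : F.obj p ⟶ E) (y : F.obj q ⟶ E') :
    (nerveMul F E E').natTrans.app (op (p ⊗ q)) (tm (toNerve x) (toNerve y)) =
      toNerve (δ F p q ≫ (x ⊗ₘ y)) :=
  desc_tm _ _ _ _

/-- The unit of the nerve. -/
def nerveUnit : 𝟙_ (Bᵒᵖ ⊛⥤ Type u) ⟶ (nerve F).obj (𝟙_ V) :=
  DayFunctor.unitDesc (↾fun _ => toNerve (η F))

theorem nerveUnit_nu :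
    (nerveUnit F).natTrans.app (op (𝟙_ B)) (nu B) = toNerve (η F) :=
  unitDesc_nu _

/-- Each axiom is an equality of maps out of a Day convolution, so it can be checked on the
generators `tm` and `nu`. There the elements are morphisms out of values of `F`, and the axiom
becomes the corresponding axiom for the oplax structure of `F` together with naturality in `V`. -/
instance : (nerve F).LaxMonoidal where
  ε := nerveUnit F
  μ := nerveMul F
  μ_natural_left {E E'} f E'' := by
    refine tensor_hom_ext fun p q (x : F.obj p ⟶ E) (y : F.obj q ⟶ E'') => ?_
    change (nerveMul F E' E'').natTrans.app _ (((nerve F).map f ▷ (nerve F).obj E'').natTrans.app _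
        (tm (toNerve x) (toNerve y))) =
      ((nerve F).map (f ▷ E'')).natTrans.app _ ((nerveMul F E E'').natTrans.app _
        (tm (toNerve x) (toNerve y)))
    rw [whiskerRight_tm, nerve_map_toNerve, nerveMul_tm, nerveMul_tm, nerve_map_toNerve]
    simp [MonoidalCategory.tensorHom_def, whisker_exchange]
  μ_natural_right {E E'} E'' f := by
    refine tensor_hom_ext fun p q (x : F.obj p ⟶ E'') (y : F.obj q ⟶ E) => ?_
    change (nerveMul F E'' E').natTrans.app _ (((nerve F).obj E'' ◁ (nerve F).map f).natTrans.app _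
        (tm (toNerve x) (toNerve y))) =
      ((nerve F).map (E'' ◁ f)).natTrans.app _ ((nerveMul F E'' E).natTrans.app _
        (tm (toNerve x) (toNerve y)))
    rw [whiskerLeft_tm, nerve_map_toNerve, nerveMul_tm, nerveMul_tm, nerve_map_toNerve]
    simp [MonoidalCategory.tensorHom_def]
  associativity E₁ E₂ E₃ := by
    refine tensor_tensor_hom_ext fun p q r (x : F.obj p ⟶ E₁) (y : F.obj q ⟶ E₂)
      (z : F.obj r ⟶ E₃) => ?_
    change ((nerve F).map _).natTrans.app _ ((nerveMul F (E₁ ⊗ E₂) E₃).natTrans.app _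
      ((nerveMul F E₁ E₂ ▷ (nerve F).obj E₃).natTrans.app _
        (tm (tm (toNerve x) (toNerve y)) (toNerve z)))) =
      (nerveMul F E₁ (E₂ ⊗ E₃)).natTrans.app _ (((nerve F).obj E₁ ◁ nerveMul F E₂ E₃).natTrans.app _
        ((α_ ((nerve F).obj E₁) ((nerve F).obj E₂) ((nerve F).obj E₃)).hom.natTrans.app _
          (tm (tm (toNerve x) (toNerve y)) (toNerve z))))
    rw [whiskerRight_tm, nerveMul_tm, nerveMul_tm, nerve_map_toNerve, associator_tm,
      naturality_apply, whiskerLeft_tm, nerveMul_tm, naturality_apply, nerveMul_tm, map_toNerve]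
    congr 1
    -- The remaining equality lives in `V`. Once the inner maps `δ` are moved out of the tensor
    -- products, it is the associativity of `δ` followed by naturality of the associator.
    have := Functor.OplaxMonoidal.associativity (F := F) p q r
    have h₁ : (δ F p q ≫ (x ⊗ₘ y)) ⊗ₘ z = δ F p q ▷ F.obj r ≫ ((x ⊗ₘ y) ⊗ₘ z) := by
      rw [← tensorHom_id, tensorHom_comp_tensorHom, Category.id_comp]
    have h₂ : x ⊗ₘ (δ F q r ≫ (y ⊗ₘ z)) = F.obj p ◁ δ F q r ≫ (x ⊗ₘ (y ⊗ₘ z)) := by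
      rw [← id_tensorHom, tensorHom_comp_tensorHom, Category.id_comp]
    rw [h₁, h₂, Category.assoc, Category.assoc, associator_naturality, reassoc_of% this]
  left_unitality E := by
    refine unit_tensor_hom_ext fun q (y : F.obj q ⟶ E) => ?_
    change (λ_ ((nerve F).obj E)).hom.natTrans.app _ (tm (nu B) (toNerve y)) =
      ((nerve F).map _).natTrans.app _ ((nerveMul F (𝟙_ V) E).natTrans.app _
        ((nerveUnit F ▷ (nerve F).obj E).natTrans.app _ (tm (nu B) (toNerve y))))
    rw [leftUnitor_tm, whiskerRight_tm, nerveUnit_nu, nerveMul_tm, nerve_map_toNerve, map_toNerve]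
    congr 1
    simp [MonoidalCategory.tensorHom_def, Functor.OplaxMonoidal.left_unitality_hom_assoc]
  right_unitality E := by
    refine tensor_unit_hom_ext fun q (y : F.obj q ⟶ E) => ?_
    change (ρ_ ((nerve F).obj E)).hom.natTrans.app _ (tm (toNerve y) (nu B)) =
      ((nerve F).map _).natTrans.app _ ((nerveMul F E (𝟙_ V)).natTrans.app _
        (((nerve F).obj E ◁ nerveUnit F).natTrans.app _ (tm (toNerve y) (nu B))))
    rw [rightUnitor_tm, whiskerLeft_tm, nerveUnit_nu, nerveMul_tm, nerve_map_toNerve, map_toNerve]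
    congr 1
    simp [MonoidalCategory.tensorHom_def', Functor.OplaxMonoidal.right_unitality_hom_assoc]

theorem nerve_μ_tm {E E' : V} {p q : B} (x : F.obj p ⟶ E) (y : F.obj q ⟶ E') :
    (μ (nerve F) E E').natTrans.app (op (p ⊗ q)) (tm (toNerve x) (toNerve y)) =
      toNerve (δ F p q ≫ (x ⊗ₘ y)) :=
  nerveMul_tm F x y

theorem nerve_ε_nu :
    (ε (nerve F)).natTrans.app (op (𝟙_ B)) (nu B) = toNerve (η F) :=
  nerveUnit_nu F

end nerve

/-! ### Left Kan extensions along the Yoneda embedding as colimits over elements. -/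

section elements

variable {X Y : Bᵒᵖ ⊛⥤ Type u}

variable (B) in
/-- The Yoneda embedding into presheaves with the Day convolution. -/
def yo : B ⥤ (Bᵒᵖ ⊛⥤ Type u) := uliftYoneda.{u} ⋙ (DayFunctor.equiv Bᵒᵖ (Type u)).inverse

/-- The morphism from a representable presheaf given by an element. -/
def el {p : B} (x : X.functor.obj (op p)) : (yo B).obj p ⟶ X := ⟨uliftYonedaEquiv.symm x⟩

/-- The identity as an element of a representable presheaf. -/
def yoId (p : B) : ((yo.{u} B).obj p).functor.obj (op p) := ULift.up (𝟙 p)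

/-- Naturality of the Yoneda correspondence in the representing object; `el_comp` is its naturality
in the presheaf. -/
theorem yo_map_el {p q : B} (f : p ⟶ q) (x : X.functor.obj (op q)) :
    (yo.{u} B).map f ≫ el x = el (X.functor.map f.op x) :=
  hom_ext fun _ g => map_comp g.down f x

theorem el_comp {p : B} (x : X.functor.obj (op p)) (g : X ⟶ Y) :
    el x ≫ g = el (g.natTrans.app (op p) x) :=
  hom_ext fun _ f => naturality_apply g f.down x

theorem el_id (p : B) : el (yoId.{u} p) = 𝟙 _ :=
  hom_ext fun _ f => congrArg ULift.up (Category.comp_id f.down)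

/-- The Yoneda lemma in the form used to replace objects of `CostructuredArrow (yo B) X` by elements
of `X`. -/
theorem el_eq {p : B} (g : (yo.{u} B).obj p ⟶ X) : el (g.natTrans.app (op p) (yoId p)) = g := by
  rw [← el_comp, el_id, Category.id_comp]

variable {F : B ⥤ V} {N : (Bᵒᵖ ⊛⥤ Type u) ⥤ V} (α : F ⟶ yo B ⋙ N)

/-- The morphism into a left Kan extension given by an element of a presheaf. -/
def elt {p : B} (x : X.functor.obj (op p)) : F.obj p ⟶ N.obj X := α.app p ≫ N.map (el x)

/-- This says that the morphisms `elt α x` form a cocone over the elements of `X`. When `N` is a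
pointwise left Kan extension, it is the colimit cocone, rewritten through the Yoneda lemma. -/
theorem map_elt {p q : B} (f : p ⟶ q) (x : X.functor.obj (op q)) :
    F.map f ≫ elt α x = elt α (X.functor.map f.op x) := by
  rw [elt, elt, ← yo_map_el, N.map_comp, ← Category.assoc, α.naturality]
  simp

theorem elt_map {p : B} (x : X.functor.obj (op p)) (g : X ⟶ Y) :
    elt α x ≫ N.map g = elt α (g.natTrans.app (op p) x) := by
  rw [elt, elt, ← el_comp, N.map_comp, Category.assoc]

theorem elt_id (p : B) : elt α (yoId p) = α.app p := by
  rw [elt, el_id, N.map_id]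
  exact Category.comp_id _

variable {α} (hα : (Functor.LeftExtension.mk N α).IsPointwiseLeftKanExtension)
  (T : V ⥤ V) [∀ X : Bᵒᵖ ⊛⥤ Type u, Limits.PreservesColimitsOfShape (CostructuredArrow (yo B) X) T]

include hα

/-- The functor `T` preserves the colimit that the pointwise Kan extension provides. It is a
parameter so that one statement covers `N.obj X` itself, with `T` the identity, and `N.obj X`
tensored on either side with a fixed object. -/
theorem hom_ext_of_elt {E : V} {g h : T.obj (N.obj X) ⟶ E}
    (H : ∀ (p : B) (x : X.functor.obj (op p)), T.map (elt α x) ≫ g = T.map (elt α x) ≫ h) :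
    g = h := by
  refine (Limits.isColimitOfPreserves T (hα X)).hom_ext fun j => ?_
  -- Every leg of the colimit cocone is of the form `elt α x`: take for `x` the element that
  -- corresponds to the arrow `j.hom` from a representable.
  have := H j.left (j.hom.natTrans.app (op j.left) (yoId _))
  rw [elt, el_eq] at this
  exact this

/-- Through the Yoneda lemma, a family indexed by elements and compatible with restriction is a
cocone over `CostructuredArrow (yo B) X`, so the colimit property applies. -/
theorem exists_desc {E : V}
    (φ : ∀ (p : B) (_ : X.functor.obj (op p)), T.obj (F.obj p) ⟶ E)
    (hφ : ∀ {p q : B} (f : p ⟶ q) (x : X.functor.obj (op q)),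
      T.map (F.map f) ≫ φ q x = φ p (X.functor.map f.op x)) :
    ∃ h : T.obj (N.obj X) ⟶ E, ∀ p x, T.map (elt α x) ≫ h = φ p x := by
  let c : Limits.Cocone ((CostructuredArrow.proj (yo B) X ⋙ F) ⋙ T) :=
    { pt := E
      ι :=
        { app j := φ j.left (j.hom.natTrans.app (op j.left) (yoId _))
          naturality i j f := by
            refine (hφ _ _).trans (.trans ?_ (Category.comp_id _).symm)
            congr 1
            -- A morphism of costructured arrows presents the element of its source as the
            -- restriction, along `f.left`, of the element of its target.
            rw [← CostructuredArrow.w f]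
            refine (naturality_apply j.hom f.left (yoId j.left)).symm.trans
              (congrArg (fun z => j.hom.natTrans.app (op i.left) z) ?_)
            exact congrArg ULift.up ((Category.comp_id f.left).trans (Category.id_comp _).symm) } }
  refine ⟨(Limits.isColimitOfPreserves T (hα X)).desc c, fun p x => ?_⟩
  refine ((Limits.isColimitOfPreserves T (hα X)).fac c (CostructuredArrow.mk (el x))).trans ?_
  -- The element recovered from the arrow `el x` is the restriction of `x` along the identity.
  change φ p (X.functor.map (𝟙 p).op x) = _
  rw [map_id]

end elements

/-! ### The adjunction with the nerve and the monoidal structure it induces. -/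

section adjunction

variable {X Y : Bᵒᵖ ⊛⥤ Type u} {F : B ⥤ V} {N : (Bᵒᵖ ⊛⥤ Type u) ⥤ V} {α : F ⟶ yo B ⋙ N}
  (hα : (Functor.LeftExtension.mk N α).IsPointwiseLeftKanExtension)

variable (α) in
/-- The map of presheaves corresponding to a morphism out of a left Kan extension. -/
def toHom {E : V} (h : N.obj X ⟶ E) : X ⟶ (nerve F).obj E where
  natTrans :=
    { app p := ↾fun x => toNerve (elt α (p := p.unop) x ≫ h)
      naturality p q f := by
        ext x
        change elt α (X.functor.map f.unop.op x) ≫ h = F.map f.unop ≫ elt α x ≫ h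
        rw [← map_elt, Category.assoc] }

-- A map from `X` to the nerve of `E` is a family of morphisms `F.obj p ⟶ E` indexed by the elements
-- of `X` and compatible with restriction. That is a cocone under the diagram whose colimit is
-- `N.obj X`, hence a single morphism out of `N.obj X`.
include hα in
theorem toHom_bijective (X : Bᵒᵖ ⊛⥤ Type u) (E : V) :
    Function.Bijective (toHom α : (N.obj X ⟶ E) → _) := by
  refine ⟨fun g h H => hom_ext_of_elt hα (𝟭 V) fun p x => ?_, fun g => ?_⟩
  · exact congrArg (fun t : X ⟶ (nerve F).obj E => t.natTrans.app (op p) x) H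
  · obtain ⟨h, hh⟩ := exists_desc (X := X) hα (𝟭 V) (E := E) (fun p x => g.natTrans.app (op p) x)
      (fun f x => (naturality_apply g f x).symm)
    exact ⟨h, hom_ext fun p x => hh p x⟩

/-- A left Kan extension along the Yoneda embedding is left adjoint to the nerve. -/
def adj : N ⊣ nerve F :=
  Adjunction.mkOfHomEquiv
    { homEquiv X E := Equiv.ofBijective _ (toHom_bijective hα X E)
      homEquiv_naturality_left_symm {X' X E} f g := by
        -- Writing the given map as `toHom α h` removes the inverse of the equivalence; naturality
        -- is then a computation on elements with `elt_map`.
        obtain ⟨h, rfl⟩ := (toHom_bijective hα X E).2 g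
        rw [Equiv.symm_apply_eq, Equiv.ofBijective_symm_apply_apply]
        refine hom_ext fun p x => ?_
        change toNerve (elt α (f.natTrans.app (op p) x) ≫ h) = toNerve (elt α x ≫ N.map f ≫ h)
        rw [← elt_map, Category.assoc]
      homEquiv_naturality_right {X E E'} f g := by
        refine hom_ext fun p x => ?_
        exact congrArg toNerve (Category.assoc (elt α x) f g).symm }

theorem adj_homEquiv {E : V} (h : N.obj X ⟶ E) : (adj hα).homEquiv X E h = toHom α h := by
  rw [adj, Adjunction.mkOfHomEquiv_homEquiv]
  rfl

/-- The unit is the transpose of the identity of `N.obj X`, and `toHom` evaluates at `x` by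
precomposing with `elt α x`. -/
theorem adj_unit_app {p : B} (x : X.functor.obj (op p)) :
    ((adj hα).unit.app X).natTrans.app (op p) x = toNerve (elt α x) := by
  rw [← Adjunction.homEquiv_id, adj_homEquiv]
  exact congrArg toNerve (Category.comp_id (elt α x))

open Functor.LaxMonoidal Functor.OplaxMonoidal

variable [MonoidalCategory V]

section

variable [F.OplaxMonoidal]

/-- The oplax structure of a left adjoint is the mate of the lax structure of its right adjoint.
Evaluate the transpose of `δ N X Y` at the generator `tm x y`: the two units give `elt α x` and `elt
α y`, and the multiplication of the nerve contributes `δ F p q`. Thus the abstractly defined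
comparison map of `N` restricts on elements to that of `F`. -/
theorem elt_tm_δ {p q : B} (x : X.functor.obj (op p)) (y : Y.functor.obj (op q)) :
    letI := (adj hα).leftAdjointOplaxMonoidal
    elt α (tm x y) ≫ δ N X Y = δ F p q ≫ (elt α x ⊗ₘ elt α y) := by
  let := (adj hα).leftAdjointOplaxMonoidal
  have h : (adj hα).homEquiv _ _ (δ N X Y) =
      ((adj hα).unit.app X ⊗ₘ (adj hα).unit.app Y) ≫ μ (nerve F) _ _ :=
    -- `δ N X Y` is by definition the preimage of this composite under the hom-set bijection of the
    -- adjunction.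
    Equiv.apply_symm_apply _ _
  rw [adj_homEquiv] at h
  have h' := congrArg (fun t => t.natTrans.app (op (p ⊗ q)) (tm x y)) h
  refine h'.trans ((comp_app _).trans ?_)
  rw [tensorHom_tm, adj_unit_app, adj_unit_app]
  exact nerve_μ_tm F (elt α x) (elt α y)

/-- The argument of `elt_tm_δ` for the unit: the transpose of `η N` is the unit map of the nerve,
which takes `nu B` to `η F`. -/
theorem elt_nu_η :
    letI := (adj hα).leftAdjointOplaxMonoidal
    elt α (nu B) ≫ η N = η F := by
  let := (adj hα).leftAdjointOplaxMonoidal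
  have h : (adj hα).homEquiv _ _ (η N) = ε (nerve F) := Equiv.apply_symm_apply _ _
  rw [adj_homEquiv] at h
  have h' := congrArg (fun t => t.natTrans.app (op (𝟙_ B)) (nu B)) h
  exact h'.trans (nerve_ε_nu F)

end

/-- The inverse is `ε F` followed by the morphism that `nu B` names. By `elt_nu_η` both composites
reduce to `ε F` and `η F` being mutually inverse, since every element of the unit presheaf is a
restriction of `nu B`. No preservation of colimits by the tensor product is needed here. -/
theorem isIso_η [F.Monoidal] :
    letI := (adj hα).leftAdjointOplaxMonoidal
    IsIso (η N) := by
  let := (adj hα).leftAdjointOplaxMonoidal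
  refine ⟨ε F ≫ elt α (nu B), hom_ext_of_elt hα (𝟭 V) fun p x => ?_, ?_⟩
  · obtain ⟨f, rfl⟩ := exists_nu x
    change elt α ((𝟙_ (Bᵒᵖ ⊛⥤ Type u)).functor.map f.op (nu B)) ≫ η N ≫ ε F ≫ elt α (nu B) =
      elt α ((𝟙_ (Bᵒᵖ ⊛⥤ Type u)).functor.map f.op (nu B)) ≫ 𝟙 _
    rw [← map_elt, Category.assoc, ← Category.assoc (elt α (nu B)), elt_nu_η,
      Functor.Monoidal.η_ε_assoc, Category.comp_id]
  · rw [Category.assoc, elt_nu_η, Functor.Monoidal.ε_η]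

variable [∀ (E : V) (X : Bᵒᵖ ⊛⥤ Type u),
    Limits.PreservesColimitsOfShape (CostructuredArrow (yo B) X) (tensorLeft E)]
  [∀ (E : V) (X : Bᵒᵖ ⊛⥤ Type u),
    Limits.PreservesColimitsOfShape (CostructuredArrow (yo B) X) (tensorRight E)]

-- Because the tensor product preserves the colimits in each variable, `N.obj X ⊗ N.obj Y` is glued
-- from the objects `F.obj p ⊗ F.obj q`. The uniqueness is applied in `Y` with `N.obj X` fixed, and
-- then in `X` with `F.obj q` fixed.
include hα in
theorem tensor_hom_ext_of_elt {E : V} {g h : N.obj X ⊗ N.obj Y ⟶ E}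
    (H : ∀ (p q : B) (x : X.functor.obj (op p)) (y : Y.functor.obj (op q)),
      (elt α x ⊗ₘ elt α y) ≫ g = (elt α x ⊗ₘ elt α y) ≫ h) : g = h := by
  refine hom_ext_of_elt hα (tensorLeft (N.obj X)) fun q y => ?_
  refine hom_ext_of_elt hα (tensorRight (F.obj q)) fun p x => ?_
  have := H p q x y
  rw [MonoidalCategory.tensorHom_def, Category.assoc, Category.assoc] at this
  exact this

-- The existence half of the same description. For fixed `y` the family descends in `x` to a map `ψ
-- q y` out of `N.obj X ⊗ F.obj q`; these maps are compatible in `y`, so they descend once more.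
include hα in
theorem exists_tensor_desc {E : V}
    (φ : ∀ (p q : B) (_ : X.functor.obj (op p)) (_ : Y.functor.obj (op q)),
      F.obj p ⊗ F.obj q ⟶ E)
    (hφ : ∀ {p q p' q' : B} (f : p' ⟶ p) (g : q' ⟶ q) x y,
      (F.map f ⊗ₘ F.map g) ≫ φ p q x y =
        φ p' q' (X.functor.map f.op x) (Y.functor.map g.op y)) :
    ∃ h : N.obj X ⊗ N.obj Y ⟶ E, ∀ p q (x : X.functor.obj (op p)) (y : Y.functor.obj (op q)),
      (elt α x ⊗ₘ elt α y) ≫ h = φ p q x y := by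
  have h₁ (q : B) (y : Y.functor.obj (op q)) := exists_desc (X := X) hα (tensorRight (F.obj q))
    (E := E) (fun p x => φ p q x y) (fun f x => by
      have := hφ f (𝟙 q) x y
      rwa [map_id, F.map_id, tensorHom_id] at this)
  choose ψ hψ using h₁
  obtain ⟨h, hh⟩ := exists_desc (X := Y) hα (tensorLeft (N.obj X)) (E := E) ψ (fun {q' q} g y => by
    -- Compatibility of `ψ` in `y` is tested on elements of `X`. There it is the hypothesis `hφ`
    -- with the identity in the first variable, after the two whiskerings are exchanged.
    refine hom_ext_of_elt hα (tensorRight (F.obj q')) fun p x => ?_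
    refine .trans ?_ (hψ _ _ _ _).symm
    have := hφ (𝟙 p) g x y
    rw [map_id, F.map_id, id_tensorHom, ← hψ] at this
    rw [← this]
    exact (whisker_exchange_assoc _ _ _).symm)
  refine ⟨h, fun p q x y => ?_⟩
  rw [MonoidalCategory.tensorHom_def, Category.assoc]
  exact (congrArg (fun t => elt α x ▷ F.obj q ≫ t) (hh q y)).trans (hψ q y p x)

variable [F.Monoidal]

/-- The inverse is glued from the maps `μ F p q ≫ elt α (tm x y)`, which are compatible with
restriction by naturality of `μ` and by `map_tm`. On elements `δ N X Y` is `δ F p q`, so both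
composites are the identity because `δ F` and `μ F` are inverse to each other. -/
theorem isIso_δ (X Y : Bᵒᵖ ⊛⥤ Type u) :
    letI := (adj hα).leftAdjointOplaxMonoidal
    IsIso (δ N X Y) := by
  let := (adj hα).leftAdjointOplaxMonoidal
  obtain ⟨h, hh⟩ := exists_tensor_desc (X := X) (Y := Y) hα (E := N.obj (X ⊗ Y))
    (fun p q x y => μ F p q ≫ elt α (tm x y)) (fun f g x y => by
      rw [μ_natural_assoc, map_elt, map_tm])
  -- Endomorphisms of `N.obj (X ⊗ Y)` are compared on elements of `X ⊗ Y`, which by `exists_tm` are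
  -- restrictions of some `tm x y`; those of `N.obj X ⊗ N.obj Y` are compared on pairs of elements.
  refine ⟨h, hom_ext_of_elt hα (𝟭 V) fun r z => ?_, tensor_hom_ext_of_elt hα fun p q x y => ?_⟩
  · obtain ⟨p, q, f, x, y, rfl⟩ := exists_tm z
    change elt α ((X ⊗ Y).functor.map f.op (tm x y)) ≫ δ N X Y ≫ h =
      elt α ((X ⊗ Y).functor.map f.op (tm x y)) ≫ 𝟙 _
    rw [← map_elt, Category.assoc, ← Category.assoc (elt α (tm x y)), elt_tm_δ, Category.assoc, hh,
      Functor.Monoidal.δ_μ_assoc, Category.comp_id]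
  · rw [reassoc_of% hh p q x y, elt_tm_δ, Functor.Monoidal.μ_δ_assoc, Category.comp_id]

/-- A left Kan extension of a monoidal functor along the Yoneda embedding is monoidal. -/
abbrev kanMonoidal : N.Monoidal :=
  letI := (adj hα).leftAdjointOplaxMonoidal
  letI := isIso_η hα
  letI := isIso_δ hα
  Functor.Monoidal.ofOplaxMonoidal N

/-- This is `elt_tm_δ` read backwards: cancel `δ N X Y`, which is now the inverse of `μ N X Y`. -/
theorem elt_tensorHom_μ {p q : B} (x : X.functor.obj (op p)) (y : Y.functor.obj (op q)) :
    letI := kanMonoidal hα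
    (elt α x ⊗ₘ elt α y) ≫ μ N X Y = μ F p q ≫ elt α (tm x y) := by
  let := kanMonoidal hα
  have h : elt α (tm x y) ≫ δ N X Y = δ F p q ≫ (elt α x ⊗ₘ elt α y) := elt_tm_δ hα x y
  rw [← cancel_mono (δ N X Y), Category.assoc, Category.assoc, h, Functor.Monoidal.μ_δ,
    Functor.Monoidal.μ_δ_assoc, Category.comp_id]

/-- Specialise to the tautological elements of two representables, whose associated morphisms are
the components of `α`. The map `g` then enters only through its value on the generator they define.
-/
theorem app_tensorHom_μ_map {p q : B} {Z : Bᵒᵖ ⊛⥤ Type u}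
    (g : (yo.{u} B).obj p ⊗ (yo.{u} B).obj q ⟶ Z) :
    letI := kanMonoidal hα
    (α.app p ⊗ₘ α.app q) ≫ μ N ((yo B).obj p) ((yo B).obj q) ≫ N.map g =
      μ F p q ≫ elt α (g.natTrans.app (op (p ⊗ q)) (tm (yoId p) (yoId q))) := by
  have h := elt_tensorHom_μ hα (yoId p) (yoId q)
  rw [elt_id, elt_id] at h
  rw [← elt_map]
  exact (reassoc_of% h) (N.map g)

end adjunction

end Day

end

end CubChains

end

/-! ### The functor of cubical chains. -/

theorem lemmal (k : Type u) [CommRing k] :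
    cubes.{u}.HasPointwiseLeftKanExtension (cubeChains k) ∧
    ∀ (N : CubSet.{u} ⥤ Coalg (M k)) (α : cubeChains k ⟶ cubes ⋙ N) [N.IsLeftKanExtension α],
      ∃ _ : N.Monoidal, ∀ p q : Cube,
        (α.app p ⊗ₘ α.app q) ≫ Functor.LaxMonoidal.μ N (cubes.obj p) (cubes.obj q) ≫
            N.map (cubesMul p q) =
          (Coalg.cubeMul k p.dim q.dim).hom ≫ α.app (p ⊗ q) := by
  refine ⟨cubes_hasPointwiseLeftKanExtension k, fun N α _ => ?_⟩
  have := cubes_hasPointwiseLeftKanExtension.{u} k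
  -- Since a pointwise left Kan extension exists, every left Kan extension is pointwise, so the
  -- general results apply to an arbitrary `N`. The functors `cubes` and `Day.yo Cube` agree by
  -- definition.
  have hα : (Functor.LeftExtension.mk (L := Day.yo.{u} Cube) N α).IsPointwiseLeftKanExtension :=
    Functor.isPointwiseLeftKanExtensionOfIsLeftKanExtension N α
  -- The inputs found by instance search are the monoidal structure on `cubeChains k`, whose
  -- multiplication is `Coalg.cubeMul`, and the preservation of colimits by tensoring with a
  -- coalgebra on either side.
  let := Day.kanMonoidal hα
  refine ⟨this, fun p q => ?_⟩
  refine (Day.app_tensorHom_μ_map hα (cubesMul p q)).trans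
    (congrArg ((Coalg.cubeMul k p.dim q.dim).hom ≫ ·) (.trans ?_ (Day.elt_id α (p ⊗ q))))
  -- It remains to see that `cubesMul p q` sends the generator given by the two identities to the
  -- tautological element of `p ⊗ q`: its value there is the tensor product of two identities.
  congr 1
  exact (Day.tensorDesc_tm _ _ _).trans (congrArg ULift.up (id_tensorHom_id p q))
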